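/- Let $k$ be a field of characteristic zero and $n \ge 0$. Let $A_n$ be the commutative $k$-algebra with generators $a_0,a_1,a_2,\ldots$ and $b_{-1},\ldots,b_{-n}$, and with the relations obtained by equating, for every $m\in\mathbb Z$, the coefficients of $t^m$ in the identity of formal Laurent series $$\sum_{i\ge 0} i\,a_i t^{i-1} = \Big(\sum_{i\ge 0} a_i t^i\Big)\Big(\sum_{j=1}^{n} b_{-j}t^{-j}\Big).$$ For a commutative ring $A$, let $D(A)$ be its (DG) derived category with cohomological grading, and let $D(A)^{\ge m}$ be the subcategory of objects with cohomology in degrees $\ge m$ only. An object $M$ of $D(A)$ is called bounded below if it lies in $D(A)^{\ge m}$ for some $m\in\mathbb Z$, and coherent if it is bounded below and, for every integer $m$, the functor $\mathrm{Hom}(M,-)$ commutes with filtered colimits in $D(A)^{\ge m}$. The ring $A$ is called semi-coherent if for every bounded below $M\in D(A)$ there is an integer $r$ such that $M$ is a filtered colimit of coherent objects $M_i$, all of which lie in $D(A)^{\ge -r}$. Then $A_n$ is semi-coherent for every $n\ge 0$, and it is not Noetherian for $n\ge 1$. Moreover, $A_1$ is a coherent ring, i.e., each of its finitely generated ideals is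 finitely presented. -/

import Mathlib

universe w u

open CategoryTheory Limits Opposite

namespace SemiCoh

noncomputable section

section Ring

variable (k : Type u) [CommRing k] (n : ℕ)

/-- The free commutative `k`-algebra on the symbols `a_0, a_1, a_2, …` and `b_{-1}, …, b_{-n}`.
The variable `Sum.inl i` is `a_i`, and `Sum.inr j`, for `j : Fin n`, is `b_{-(j+1)}`. -/
abbrev FreeAlg : Type u := MvPolynomial (ℕ ⊕ Fin n) k

/-- The formal series `∑_{i ≥ 0} a_i t^i`, as a Laurent series. -/
def aSeries : LaurentSeries (FreeAlg k n) :=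
  HahnSeries.ofPowerSeries ℤ (FreeAlg k n) (PowerSeries.mk fun i => MvPolynomial.X (Sum.inl i))

/-- The polar part `∑_{j = 1}^n b_{-j} t^{-j}`, as a Laurent series. -/
def bSeries : LaurentSeries (FreeAlg k n) :=
  ∑ j : Fin n, HahnSeries.single (-((j : ℤ) + 1)) (MvPolynomial.X (Sum.inr j))

/-- The ideal generated by the differences of the coefficients at `t^m` (`m ∈ ℤ`) of the two sides
of `∑ i a_i t^{i-1} = (∑ a_i t^i) (∑ b_{-j} t^{-j})`. -/
def relations : Ideal (FreeAlg k n) :=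
  Ideal.span (Set.range fun m : ℤ =>
    (LaurentSeries.derivative (FreeAlg k n) (aSeries k n)).coeff m -
      (aSeries k n * bSeries k n).coeff m)

/-- The ring `A_n`. -/
abbrev A : Type u := FreeAlg k n ⧸ relations k n

end Ring

/-- A commutative ring is coherent if each of its finitely generated ideals is finitely presented
as a module. -/
def IsCoherentRing (R : Type u) [CommRing R] : Prop :=
  ∀ I : Ideal R, I.FG → Module.FinitePresentation R I

section Derived

/- In this section the derived category `D(R)` of `R`-modules is Mathlib's `DerivedCategory`, which
is formed with respect to a choice `HasDerivedCategory` of a localization of the category of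
cochain complexes at the quasi-isomorphisms. Such a choice exists, and any two are equivalent.

Filtered colimits in the (∞-categorical, or DG) derived category are computed by strict diagrams
`F` of cochain complexes indexed by small filtered categories: termwise filtered colimits of
modules are exact, so that `colimit F` is the homotopy colimit of `F`, and every filtered diagram
is represented by a strict one. -/

variable {R : Type u} [CommRing R] [HasDerivedCategory.{w} (ModuleCat.{u} R)]

/-- `M ∈ Coh(R)`: the object `M` is bounded below, and for each `n` the functor `Hom(M, -)`
commutes with filtered colimits in `D(R)^{≥ n}`. As `n` is any integer and the diagram is
arbitrary, its shifts are included, so that this is a statement on the whole complex of maps. -/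
structure IsCoherent (M : DerivedCategory (ModuleCat.{u} R)) : Prop where
  bounded_below : ∃ n : ℤ, M.IsGE n
  preserves : ∀ (n : ℤ) (J : Type u) [SmallCategory J] [IsFiltered J]
    (F : J ⥤ CochainComplex (ModuleCat.{u} R) ℤ),
    (∀ j, (DerivedCategory.Q.obj (F.obj j)).IsGE n) →
      PreservesColimit F (DerivedCategory.Q ⋙ coyoneda.obj (op M))

/-- `M` is a filtered colimit of coherent objects, all of which lie in `D(R)^{≥ -r}`. -/
def IsGoodWith (r : ℤ) (M : DerivedCategory (ModuleCat.{u} R)) : Prop :=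
  ∃ (J : Type u) (_ : SmallCategory J) (_ : IsFiltered J)
    (F : J ⥤ CochainComplex (ModuleCat.{u} R) ℤ),
    (∀ j, IsCoherent (DerivedCategory.Q.obj (F.obj j))) ∧
    (∀ j, (DerivedCategory.Q.obj (F.obj j)).IsGE (-r)) ∧
    Nonempty (DerivedCategory.Q.obj (colimit F) ≅ M)

variable (R) in
/-- The ring `R` is semi-coherent: each bounded below object `M` of `D(R)` is a filtered colimit of
coherent objects that lie in `D(R)^{≥ -r}`, for some integer `r`. -/
def IsSemiCoherent : Prop :=
  ∀ M : DerivedCategory (ModuleCat.{u} R), (∃ n : ℤ, M.IsGE n) → ∃ r : ℤ, IsGoodWith r M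

end Derived

end

end SemiCoh

/-!
# Semi-coherence of the rings `A n`

Write `a_j`, `b_{-j}` for the generators of `A n`. For `n ≥ 1`, the relations are `∑_{p + j = l}
β_{p,j} a_j = 0` for `l ≥ 0`, where `β_{p,j}` is `b_{-(n-p)}`, with the integer `j` subtracted if it
is `b_{-1}`, and zero for `p ≥ n` (`relations_eq_idl`). Let `R_i` be the Noetherian ring with the
generators `a_j` for `j < i`, all `b`'s, and the relations for `l < i`; then `A n` is the colimit of
the `R_i` (`noetherianSystem`). Semi-coherence rests on the fact that `A n` has flat dimension at
most `d = 2n` over each `R_i` (`flatDimHomLE_toLim`), a bound independent of `i`.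

*The flat dimension.* Modulo the `a_j` with `j < s` and the `β_{p,s}` with `p < r`, the first
nontrivial relation says `β_{r,s} a_s = 0`, and in fact `a_s` and `β_{r,s}` are each other's
annihilators, in the truncated ring and in its limit (`of_mul_mem_idl_Iio`). In this situation the
flat dimension is bounded by those of the two quotients (`FlatDimLE.of_isReductionMod`), in which
`s` and `r`, respectively, have grown by one. The process ends with polynomial rings in at most `2n`
variables, where Hilbert's syzygy theorem applies (`WeakDimLE.mvPolynomial`). Characteristic zero
enters when `r = n`: then `b_{-1} = s`, and the relations can be solved for the `a_j` with `j > s`,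
except for the last few, because `s - j` is invertible.

*Semi-coherence.* A bounded below complex of modules over a colimit of Noetherian rings is a
filtered colimit of bounded complexes of finite modules over these rings (`CxSystem.initial`).
Replacing all terms of such a system by first syzygies, at the cost of one more degree below, and
repeating this `d` times, one arrives at complexes of finite modules that are Tor-acyclic with
respect to `A n` (`exists_cxSystem`). A free cover of such a complex has a kernel of the same kind,
in the same degrees, and the sequence remains exact after base change to `A n`. Maps from bounded
complexes of finite free modules commute with filtered colimits, and there are no nonzero maps from
objects in low degrees to objects in high degrees; repeated passage to the kernel therefore shows
that the base change is coherent (`Cx.FinTor.isCoherent`). The lower bound on degrees is the same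
for all members of the system, so that the given object is a filtered colimit of coherent objects in
`D^{≥ -r}` (`NoetherianSystem.isSemiCoherent`). The ring `A 0` is Noetherian, and the same theorem
applies to it, with a constant system.

*Noetherianity.* For `n ≥ 1` and each `j`, there is a homomorphism from `A n` to a polynomial ring
in one variable `y` that maps `b_{-1}` to `j`, `a_j` to `y`, and all other generators to zero. Thus
the ideals generated by `a_0, …, a_{j-1}` form a strictly increasing chain (`not_isNoetherianRing`).

*Coherence of `A 1`.* Here `b_{-1} a_j = j a_j` and `a_i a_j = 0` for `i ≠ j`. Finitely many
elements `g_l` lie in the image of `R_i` for large `i`, which is a Noetherian retract of `A 1`, so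
that the relations with coefficients there are finitely generated. The other relations have
coefficients in the ideal generated by the `a_j` with `j ≥ i`. On that ideal, some `g_m` acts
invertibly, and these relations come from Koszul relations, or all `g_l` are killed by an element
that acts invertibly (`B.isCoherentRing`).
-/

namespace SemiCoh

/-! ### Flat dimension -/

section TensorLemmas

open TensorProduct

variable {R : Type*} [CommRing R]
  {K F Y S₁ G S : Type*} [AddCommGroup K] [AddCommGroup F] [AddCommGroup Y]
  [AddCommGroup S₁] [AddCommGroup G] [AddCommGroup S]
  [Module R K] [Module R F] [Module R Y] [Module R S₁] [Module R G] [Module R S]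
  {i : K →ₗ[R] F} {p : F →ₗ[R] Y} {j : S₁ →ₗ[R] G} {π : G →ₗ[R] S}

/-- Balancing of `Tor₁(Y, S)`: computed with a presentation of `Y` or with one of `S`. -/
theorem lTensor_injective_of_rTensor_injective [Module.Flat R F]
    (hip : Function.Exact i p) (hp : Function.Surjective p)
    (hj : Function.Injective j) (hjπ : Function.Exact j π) (hπ : Function.Surjective π)
    (h : Function.Injective (i.rTensor S)) : Function.Injective (j.lTensor Y) := by
  rw [injective_iff_map_eq_zero]
  intro y hy
  obtain ⟨f, rfl⟩ := LinearMap.rTensor_surjective S₁ hp y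
  have h1 : p.rTensor G (j.lTensor F f) = 0 := by
    rw [← LinearMap.comp_apply, LinearMap.rTensor_comp_lTensor,
      ← LinearMap.lTensor_comp_rTensor]
    exact hy
  obtain ⟨k, hk⟩ := (rTensor_exact G hip hp _).1 h1
  have h2 : π.lTensor K k = 0 := by
    apply h
    rw [map_zero, ← LinearMap.comp_apply, LinearMap.rTensor_comp_lTensor,
      ← LinearMap.lTensor_comp_rTensor, LinearMap.comp_apply, hk]
    exact (lTensor_exact F hjπ hπ).apply_apply_eq_zero f
  obtain ⟨k₁, rfl⟩ := (lTensor_exact K hjπ hπ _).1 h2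
  have h3 : i.rTensor S₁ k₁ = f := by
    apply Module.Flat.lTensor_preserves_injective_linearMap (M := F) j hj
    rw [← hk, ← LinearMap.comp_apply, LinearMap.lTensor_comp_rTensor,
      ← LinearMap.rTensor_comp_lTensor, LinearMap.comp_apply]
  rw [← h3]
  exact (rTensor_exact S₁ hip hp).apply_apply_eq_zero k₁

theorem rTensor_injective_of_lTensor_injective [Module.Flat R G]
    (hi : Function.Injective i) (hip : Function.Exact i p) (hp : Function.Surjective p)
    (hjπ : Function.Exact j π) (hπ : Function.Surjective π)
    (h : Function.Injective (j.lTensor Y)) : Function.Injective (i.rTensor S) := by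
  rw [← LinearMap.lTensor_inj_iff_rTensor_inj]
  rw [LinearMap.lTensor_inj_iff_rTensor_inj] at h
  exact lTensor_injective_of_rTensor_injective hjπ hπ hi hip hp h

/-- `Tor₁(Y, S) = 0` for flat `Y`. -/
theorem rTensor_injective_of_flat_quotient [Module.Flat R Y]
    (hi : Function.Injective i) (hip : Function.Exact i p) (hp : Function.Surjective p)
    (S : Type*) [AddCommGroup S] [Module R S] : Function.Injective (i.rTensor S) := by
  let π := Finsupp.linearCombination R (id : S → S)
  have hπ : Function.Exact (LinearMap.ker π).subtype π := LinearMap.exact_subtype_ker_map π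
  refine rTensor_injective_of_lTensor_injective (S₁ := LinearMap.ker π)
    (j := (LinearMap.ker π).subtype) (π := π) hi hip hp hπ
    (Finsupp.linearCombination_id_surjective R S) ?_
  exact Module.Flat.lTensor_preserves_injective_linearMap _ (Submodule.injective_subtype _)

/-- The kernel of a surjection of flat modules is flat. -/
theorem flat_left_of_exact [Module.Flat R F] [Module.Flat R Y]
    (hi : Function.Injective i) (hip : Function.Exact i p) (hp : Function.Surjective p) :
    Module.Flat R K := by
  rw [Module.Flat.iff_lTensor_preserves_injective_linearMap]
  intro N N' _ _ _ _ f hf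
  have h1 : Function.Injective (f.lTensor F ∘ₗ i.rTensor N) :=
    (Module.Flat.lTensor_preserves_injective_linearMap f hf).comp
      (rTensor_injective_of_flat_quotient hi hip hp N)
  rw [LinearMap.lTensor_comp_rTensor, ← LinearMap.rTensor_comp_lTensor] at h1
  exact Function.Injective.of_comp h1

theorem flat_middle_of_exact [Module.Flat R K] [Module.Flat R Y]
    (hi : Function.Injective i) (hip : Function.Exact i p) (hp : Function.Surjective p) :
    Module.Flat R F := by
  rw [Module.Flat.iff_lTensor_preserves_injective_linearMap]
  intro N N' _ _ _ _ f hf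
  rw [injective_iff_map_eq_zero]
  intro x hx
  have h1 : p.rTensor N x = 0 := by
    apply Module.Flat.lTensor_preserves_injective_linearMap (M := Y) f hf
    rw [← LinearMap.comp_apply, LinearMap.lTensor_comp_rTensor,
      ← LinearMap.rTensor_comp_lTensor, LinearMap.comp_apply, hx, map_zero, map_zero]
  obtain ⟨y, rfl⟩ := (rTensor_exact N hip hp x).1 h1
  have h2 : y = 0 := by
    apply Module.Flat.lTensor_preserves_injective_linearMap (M := K) f hf
    apply rTensor_injective_of_flat_quotient hi hip hp N'
    rw [← LinearMap.comp_apply, LinearMap.rTensor_comp_lTensor,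
      ← LinearMap.lTensor_comp_rTensor, LinearMap.comp_apply, hx, map_zero, map_zero]
  rw [h2, map_zero]

end TensorLemmas

section FlatDim

/-- The first syzygy of `X`: the kernel of the canonical surjection from the free module on the
underlying set of `X`. -/
noncomputable abbrev syz (R : Type u) [CommRing R] (X : Type u) [AddCommGroup X] [Module R X] :
    Submodule R (X →₀ R) :=
  LinearMap.ker (Finsupp.linearCombination R (id : X → X))

/-- `FlatDimLE R d X`: the `R`-module `X` has flat dimension at most `d`, that is, its `d`-th
syzygy in the canonical free resolution is flat. -/
def FlatDimLE (R : Type u) [CommRing R] :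
    ℕ → ∀ (X : Type u) [AddCommGroup X] [Module R X], Prop
  | 0, X, _, _ => Module.Flat R X
  | d + 1, X, _, _ => FlatDimLE R d (syz R X)

variable {R : Type u} [CommRing R]

/-- Schanuel's lemma for flat covers: if flat dimension at most `d` does not change when passing to
an extension by a flat module, then it is the same for the kernels of any two flat covers. -/
theorem FlatDimLE.iff_of_covers {d : ℕ}
    (hB : ∀ {K E L : Type u} [AddCommGroup K] [Module R K] [AddCommGroup E] [Module R E]
      [AddCommGroup L] [Module R L] [Module.Flat R L] (i : K →ₗ[R] E) (p : E →ₗ[R] L),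
      Function.Injective i → Function.Exact i p → Function.Surjective p →
      (FlatDimLE R d K ↔ FlatDimLE R d E))
    {K L K' L' X : Type u} [AddCommGroup K] [Module R K] [AddCommGroup L] [Module R L]
    [AddCommGroup K'] [Module R K'] [AddCommGroup L'] [Module R L'] [AddCommGroup X] [Module R X]
    [Module.Flat R L] [Module.Flat R L']
    (i : K →ₗ[R] L) (p : L →ₗ[R] X) (hi : Function.Injective i) (hip : Function.Exact i p)
    (hp : Function.Surjective p)
    (i' : K' →ₗ[R] L') (p' : L' →ₗ[R] X) (hi' : Function.Injective i')
    (hip' : Function.Exact i' p') (hp' : Function.Surjective p') :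
    FlatDimLE R d K ↔ FlatDimLE R d K' := by
  let E : Submodule R (L × L') := LinearMap.ker (p.coprod (-p'))
  have hE : ∀ x : L × L', x ∈ E ↔ p x.1 = p' x.2 := fun x => by
    simp [E, LinearMap.mem_ker, ← sub_eq_add_neg, sub_eq_zero]
  let iK : K →ₗ[R] E := LinearMap.codRestrict E (LinearMap.inl R L L' ∘ₗ i) fun k => by
    rw [hE]; simp [hip.apply_apply_eq_zero]
  let iK' : K' →ₗ[R] E := LinearMap.codRestrict E (LinearMap.inr R L L' ∘ₗ i') fun k => by
    rw [hE]; simp [hip'.apply_apply_eq_zero]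
  refine (hB iK (LinearMap.snd R L L' ∘ₗ E.subtype) ?_ ?_ ?_).trans
    (hB iK' (LinearMap.fst R L L' ∘ₗ E.subtype) ?_ ?_ ?_).symm
  · intro a b h
    exact hi (congrArg (fun x : E => x.1.1) h)
  · rintro ⟨⟨l, l'⟩, hx⟩
    rw [hE] at hx
    constructor
    · intro h
      obtain rfl : l' = 0 := h
      obtain ⟨k, rfl⟩ := (hip l).1 (by simpa using hx)
      exact ⟨k, rfl⟩
    · rintro ⟨k, hk⟩
      exact (congrArg (fun x : E => x.1.2) hk).symm
  · intro l'
    obtain ⟨l, hl⟩ := hp (p' l')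
    exact ⟨⟨(l, l'), (hE _).2 hl⟩, rfl⟩
  · intro a b h
    exact hi' (congrArg (fun x : E => x.1.2) h)
  · rintro ⟨⟨l, l'⟩, hx⟩
    rw [hE] at hx
    constructor
    · intro h
      obtain rfl : l = 0 := h
      obtain ⟨k, rfl⟩ := (hip' l').1 (by simpa using hx.symm)
      exact ⟨k, rfl⟩
    · rintro ⟨k, hk⟩
      exact (congrArg (fun x : E => x.1.1) hk).symm
  · intro l
    obtain ⟨l', hl⟩ := hp' (p l)
    exact ⟨⟨(l, l'), (hE _).2 hl.symm⟩, rfl⟩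

/-- Flat dimension at most `d` is insensitive to extensions by a flat module. -/
theorem FlatDimLE.iff_of_flat_quotient (d : ℕ) :
    ∀ {K E L : Type u} [AddCommGroup K] [Module R K] [AddCommGroup E] [Module R E]
      [AddCommGroup L] [Module R L] [Module.Flat R L] (i : K →ₗ[R] E) (p : E →ₗ[R] L),
      Function.Injective i → Function.Exact i p → Function.Surjective p →
      (FlatDimLE R d K ↔ FlatDimLE R d E) := by
  induction d with
  | zero =>
    intro K E L _ _ _ _ _ _ _ i p hi hip hp
    refine ⟨fun h => ?_, fun h => ?_⟩
    · have : Module.Flat R K := h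
      exact flat_middle_of_exact hi hip hp
    · have : Module.Flat R E := h
      exact flat_left_of_exact hi hip hp
  | succ d ih =>
    intro K E L _ _ _ _ _ _ _ i p hi hip hp
    let π := Finsupp.linearCombination R (id : E → E)
    have hπ : Function.Surjective π := Finsupp.linearCombination_id_surjective R E
    let V : Submodule R (E →₀ R) := LinearMap.ker (p ∘ₗ π)
    have hV : Function.Exact V.subtype (p ∘ₗ π) := LinearMap.exact_subtype_ker_map _
    have : Module.Flat R V :=
      flat_left_of_exact (K := V) (i := V.subtype) (p := p ∘ₗ π) V.injective_subtype hV (hp.comp hπ)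
    have hmem : ∀ v : V, π v ∈ LinearMap.range i := fun v => (hip _).1 v.2
    let ei := LinearEquiv.ofInjective i hi
    let q : V →ₗ[R] K := ei.symm ∘ₗ LinearMap.codRestrict (LinearMap.range i) (π ∘ₗ V.subtype) hmem
    have hq : ∀ v : V, i (q v) = π v := fun v => by
      have := ei.apply_symm_apply ⟨π v, hmem v⟩
      exact congrArg Subtype.val this
    have hsub : syz R E ≤ V := fun f hf => by
      have hf' : π f = 0 := hf
      change p (π f) = 0
      rw [hf', map_zero]
    refine FlatDimLE.iff_of_covers ih (K := syz R K) (K' := syz R E) (L' := V) (syz R K).subtype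
      (Finsupp.linearCombination R (id : K → K)) (Submodule.injective_subtype _)
      (LinearMap.exact_subtype_ker_map _) (Finsupp.linearCombination_id_surjective R K)
      (Submodule.inclusion hsub) q (Submodule.inclusion_injective hsub) ?_ ?_
    · intro v
      constructor
      · intro h
        have : π v = 0 := by rw [← hq, h, map_zero]
        exact ⟨⟨v, this⟩, rfl⟩
      · rintro ⟨f, rfl⟩
        apply hi
        rw [hq, map_zero]
        exact f.2
    · intro k
      obtain ⟨f, hf⟩ := hπ (i k)
      have hfV : f ∈ V := by
        change p (π f) = 0
        rw [hf, hip.apply_apply_eq_zero]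
      exact ⟨⟨f, hfV⟩, hi (by rw [hq]; exact hf)⟩

/-- Flat dimension may be computed with any flat cover. -/
theorem FlatDimLE.succ_iff {d : ℕ} {K L X : Type u} [AddCommGroup K] [Module R K]
    [AddCommGroup L] [Module R L] [AddCommGroup X] [Module R X] [Module.Flat R L]
    (i : K →ₗ[R] L) (p : L →ₗ[R] X) (hi : Function.Injective i) (hip : Function.Exact i p)
    (hp : Function.Surjective p) : FlatDimLE R (d + 1) X ↔ FlatDimLE R d K :=
  FlatDimLE.iff_of_covers (FlatDimLE.iff_of_flat_quotient d) (syz R X).subtype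
    (Finsupp.linearCombination R (id : X → X)) (Submodule.injective_subtype _)
    (LinearMap.exact_subtype_ker_map _) (Finsupp.linearCombination_id_surjective R X) i p hi hip hp

theorem FlatDimLE.succ {d : ℕ} {X : Type u} [AddCommGroup X] [Module R X]
    (h : FlatDimLE R d X) : FlatDimLE R (d + 1) X := by
  induction d generalizing X with
  | zero =>
    have : Module.Flat R X := h
    exact flat_left_of_exact (K := syz R X) (Submodule.injective_subtype _)
      (LinearMap.exact_subtype_ker_map (Finsupp.linearCombination R (id : X → X)))
      (Finsupp.linearCombination_id_surjective R X)
  | succ d ih => exact ih (X := syz R X) h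

theorem FlatDimLE.mono {d e : ℕ} (hde : d ≤ e) {X : Type u} [AddCommGroup X] [Module R X]
    (h : FlatDimLE R d X) : FlatDimLE R e X := by
  induction hde with
  | refl => exact h
  | step _ ih => exact ih.succ

/-! ### Flat dimension and reduction modulo an element -/

section Reduction

variable {R₁ R₂ : Type u} [CommRing R₁] [CommRing R₂]

/-- The additive map `g : X → X₁` exhibits the `R₁`-module `X₁` as `X / aX`, and the ring
homomorphism `f : R → R₁` exhibits `R₁` as `R / aR`. -/
structure IsReductionMod (a : R) (f : R →+* R₁) {X X₁ : Type u} [AddCommGroup X] [Module R X]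
    [AddCommGroup X₁] [Module R₁ X₁] (g : X →+ X₁) : Prop where
  surj_ring : Function.Surjective f
  ker_ring : ∀ r, f r = 0 ↔ ∃ r', r = a * r'
  surj : Function.Surjective g
  map_smul : ∀ r x, g (r • x) = f r • g x
  ker : ∀ x, g x = 0 ↔ ∃ x', x = a • x'

theorem isTrivialRelation_of_fintype {X : Type u} [AddCommGroup X] [Module R X] {ι κ : Type*}
    [Fintype ι] [Fintype κ] {f : ι → R} {x : ι → X} (c : ι → κ → R) (y : κ → X)
    (hx : ∀ i, x i = ∑ j, c i j • y j) (hc : ∀ j, ∑ i, f i * c i j = 0) :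
    Module.IsTrivialRelation f x := by
  let e := Fintype.equivFin κ
  refine ⟨Fintype.card κ, fun i j => c i (e.symm j), fun j => y (e.symm j), fun i => ?_,
    fun j => hc _⟩
  rw [hx, ← e.symm.sum_comp]

/-- Flatness is detected modulo two elements `a`, `b` that are each other's annihilators: apply the
equational criterion first modulo `a`, and then modulo `b` to the quotient by `a`. -/
theorem flat_of_isReductionMod {a b : R} (hab : a * b = 0)
    {f₁ : R →+* R₁} {f₂ : R →+* R₂} {X X₁ X₂ : Type u}
    [AddCommGroup X] [Module R X] [AddCommGroup X₁] [Module R₁ X₁] [AddCommGroup X₂] [Module R₂ X₂]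
    {g₁ : X →+ X₁} {g₂ : X →+ X₂} (h₁ : IsReductionMod a f₁ g₁) (h₂ : IsReductionMod b f₂ g₂)
    (ha : ∀ x : X, a • x = 0 → ∃ x', x = b • x')
    [Module.Flat R₁ X₁] [Module.Flat R₂ X₂] : Module.Flat R X := by
  refine Module.Flat.of_forall_isTrivialRelation fun {l f x} hfx => ?_
  have e1 : ∑ i, f₁ (f i) • g₁ (x i) = 0 := by
    rw [← map_zero g₁, ← hfx, map_sum]
    exact Finset.sum_congr rfl fun i _ => (h₁.map_smul _ _).symm
  obtain ⟨k, c', y', hxy, hfc⟩ := Module.Flat.isTrivialRelation_of_sum_smul_eq_zero e1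
  dsimp only at hxy hfc
  choose c hc using fun i j => h₁.surj_ring (c' i j)
  choose y hy using fun j => h₁.surj (y' j)
  have e2 : ∀ i, ∃ z, x i - ∑ j, c i j • y j = a • z := fun i => by
    rw [← h₁.ker, map_sub, map_sum, hxy, sub_eq_zero]
    exact Finset.sum_congr rfl fun j _ => by rw [h₁.map_smul, hc, hy]
  choose z hz using e2
  have e3 : ∀ j, ∃ s, ∑ i, f i * c i j = a * s := fun j => by
    rw [← h₁.ker_ring, map_sum, ← hfc j]
    exact Finset.sum_congr rfl fun i _ => by rw [map_mul, hc]
  choose s hs using e3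
  have hx : ∀ i, x i = ∑ j, c i j • y j + a • z i := fun i => by rw [← hz, add_sub_cancel]
  have e4 : a • (∑ j, s j • y j + ∑ i, f i • z i) = 0 := by
    have h1 : ∑ i, f i • (∑ j, c i j • y j) = ∑ j, (a * s j) • y j := by
      simp_rw [Finset.smul_sum, smul_smul, ← hs, Finset.sum_smul]
      exact Finset.sum_comm
    rw [← hfx]
    simp_rw [hx, smul_add, Finset.sum_add_distrib, h1, Finset.smul_sum, smul_smul, mul_comm a]
  obtain ⟨v, hv⟩ := ha _ e4
  have e5 : ∑ i : Fin k ⊕ Fin l, f₂ (Sum.elim s f i) • g₂ (Sum.elim y z i) = 0 := by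
    have : g₂ (∑ j, s j • y j + ∑ i, f i • z i) = 0 := (h₂.ker _).2 ⟨v, hv⟩
    rw [← this]
    simp [h₂.map_smul]
  obtain ⟨m, d', v', hv', hd'⟩ := Module.Flat.isTrivialRelation_of_sum_smul_eq_zero e5
  dsimp only at hv' hd'
  choose d hd using fun i j => h₂.surj_ring (d' i j)
  choose w hw using fun j => h₂.surj (v' j)
  have e6 : ∀ i : Fin k ⊕ Fin l, ∃ u, Sum.elim y z i - ∑ j, d i j • w j = b • u := fun i => by
    rw [← h₂.ker, map_sub, map_sum, hv', sub_eq_zero]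
    exact Finset.sum_congr rfl fun j _ => by rw [h₂.map_smul, hd, hw]
  choose u hu using e6
  have hyz : ∀ i : Fin k ⊕ Fin l, Sum.elim y z i = ∑ j, d i j • w j + b • u i := fun i => by
    rw [← hu, add_sub_cancel]
  have e7 : ∀ j, ∃ t, ∑ i : Fin k ⊕ Fin l, Sum.elim s f i * d i j = b * t := fun j => by
    rw [← h₂.ker_ring, map_sum, ← hd' j]
    exact Finset.sum_congr rfl fun i _ => by rw [map_mul, hd]
  choose t ht using e7
  refine isTrivialRelation_of_fintype (κ := Fin m ⊕ Fin k)
    (fun i => Sum.elim (fun m => ∑ j, c i j * d (.inl j) m + a * d (.inr i) m)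
      (fun j => c i j * b)) (Sum.elim w (fun j => u (.inl j))) (fun i => ?_) ?_
  · have hy := fun j => hyz (.inl j)
    have hz := hyz (.inr i)
    simp only [Sum.elim_inl, Sum.elim_inr] at hy hz
    have h0 : a • b • u (.inr i) = 0 := by rw [smul_smul, hab, zero_smul]
    simp only [Fintype.sum_sum_type, Sum.elim_inl, Sum.elim_inr]
    rw [hx, hz, smul_add, h0, add_zero]
    conv_lhs => enter [1, 2, j]; rw [hy j]
    simp_rw [smul_add, add_smul, Finset.sum_add_distrib, Finset.smul_sum, smul_smul,
      Finset.sum_smul]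
    rw [Finset.sum_comm]
    abel
  · rintro (m | j)
    · have := ht m
      simp only [Fintype.sum_sum_type, Sum.elim_inl, Sum.elim_inr] at this
      simp only [Sum.elim_inl, mul_add, Finset.sum_add_distrib, Finset.mul_sum]
      rw [Finset.sum_comm]
      have h1 : ∀ j, ∑ i, f i * (c i j * d (.inl j) m) = a * (s j * d (.inl j) m) := fun j => by
        rw [← mul_assoc, ← hs, Finset.sum_mul]
        exact Finset.sum_congr rfl fun i _ => by ring
      have h2 : ∑ i, f i * (a * d (.inr i) m) = a * ∑ i, f i * d (.inr i) m := by
        rw [Finset.mul_sum]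
        exact Finset.sum_congr rfl fun i _ => by ring
      simp_rw [h1]
      rw [h2, ← Finset.mul_sum, ← mul_add, this, ← mul_assoc, hab, zero_mul]
    · simp only [Sum.elim_inr]
      simp_rw [← mul_assoc]
      rw [← Finset.sum_mul, hs, mul_right_comm, hab, zero_mul]

theorem exists_eq_smul_finsupp {a : R} {σ : Type u} (x : σ →₀ R)
    (h : ∀ i, ∃ r', x i = a * r') : ∃ x' : σ →₀ R, x = a • x' := by
  classical
  choose r hr using h
  refine ⟨Finsupp.onFinset x.support (fun i => if x i = 0 then 0 else r i) ?_, ?_⟩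
  · intro i hi
    rw [Finsupp.mem_support_iff]
    intro h
    exact hi (if_pos h)
  · ext i
    simp only [Finsupp.smul_apply, Finsupp.onFinset_apply, smul_eq_mul]
    split_ifs with h
    · simpa using h
    · exact hr i

/-- The annihilator of `a` in the syzygy of `X`, when `a` and `b` are each other's annihilators
in `R` and in `X`. -/
theorem syz_annihilator {a b : R} (hab : a * b = 0) (hR : ∀ r : R, a * r = 0 → ∃ r', r = b * r')
    {X : Type u} [AddCommGroup X] [Module R X] (hX : ∀ x : X, b • x = 0 → ∃ x', x = a • x')
    (k : syz R X) (hk : a • k = 0) : ∃ k', k = b • k' := by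
  obtain ⟨F, hF⟩ := exists_eq_smul_finsupp k.1 fun i => hR _ (by
    simpa using DFunLike.congr_fun (congrArg Subtype.val hk) i)
  have h1 : Finsupp.linearCombination R (id : X → X) k.1 = 0 := k.2
  rw [hF, map_smul] at h1
  obtain ⟨y, hy⟩ := hX _ h1
  refine ⟨⟨F - a • Finsupp.single y 1, ?_⟩, ?_⟩
  · rw [LinearMap.mem_ker, map_sub, hy, map_smul]
    simp
  · ext1
    change k.1 = b • (F - a • Finsupp.single y 1)
    rw [smul_sub, smul_smul, mul_comm b, hab, zero_smul, sub_zero, hF]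

/-- Modulo `a`, the syzygy of `X` becomes a first syzygy of the reduction of `X`. -/
theorem IsReductionMod.syz {a b : R} (hab : a * b = 0) {f₁ : R →+* R₁} {X X₁ : Type u}
    [AddCommGroup X] [Module R X] [AddCommGroup X₁] [Module R₁ X₁] {g₁ : X →+ X₁}
    (h₁ : IsReductionMod a f₁ g₁) (hX : ∀ x : X, a • x = 0 → ∃ x', x = b • x') :
    ∃ g : syz R X →+ LinearMap.ker (Finsupp.linearCombination R₁ g₁), IsReductionMod a f₁ g := by
  let m : (X →₀ R) →+ (X →₀ R₁) := Finsupp.mapRange.addMonoidHom (f₁ : R →+ R₁)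
  have hm : ∀ F, Finsupp.linearCombination R₁ g₁ (m F) =
      g₁ (Finsupp.linearCombination R (id : X → X) F) := fun F => by
    induction F using Finsupp.induction_linear with
    | zero => simp
    | add F G hF hG => simp [hF, hG]
    | single x r => simp [m, h₁.map_smul]
  have hms : ∀ (r : R) F, m (r • F) = f₁ r • m F := fun r F => by ext i; simp [m]
  have hmk : ∀ F, m F = 0 → ∃ F', F = a • F' := fun F hF =>
    exists_eq_smul_finsupp F fun i => (h₁.ker_ring _).1 (by simpa [m] using DFunLike.congr_fun hF i)
  have ha : f₁ a = 0 := (h₁.ker_ring a).2 ⟨1, (mul_one a).symm⟩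
  refine ⟨(m.comp (SemiCoh.syz R X).subtype.toAddMonoidHom).codRestrict
    (LinearMap.ker (Finsupp.linearCombination R₁ g₁)) fun k => ?_,
    ⟨h₁.surj_ring, h₁.ker_ring, ?_, ?_, ?_⟩⟩
  · have hk : Finsupp.linearCombination R (id : X → X) k.1 = 0 := k.2
    rw [LinearMap.mem_ker]
    exact (hm k.1).trans (by rw [hk, map_zero])
  · rintro ⟨K, hK⟩
    obtain ⟨F, rfl⟩ := Finsupp.mapRange_surjective _ (map_zero f₁) h₁.surj_ring K
    obtain ⟨y, hy⟩ := (h₁.ker _).1 ((hm F).symm.trans hK)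
    refine ⟨⟨F - a • Finsupp.single y 1, ?_⟩, Subtype.ext ?_⟩
    · rw [LinearMap.mem_ker, map_sub, hy, _root_.map_smul]
      simp
    · change m (F - a • Finsupp.single y 1) = m F
      rw [map_sub, hms, ha, zero_smul, sub_zero]
  · intro r k
    exact Subtype.ext (hms r k.1)
  · intro k
    constructor
    · intro h
      obtain ⟨F, hF⟩ := hmk k.1 (congrArg Subtype.val h)
      have h1 : Finsupp.linearCombination R (id : X → X) k.1 = 0 := k.2
      rw [hF, _root_.map_smul] at h1
      obtain ⟨y, hy⟩ := hX _ h1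
      refine ⟨⟨F - b • Finsupp.single y 1, ?_⟩, Subtype.ext ?_⟩
      · rw [LinearMap.mem_ker, map_sub, hy, _root_.map_smul]
        simp
      · change k.1 = a • (F - b • Finsupp.single y 1)
        rw [smul_sub, smul_smul, hab, zero_smul, sub_zero, hF]
    · rintro ⟨k', rfl⟩
      refine Subtype.ext ((hms a k'.1).trans ?_)
      rw [ha, zero_smul]
      rfl

/-- **Dévissage of flat dimension.** If `a` and `b` are each other's annihilators, in the ring `R`
and in the module `X`, then the flat dimension of `X` over `R` is bounded by those of `X / aX` over
`R / a` and of `X / bX` over `R / b`. -/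
theorem FlatDimLE.of_isReductionMod {a b : R} (hab : a * b = 0)
    (hRa : ∀ r : R, a * r = 0 → ∃ r', r = b * r') (hRb : ∀ r : R, b * r = 0 → ∃ r', r = a * r')
    {f₁ : R →+* R₁} {f₂ : R →+* R₂} (d : ℕ) :
    ∀ {X X₁ X₂ : Type u} [AddCommGroup X] [Module R X] [AddCommGroup X₁] [Module R₁ X₁]
      [AddCommGroup X₂] [Module R₂ X₂] {g₁ : X →+ X₁} {g₂ : X →+ X₂},
      IsReductionMod a f₁ g₁ → IsReductionMod b f₂ g₂ →
      (∀ x : X, a • x = 0 → ∃ x', x = b • x') → (∀ x : X, b • x = 0 → ∃ x', x = a • x') →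
      FlatDimLE R₁ d X₁ → FlatDimLE R₂ d X₂ → FlatDimLE R d X := by
  have hba : b * a = 0 := by rw [mul_comm, hab]
  induction d with
  | zero =>
    intro X X₁ X₂ _ _ _ _ _ _ g₁ g₂ h₁ h₂ ha hb hd₁ hd₂
    have : Module.Flat R₁ X₁ := hd₁
    have : Module.Flat R₂ X₂ := hd₂
    exact flat_of_isReductionMod hab h₁ h₂ ha
  | succ d ih =>
    intro X X₁ X₂ _ _ _ _ _ _ g₁ g₂ h₁ h₂ ha hb hd₁ hd₂
    have key : ∀ {S Y : Type u} [CommRing S] [AddCommGroup Y] [Module S Y] (g : X → Y),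
        Function.Surjective g → FlatDimLE S (d + 1) Y →
        FlatDimLE S d (LinearMap.ker (Finsupp.linearCombination S g)) := by
      intro S Y _ _ _ g hg h
      refine (FlatDimLE.succ_iff (K := LinearMap.ker (Finsupp.linearCombination S g))
        (LinearMap.ker (Finsupp.linearCombination S g)).subtype
        (Finsupp.linearCombination S g) (Submodule.injective_subtype _)
        (LinearMap.exact_subtype_ker_map _) (fun y => ?_)).1 h
      obtain ⟨x, rfl⟩ := hg y
      exact ⟨Finsupp.single x 1, by simp⟩
    obtain ⟨k₁, hk₁⟩ := h₁.syz hab ha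
    obtain ⟨k₂, hk₂⟩ := h₂.syz hba hb
    exact ih (X := syz R X) hk₁ hk₂ (syz_annihilator hab hRa hb) (syz_annihilator hba hRb ha)
      (key g₁ h₁.surj hd₁) (key g₂ h₂.surj hd₂)

end Reduction

/-! ### Hilbert's syzygy theorem -/

section ChangeOfRings

/-- Flat dimension is invariant under an isomorphism of rings. -/
theorem FlatDimLE.of_bijective_algebraMap {S : Type u} [CommRing S] [Algebra R S]
    (h : Function.Bijective (algebraMap R S)) (d : ℕ) :
    ∀ {X : Type u} [AddCommGroup X] [Module R X] [Module S X] [IsScalarTower R S X],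
      FlatDimLE R d X → FlatDimLE S d X := by
  have hflat : Module.Flat R S := Module.Flat.of_linearEquiv
    (LinearEquiv.ofBijective (Algebra.linearMap R S) h).symm
  induction d with
  | zero =>
    intro X _ _ _ _ hX
    have : Module.Flat R X := hX
    refine Module.Flat.of_forall_isTrivialRelation fun {l f x} hfx => ?_
    choose f' hf' using fun i => h.2 (f i)
    have h1 : ∑ i, f' i • x i = 0 := by
      rw [← hfx]
      exact Finset.sum_congr rfl fun i _ => by rw [← hf', algebraMap_smul]
    obtain ⟨k, c, y, hxy, hc⟩ := Module.Flat.isTrivialRelation_of_sum_smul_eq_zero h1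
    refine ⟨k, fun i j => algebraMap R S (c i j), y, fun i => ?_, fun j => ?_⟩
    · simp_rw [algebraMap_smul]
      exact hxy i
    · rw [← map_zero (algebraMap R S), ← hc j, map_sum]
      exact Finset.sum_congr rfl fun i _ => by rw [map_mul, hf']
  | succ d ih =>
    intro X _ _ _ _ hX
    refine ih (X := syz S X) ?_
    have : Module.Flat R (X →₀ S) := Module.Flat.trans R S (X →₀ S)
    exact (FlatDimLE.succ_iff (K := syz S X) ((syz S X).subtype.restrictScalars R)
      ((Finsupp.linearCombination S (id : X → X)).restrictScalars R)
      (Submodule.injective_subtype _)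
      (LinearMap.exact_subtype_ker_map (Finsupp.linearCombination S (id : X → X)))
      (Finsupp.linearCombination_id_surjective S X)).1 hX

section Polynomial

open Polynomial TensorProduct

variable (R) (X : Type u) [AddCommGroup X] [Module R X] [Module R[X] X] [IsScalarTower R R[X] X]

/-- The map `p ⊗ x ↦ p y ⊗ x - p ⊗ y x` on `R[y] ⊗ X`, for an `R[y]`-module `X`. -/
noncomputable def polynomialDelta : R[X] ⊗[R] X →ₗ[R[X]] R[X] ⊗[R] X :=
  (Polynomial.X : R[X]) • LinearMap.id -
    (((Polynomial.X : R[X]) • (LinearMap.id : X →ₗ[R[X]] X)).restrictScalars R).baseChange R[X]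

/-- The action map `R[y] ⊗ X → X`. -/
noncomputable def polynomialAct : R[X] ⊗[R] X →ₗ[R[X]] X :=
  (LinearMap.id : X →ₗ[R] X).liftBaseChange R[X]

@[simp]
theorem polynomialDelta_tmul (p : R[X]) (x : X) :
    polynomialDelta R X (p ⊗ₜ x) =
      (Polynomial.X * p) ⊗ₜ x - p ⊗ₜ[R] ((Polynomial.X : R[X]) • x) := by
  simp [polynomialDelta, smul_tmul']

@[simp]
theorem polynomialAct_tmul (p : R[X]) (x : X) : polynomialAct R X (p ⊗ₜ x) = p • x := by
  simp [polynomialAct]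

theorem polynomialAct_surjective : Function.Surjective (polynomialAct R X) :=
  fun x => ⟨1 ⊗ₜ x, by simp⟩

theorem polynomialDelta_exact : Function.Exact (polynomialDelta R X) (polynomialAct R X) := by
  have h1 : polynomialAct R X ∘ₗ polynomialDelta R X = 0 := by
    ext x
    simp
  have h2 : ∀ (p : R[X]) (x : X), ∃ t, polynomialDelta R X t = p ⊗ₜ x - 1 ⊗ₜ (p • x) := by
    intro p
    induction p using Polynomial.induction_on with
    | C a =>
      intro x
      refine ⟨0, ?_⟩
      have : (C a : R[X]) = a • (1 : R[X]) := by rw [← C_mul', mul_one]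
      rw [map_zero, this, smul_tmul, smul_assoc, one_smul, sub_self]
    | add p q hp hq =>
      intro x
      obtain ⟨t, ht⟩ := hp x
      obtain ⟨t', ht'⟩ := hq x
      exact ⟨t + t', by rw [map_add, ht, ht', add_smul, add_tmul, tmul_add]; abel⟩
    | monomial n a h =>
      intro x
      obtain ⟨t, ht⟩ := h ((Polynomial.X : R[X]) • x)
      refine ⟨(C a * Polynomial.X ^ n) ⊗ₜ x + t, ?_⟩
      rw [map_add, ht, polynomialDelta_tmul, smul_smul,
        mul_comm Polynomial.X, mul_assoc, ← pow_succ]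
      abel
  have h3 : ∀ t, ∃ t', polynomialDelta R X t' = t - 1 ⊗ₜ polynomialAct R X t := by
    intro t
    induction t with
    | zero => exact ⟨0, by simp⟩
    | tmul p x => simpa using h2 p x
    | add a b ha hb =>
      obtain ⟨t, ht⟩ := ha
      obtain ⟨t', ht'⟩ := hb
      exact ⟨t + t', by rw [map_add, ht, ht', map_add, tmul_add]; abel⟩
  intro t
  constructor
  · intro h
    obtain ⟨t', ht'⟩ := h3 t
    exact ⟨t', by rw [ht', h, tmul_zero, sub_zero]⟩
  · rintro ⟨t, rfl⟩
    exact LinearMap.congr_fun h1 t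

theorem polynomialDelta_injective : Function.Injective (polynomialDelta R X) := by
  let e := TensorProduct.equivFinsuppOfBasisLeft (N := X) (Polynomial.basisMonomials R)
  have he : ∀ (p : R[X]) (x : X) (n : ℕ), e (p ⊗ₜ x) n = p.coeff n • x := fun p x n => by
    simp [e, Polynomial.basisMonomials, Polynomial.coeff]
  have hδ : ∀ t n, e (polynomialDelta R X t) (n + 1) =
      e t n - (Polynomial.X : R[X]) • e t (n + 1) := by
    intro t n
    induction t with
    | zero => simp
    | tmul p x =>
      rw [polynomialDelta_tmul, map_sub, Finsupp.sub_apply, he, he, he, he, coeff_X_mul,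
        smul_comm (Polynomial.X : R[X])]
    | add a b ha hb => simp only [map_add, Finsupp.add_apply, ha, hb, smul_add]; abel
  rw [injective_iff_map_eq_zero]
  intro t ht
  have h1 : ∀ n, e t n = (Polynomial.X : R[X]) • e t (n + 1) := fun n => by
    rw [← sub_eq_zero, ← hδ, ht, map_zero, Finsupp.zero_apply]
  obtain ⟨N, hN⟩ : ∃ N, ∀ n, N ≤ n → e t n = 0 := by
    obtain ⟨N, hN⟩ := (e t).support.finite_toSet.bddAbove
    refine ⟨N + 1, fun n hn => ?_⟩
    by_contra h
    have := hN (Finsupp.mem_support_iff.2 h)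
    omega
  have h2 : ∀ i n, N ≤ n + i → e t n = 0 := by
    intro i
    induction i with
    | zero => exact hN
    | succ i ih => intro n hn; rw [h1, ih (n + 1) (by omega), smul_zero]
  rw [← map_eq_zero_iff e e.injective]
  ext n
  exact h2 N n (by omega)

variable {R X} in
/-- Adjoining a polynomial variable raises flat dimension by at most one. -/
theorem FlatDimLE.polynomial (d : ℕ) :
    ∀ {X : Type u} [AddCommGroup X] [Module R X] [Module R[X] X] [IsScalarTower R R[X] X],
      FlatDimLE R d X → FlatDimLE R[X] (d + 1) X := by
  induction d with
  | zero =>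
    intro X _ _ _ _ h
    have : Module.Flat R X := h
    refine (FlatDimLE.succ_iff (polynomialDelta R X) (polynomialAct R X)
      (polynomialDelta_injective R X) (polynomialDelta_exact R X)
      (polynomialAct_surjective R X)).2 ?_
    exact (inferInstance : Module.Flat R[X] (R[X] ⊗[R] X))
  | succ d ih =>
    intro X _ _ _ _ hX
    refine ih (X := syz R[X] X) ?_
    have : Module.Flat R (X →₀ R[X]) := Module.Flat.trans R R[X] (X →₀ R[X])
    exact (FlatDimLE.succ_iff (K := syz R[X] X) ((syz R[X] X).subtype.restrictScalars R)
      ((Finsupp.linearCombination R[X] (id : X → X)).restrictScalars R)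
      (Submodule.injective_subtype _)
      (LinearMap.exact_subtype_ker_map (Finsupp.linearCombination R[X] (id : X → X)))
      (Finsupp.linearCombination_id_surjective R[X] X)).1 hX

end Polynomial

/-- Every `R`-module has flat dimension at most `d`. -/
def WeakDimLE (R : Type u) [CommRing R] (d : ℕ) : Prop :=
  ∀ (X : Type u) [AddCommGroup X] [Module R X], FlatDimLE R d X

theorem WeakDimLE.of_ringEquiv {S : Type u} [CommRing S] (e : R ≃+* S) {d : ℕ}
    (h : WeakDimLE R d) : WeakDimLE S d := by
  intro X _ _
  let : Algebra R S := e.toRingHom.toAlgebra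
  let : Module R X := Module.compHom X e.toRingHom
  have : IsScalarTower R S X := ⟨fun r s x => mul_smul (e r) s x⟩
  exact FlatDimLE.of_bijective_algebraMap (R := R) e.bijective d (h X)

theorem WeakDimLE.polynomial {d : ℕ} (h : WeakDimLE R d) :
    WeakDimLE (Polynomial R) (d + 1) := by
  intro X _ _
  let : Module R X := Module.compHom X (algebraMap R (Polynomial R))
  have : IsScalarTower R (Polynomial R) X := .of_algebraMap_smul fun r x => rfl
  exact FlatDimLE.polynomial d (h X)

theorem WeakDimLE.of_field (k : Type u) [Field k] : WeakDimLE k 0 := fun X _ _ =>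
  (inferInstance : Module.Flat k X)

/-- **Hilbert's syzygy theorem**, for flat dimension. -/
theorem WeakDimLE.mvPolynomial (k : Type u) [Field k] (τ : Type) [Finite τ] {d : ℕ}
    (hd : Nat.card τ ≤ d) : WeakDimLE (MvPolynomial τ k) d := by
  have key : ∀ n, WeakDimLE (MvPolynomial (Fin n) k) n := by
    intro n
    induction n with
    | zero =>
      exact (WeakDimLE.of_field k).of_ringEquiv (MvPolynomial.isEmptyRingEquiv k (Fin 0)).symm
    | succ n ih =>
      exact ih.polynomial.of_ringEquiv (MvPolynomial.finSuccEquiv k n).symm.toRingEquiv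
  exact fun X _ _ => ((key _).of_ringEquiv
    (MvPolynomial.renameEquiv k (Finite.equivFin τ).symm).toRingEquiv X).mono hd

end ChangeOfRings

/-! ### Vanishing of Tor -/

section TorVanish

/-- `TorVanish p X S`: the vanishing of `Tor_{p+1}(X, S)`, expressed by means of the canonical free
resolution of `X`. -/
def TorVanish (S : Type u) [AddCommGroup S] [Module R S] :
    ℕ → ∀ (X : Type u) [AddCommGroup X] [Module R X], Prop
  | 0, X, _, _ => Function.Injective ((syz R X).subtype.rTensor S)
  | p + 1, X, _, _ => TorVanish S p (syz R X)

variable {S₁ G S : Type u} [AddCommGroup S₁] [AddCommGroup G] [AddCommGroup S]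
  [Module R S₁] [Module R G] [Module R S] {j : S₁ →ₗ[R] G} {π : G →ₗ[R] S}

theorem TorVanish.lTensor_injective {X : Type u} [AddCommGroup X] [Module R X]
    (h : TorVanish (R := R) S 0 X) (hj : Function.Injective j) (hjπ : Function.Exact j π)
    (hπ : Function.Surjective π) : Function.Injective (j.lTensor X) :=
  lTensor_injective_of_rTensor_injective (K := syz R X) (LinearMap.exact_subtype_ker_map _)
    (Finsupp.linearCombination_id_surjective R X) hj hjπ hπ h

/-- Dimension shifting in the second variable of `Tor`. -/
theorem TorVanish.of_succ (hj : Function.Injective j) (hjπ : Function.Exact j π)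
    (hπ : Function.Surjective π) [Module.Flat R G] (p : ℕ) :
    ∀ {X : Type u} [AddCommGroup X] [Module R X],
      TorVanish (R := R) S (p + 1) X → TorVanish (R := R) S₁ p X := by
  induction p with
  | zero =>
    intro X _ _ h
    have h' : TorVanish (R := R) S 0 (syz R X) := h
    have h1 := h'.lTensor_injective hj hjπ hπ
    have h2 : Function.Injective ((syz R X).subtype.rTensor G ∘ₗ j.lTensor (syz R X)) :=
      (Module.Flat.rTensor_preserves_injective_linearMap _ (Submodule.injective_subtype _)).comp h1
    rw [LinearMap.rTensor_comp_lTensor, ← LinearMap.lTensor_comp_rTensor] at h2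
    exact Function.Injective.of_comp h2
  | succ p ih =>
    intro X _ _ h
    exact ih (X := syz R X) h

theorem FlatDimLE.torVanish (S : Type u) [AddCommGroup S] [Module R S] {d p : ℕ} (hdp : d ≤ p)
    {X : Type u} [AddCommGroup X] [Module R X] (h : FlatDimLE R d X) :
    TorVanish (R := R) S p X := by
  induction p generalizing d X with
  | zero =>
    obtain rfl : d = 0 := by omega
    have : Module.Flat R X := h
    exact rTensor_injective_of_flat_quotient (K := syz R X) (Submodule.injective_subtype _)
      (LinearMap.exact_subtype_ker_map _) (Finsupp.linearCombination_id_surjective R X) S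
  | succ p ih =>
    have h' : FlatDimLE R (p + 1) X := h.mono hdp
    exact ih (X := syz R X) le_rfl h'

end TorVanish

end FlatDim

/-! ### Ideals generated by truncated relations -/

section Substitution

variable {k : Type u} [Field k] {σ : Type}

open Classical in
/-- The substitution homomorphism that keeps the variables in `τ` and replaces every other
variable `v` by the constant `c v`. -/
noncomputable def substHom (τ : Set σ) (c : σ → k) :
    MvPolynomial σ k →ₐ[k] MvPolynomial τ k :=
  MvPolynomial.aeval fun v => if h : v ∈ τ then MvPolynomial.X ⟨v, h⟩ else MvPolynomial.C (c v)

theorem substHom_X_of_mem {τ : Set σ} (c : σ → k) {v : σ} (h : v ∈ τ) :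
    substHom τ c (MvPolynomial.X v) = MvPolynomial.X ⟨v, h⟩ := by
  simp [substHom, h]

theorem substHom_X_of_notMem {τ : Set σ} (c : σ → k) {v : σ} (h : v ∉ τ) :
    substHom τ c (MvPolynomial.X v) = MvPolynomial.C (c v) := by
  simp [substHom, h]

theorem substHom_surjective (τ : Set σ) (c : σ → k) : Function.Surjective (substHom τ c) := by
  intro p
  refine ⟨MvPolynomial.rename Subtype.val p, ?_⟩
  have : (substHom τ c).comp (MvPolynomial.rename Subtype.val) = AlgHom.id k _ := by
    ext v
    simp [substHom_X_of_mem c v.2]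
  exact AlgHom.congr_fun this p

/-- An ideal which contains `v - c v` for each variable `v ∉ τ`, and whose elements vanish under the
corresponding substitution, is the kernel of this substitution. -/
theorem mem_iff_substHom_eq_zero {τ : Set σ} {c : σ → k} {I : Ideal (MvPolynomial σ k)}
    (h : ∀ v ∉ τ, MvPolynomial.X v - MvPolynomial.C (c v) ∈ I)
    (hI : ∀ g ∈ I, substHom τ c g = 0) (g : MvPolynomial σ k) :
    g ∈ I ↔ substHom τ c g = 0 := by
  refine ⟨hI g, fun hg => ?_⟩
  have h1 : ((Ideal.Quotient.mkₐ k I).comp (MvPolynomial.rename Subtype.val)).comp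
      (substHom τ c) = Ideal.Quotient.mkₐ k I := by
    ext v
    by_cases hv : v ∈ τ
    · simp [substHom_X_of_mem c hv]
    · simp only [AlgHom.comp_apply, substHom_X_of_notMem c hv]
      rw [MvPolynomial.algHom_C, MvPolynomial.algebraMap_eq]
      exact ((Ideal.Quotient.mk_eq_mk_iff_sub_mem _ _).2 (h v hv)).symm
  rw [← Ideal.Quotient.eq_zero_iff_mem]
  have h2 := AlgHom.congr_fun h1 g
  simp only [AlgHom.comp_apply, hg, map_zero] at h2
  exact h2.symm

end Substitution

section Ideals

variable (k : Type u) [Field k] (N : ℕ)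

/-- The variable `a_j`. -/
noncomputable def av (j : ℕ) : FreeAlg k N := MvPolynomial.X (Sum.inl j)

/-- The coefficient `β_{p,s}` of `a_s` in the `(p + s)`-th relation: this is `b_{-(N-p)}` for
`p + 1 < N`, it is `b_{-1} - s` for `p + 1 = N`, and it is zero for larger `p`. -/
noncomputable def beta (p s : ℕ) : FreeAlg k N :=
  if h : p < N then
    MvPolynomial.X (Sum.inr ⟨N - 1 - p, by omega⟩) -
      MvPolynomial.C (if p + 1 = N then (s : k) else 0)
  else 0

/-- The `l`-th relation `∑_{p + j = l} β_{p,j} a_j`: up to sign, this is the coefficient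
of `t^(l-N)` in the defining identity of the ring `A k N`. -/
noncomputable def rel (l : ℕ) : FreeAlg k N :=
  ∑ x ∈ Finset.HasAntidiagonal.antidiagonal l,
    beta k N x.1 x.2 * av k N x.2

/-- The generators of the ideal `idl k N r s L`. -/
noncomputable def gens (r s : ℕ) (L : Set ℕ) : Set (FreeAlg k N) :=
  rel k N '' L ∪ (av k N '' Set.Iio s ∪ (fun p => beta k N p s) '' Set.Iio r)

/-- The ideal generated by the relations with index in `L`, by the `a_j` with `j < s`, and by the
`β_{p,s}` with `p < r`. -/
noncomputable def idl (r s : ℕ) (L : Set ℕ) : Ideal (FreeAlg k N) := Ideal.span (gens k N r s L)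

variable {k N} {r s : ℕ} {L : Set ℕ}

theorem beta_eq {p : ℕ} (hp : p + 1 < N) (s s' : ℕ) : beta k N p s = beta k N p s' := by
  simp [beta, hp.ne]

theorem rel_mem_idl {l : ℕ} (hl : l ∈ L) : rel k N l ∈ idl k N r s L :=
  Ideal.subset_span (Or.inl ⟨l, hl, rfl⟩)

theorem av_mem_idl {j : ℕ} (hj : j < s) : av k N j ∈ idl k N r s L :=
  Ideal.subset_span (Or.inr (Or.inl ⟨j, hj, rfl⟩))

theorem beta_mem_idl {p : ℕ} (hp : p < r) : beta k N p s ∈ idl k N r s L :=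
  Ideal.subset_span (Or.inr (Or.inr ⟨p, hp, rfl⟩))

theorem idl_le_iff {I : Ideal (FreeAlg k N)} :
    idl k N r s L ≤ I ↔ (∀ l ∈ L, rel k N l ∈ I) ∧ (∀ j < s, av k N j ∈ I) ∧
      ∀ p < r, beta k N p s ∈ I := by
  simp only [idl, gens, Ideal.span_le, Set.union_subset_iff, Set.image_subset_iff]
  rfl

theorem idl_mono {L' : Set ℕ} (h : L ⊆ L') : idl k N r s L ≤ idl k N r s L' :=
  idl_le_iff.2 ⟨fun _ hl => rel_mem_idl (h hl), fun _ hj => av_mem_idl hj,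
    fun _ hp => beta_mem_idl hp⟩

theorem mem_idl_insert {l : ℕ} {g : FreeAlg k N} :
    g ∈ idl k N r s (insert l L) ↔ ∃ h, ∃ z ∈ idl k N r s L, g = h * rel k N l + z := by
  rw [idl, gens, Set.image_insert_eq, Set.insert_union, Ideal.mem_span_insert]
  rfl

theorem mem_idl_succ_left {g : FreeAlg k N} :
    g ∈ idl k N (r + 1) s L ↔ ∃ h, ∃ z ∈ idl k N r s L, g = h * beta k N r s + z := by
  have : Set.Iio (r + 1) = insert r (Set.Iio r) := by
    ext; simp only [Set.mem_Iio, Set.mem_insert_iff]; omega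
  rw [idl, gens, this, Set.image_insert_eq, Set.union_insert, Set.union_insert,
    Ideal.mem_span_insert]
  rfl

theorem mem_idl_succ_right (hr : r < N) {g : FreeAlg k N} :
    g ∈ idl k N r (s + 1) L ↔ ∃ h, ∃ z ∈ idl k N r s L, g = h * av k N s + z := by
  have h1 : Set.Iio (s + 1) = insert s (Set.Iio s) := by
    ext; simp only [Set.mem_Iio, Set.mem_insert_iff]; omega
  have h2 : (fun p => beta k N p (s + 1)) '' Set.Iio r = (fun p => beta k N p s) '' Set.Iio r :=
    Set.image_congr fun p hp => beta_eq (by have := Set.mem_Iio.1 hp; omega) _ _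
  rw [idl, gens, h1, h2, Set.image_insert_eq, Set.insert_union, Set.union_insert,
    Ideal.mem_span_insert]
  rfl

theorem idl_le_succ_left : idl k N r s L ≤ idl k N (r + 1) s L := fun g hg =>
  mem_idl_succ_left.2 ⟨0, g, hg, by ring⟩

theorem idl_le_succ_right (hr : r < N) : idl k N r s L ≤ idl k N r (s + 1) L := fun g hg =>
  (mem_idl_succ_right hr).2 ⟨0, g, hg, by ring⟩

theorem exists_mem_idl_Iio {g : FreeAlg k N} (hg : g ∈ idl k N r s Set.univ) (m : ℕ) :
    ∃ l, m ≤ l ∧ g ∈ idl k N r s (Set.Iio l) := by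
  have hmono : Monotone fun l => idl k N r s (Set.Iio l) := fun l l' h =>
    idl_mono (k := k) (N := N) (r := r) (s := s) (Set.Iio_subset_Iio h)
  have h1 : idl k N r s Set.univ ≤ ⨆ l, idl k N r s (Set.Iio l) := by
    rw [idl_le_iff]
    refine ⟨fun l _ => ?_, fun j hj => ?_, fun p hp => ?_⟩
    · exact Submodule.mem_iSup_of_mem (l + 1) (rel_mem_idl (Set.mem_Iio.2 (by omega)))
    · exact Submodule.mem_iSup_of_mem 0 (av_mem_idl hj)
    · exact Submodule.mem_iSup_of_mem 0 (beta_mem_idl hp)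
  obtain ⟨l, hl⟩ := (Submodule.mem_iSup_of_directed _ hmono.directed_le).1 (h1 hg)
  exact ⟨max m l, le_max_left _ _, hmono (le_max_right m l) hl⟩

/-- Modulo the `a_j` with `j < s` and the `β_{p,s}` with `p < r`, the `(r + s)`-th relation reduces
to `β_{r,s} a_s`. -/
theorem rel_sub_mem_idl (hr : r < N) : rel k N (r + s) - beta k N r s * av k N s ∈
    idl k N r s L := by
  rw [rel, ← Finset.add_sum_erase _ _ (a := (r, s))
      (Finset.HasAntidiagonal.mem_antidiagonal.2 rfl),
    add_sub_cancel_left]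
  refine Ideal.sum_mem _ fun x hx => ?_
  rw [Finset.mem_erase, Finset.HasAntidiagonal.mem_antidiagonal, ne_eq, Prod.ext_iff] at hx
  by_cases h : x.2 < s
  · exact Ideal.mul_mem_left _ _ (av_mem_idl h)
  · rw [beta_eq (by omega) x.2 s]
    exact Ideal.mul_mem_right _ _ (beta_mem_idl (by omega))

theorem beta_mul_av_mem_idl (hr : r < N) (h : r + s ∈ L) :
    beta k N r s * av k N s ∈ idl k N r s L := by
  have := Ideal.sub_mem _ (rel_mem_idl (k := k) (N := N) (r := r) (s := s) h)
    (rel_sub_mem_idl (L := L) hr)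
  rwa [sub_sub_cancel] at this

section Base

/-- The variables that survive modulo `idl k N r s (Set.Iio l)` when `l ≤ r + s`. -/
def varsLow (N r s : ℕ) : Set (ℕ ⊕ Fin N) :=
  {v | Sum.elim (fun j => s ≤ j) (fun q => q.1 + r < N) v}

theorem substHom_av {τ : Set (ℕ ⊕ Fin N)} (c : ℕ ⊕ Fin N → k) {j : ℕ} (h : Sum.inl j ∈ τ) :
    substHom τ c (av k N j) = MvPolynomial.X ⟨Sum.inl j, h⟩ := substHom_X_of_mem c h

theorem substHom_av_of_notMem {τ : Set (ℕ ⊕ Fin N)} (c : ℕ ⊕ Fin N → k) {j : ℕ}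
    (h : Sum.inl j ∉ τ) : substHom τ c (av k N j) = MvPolynomial.C (c (Sum.inl j)) :=
  substHom_X_of_notMem c h

theorem X_sub_C_mem_idl_low (hr : r < N) {v : ℕ ⊕ Fin N} (hv : v ∉ varsLow N r s) :
    (MvPolynomial.X v - MvPolynomial.C 0 : FreeAlg k N) ∈ idl k N r s L := by
  rw [MvPolynomial.C_0, sub_zero]
  rcases v with j | q
  · exact av_mem_idl (not_le.1 hv)
  · have hq : ¬ q.1 + r < N := hv
    have := beta_mem_idl (k := k) (N := N) (r := r) (s := s) (L := L) (p := N - 1 - q)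
      (by have := q.2; omega)
    have h1 : beta k N (N - 1 - q) s = MvPolynomial.X (Sum.inr q) := by
      have h2 : N - 1 - q + 1 ≠ N := by have := q.2; omega
      have h3 : N - 1 - q < N := by omega
      have h4 : N - 1 - (N - 1 - q) = q.1 := by have := q.2; omega
      simp [beta, h2, h3, h4]
    rwa [h1] at this

theorem substHom_low_eq_zero (hr : r < N) {l : ℕ} (hl : l ≤ r + s) :
    ∀ g ∈ idl k N r s (Set.Iio l), substHom (varsLow N r s) (0 : ℕ ⊕ Fin N → k) g = 0 := by
  have ha : ∀ j < s, substHom (varsLow N r s) (0 : ℕ ⊕ Fin N → k) (av k N j) = 0 := fun j hj => by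
    rw [substHom_av_of_notMem _ (show Sum.inl j ∉ varsLow N r s from not_le.2 hj)]
    simp
  have hb : ∀ p < r, ∀ s', substHom (varsLow N r s) (0 : ℕ ⊕ Fin N → k) (beta k N p s') = 0 :=
    fun p hp s' => by
    have h2 : p + 1 ≠ N := by omega
    have h3 : p < N := by omega
    have h4 : (Sum.inr ⟨N - 1 - p, by omega⟩ : ℕ ⊕ Fin N) ∉ varsLow N r s := by
      change ¬ (N - 1 - p + r < N)
      omega
    simp [beta, h2, h3, substHom_X_of_notMem _ h4]
  suffices h : idl k N r s (Set.Iio l) ≤ RingHom.ker (substHom (varsLow N r s) 0) from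
    fun g hg => h hg
  rw [idl_le_iff]
  refine ⟨fun m hm => ?_, ha, fun p hp => hb p hp s⟩
  rw [RingHom.mem_ker, rel, map_sum]
  refine Finset.sum_eq_zero fun x hx => ?_
  rw [Finset.HasAntidiagonal.mem_antidiagonal] at hx
  rw [Set.mem_Iio] at hm
  rw [map_mul]
  by_cases h : x.2 < s
  · rw [ha _ h, mul_zero]
  · rw [hb x.1 (by omega), zero_mul]

/-- For `l ≤ r + s` the ideal `idl k N r s (Set.Iio l)` is generated by variables. -/
theorem mem_idl_low (hr : r < N) {l : ℕ} (hl : l ≤ r + s) {g : FreeAlg k N} :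
    g ∈ idl k N r s (Set.Iio l) ↔ substHom (varsLow N r s) (0 : ℕ ⊕ Fin N → k) g = 0 :=
  mem_iff_substHom_eq_zero (fun _ hv => X_sub_C_mem_idl_low hr hv) (substHom_low_eq_zero hr hl) g

theorem of_av_mul_mem_idl_low (hr : r < N) {l : ℕ} (hl : l ≤ r + s) {g : FreeAlg k N}
    (hg : av k N s * g ∈ idl k N r s (Set.Iio l)) : g ∈ idl k N r s (Set.Iio l) := by
  rw [mem_idl_low hr hl, map_mul, substHom_av _ (show Sum.inl s ∈ varsLow N r s from le_refl s),
    mul_eq_zero] at hg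
  exact (mem_idl_low hr hl).2 (hg.resolve_left (MvPolynomial.X_ne_zero _))

theorem X_sub_C_ne_zero {σ : Type*} (v : σ) (c : k) :
    (MvPolynomial.X v - MvPolynomial.C c : MvPolynomial σ k) ≠ 0 := by
  intro h
  have := congrArg (MvPolynomial.eval fun _ => c + 1) h
  simp at this

theorem of_beta_mul_mem_idl_low (hr : r < N) {l : ℕ} (hl : l ≤ r + s) {g : FreeAlg k N}
    (hg : beta k N r s * g ∈ idl k N r s (Set.Iio l)) : g ∈ idl k N r s (Set.Iio l) := by
  have h4 : (Sum.inr ⟨N - 1 - r, by omega⟩ : ℕ ⊕ Fin N) ∈ varsLow N r s := by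
    change N - 1 - r + r < N
    omega
  rw [mem_idl_low hr hl, map_mul, mul_eq_zero] at hg
  refine (mem_idl_low hr hl).2 (hg.resolve_left ?_)
  rw [beta, dif_pos hr, map_sub, substHom_X_of_mem _ h4, MvPolynomial.algHom_C]
  exact X_sub_C_ne_zero _ _

/-- The variables that survive modulo `idl k N N s (Set.Iio l)`. -/
def varsTop (N s l : ℕ) : Set (ℕ ⊕ Fin N) :=
  {v | Sum.elim (fun j => s ≤ j ∧ (j = s ∨ l < j + N)) (fun _ => False) v}

/-- The values of the other variables modulo `idl k N N s (Set.Iio l)`. -/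
def valTop (k : Type u) [Field k] (N s : ℕ) : ℕ ⊕ Fin N → k :=
  Sum.elim (fun _ => 0) (fun q => if q.1 = 0 then s else 0)

theorem substHom_beta_top {τ : Set (ℕ ⊕ Fin N)} (hτ : ∀ q, Sum.inr q ∉ τ) (p s' : ℕ) :
    substHom τ (valTop k N s) (beta k N p s') =
      MvPolynomial.C (if p + 1 = N then (s : k) - s' else 0) := by
  by_cases hp : p < N
  · have h : N - 1 - p = 0 ↔ p + 1 = N := by omega
    rw [beta, dif_pos hp, map_sub, substHom_X_of_notMem _ (hτ _), MvPolynomial.algHom_C,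
      MvPolynomial.algebraMap_eq, ← map_sub]
    simp only [valTop, Sum.elim_inr, h]
    split_ifs <;> simp
  · rw [beta, dif_neg hp, if_neg (by omega)]
    simp

theorem beta_eq_add (p s s' : ℕ) : beta k N p s' =
    beta k N p s + MvPolynomial.C (if p + 1 = N then (s : k) - s' else 0) := by
  by_cases hp : p < N
  · rw [beta, beta, dif_pos hp, dif_pos hp, sub_add, ← map_sub]
    congr 2
    split_ifs <;> simp
  · rw [beta, beta, dif_neg hp, dif_neg hp, if_neg (by omega)]
    simp

/-- For `r = N`, where all `β_{p,s}` are divided out, the relation `rel k N (N - 1 + j)` reduces to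
`(s - j) a_j`. -/
theorem rel_eq_top (hN : 0 < N) (s j : ℕ) : rel k N (N - 1 + j) =
    ∑ x ∈ Finset.HasAntidiagonal.antidiagonal (N - 1 + j), beta k N x.1 s * av k N x.2 +
      MvPolynomial.C ((s : k) - j) * av k N j := by
  simp_rw [rel, beta_eq_add _ s (_ : ℕ × ℕ).2, add_mul, Finset.sum_add_distrib]
  congr 1
  rw [Finset.sum_eq_single (N - 1, j), if_pos (by dsimp only; omega)]
  · rintro ⟨p, i⟩ hx hne
    rw [Finset.HasAntidiagonal.mem_antidiagonal] at hx
    rw [if_neg, map_zero, zero_mul]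
    rw [ne_eq, Prod.mk.injEq] at hne
    dsimp only at hx ⊢
    omega
  · intro h
    exact absurd (Finset.HasAntidiagonal.mem_antidiagonal.2 (by rfl)) h

theorem rel_sub_mem_idl_top (hN : 0 < N) (s j : ℕ) :
    rel k N (N - 1 + j) - MvPolynomial.C ((s : k) - j) * av k N j ∈ idl k N N s L := by
  rw [rel_eq_top hN s, add_sub_cancel_right]
  refine Ideal.sum_mem _ fun x hx => ?_
  by_cases h : x.1 < N
  · exact Ideal.mul_mem_right _ _ (beta_mem_idl h)
  · rw [beta, dif_neg h, zero_mul]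
    exact zero_mem _

theorem substHom_rel_top {τ : Set (ℕ ⊕ Fin N)} (hτ : ∀ q, Sum.inr q ∉ τ) (hN : 0 < N) (j : ℕ) :
    substHom τ (valTop k N s) (rel k N (N - 1 + j)) =
      MvPolynomial.C ((s : k) - j) * substHom τ (valTop k N s) (av k N j) := by
  rw [rel_eq_top hN s, map_add, map_sum, Finset.sum_eq_zero, zero_add, map_mul,
    MvPolynomial.algHom_C, MvPolynomial.algebraMap_eq]
  intro x _
  rw [map_mul, substHom_beta_top hτ, sub_self, ite_self, map_zero, zero_mul]

theorem substHom_rel_top_of_lt {τ : Set (ℕ ⊕ Fin N)} (hτ : ∀ q, Sum.inr q ∉ τ) {m : ℕ}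
    (hm : m + 1 < N) : substHom τ (valTop k N s) (rel k N m) = 0 := by
  rw [rel, map_sum]
  refine Finset.sum_eq_zero fun x hx => ?_
  rw [Finset.HasAntidiagonal.mem_antidiagonal] at hx
  rw [map_mul, substHom_beta_top hτ, if_neg (by omega), map_zero, zero_mul]

theorem inr_notMem_varsTop {l : ℕ} (q : Fin N) : Sum.inr q ∉ varsTop N s l := fun h => h

theorem X_sub_C_mem_idl_top [CharZero k] (hN : 0 < N) {l : ℕ} {v : ℕ ⊕ Fin N}
    (hv : v ∉ varsTop N s l) : (MvPolynomial.X v - MvPolynomial.C (valTop k N s v) : FreeAlg k N) ∈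
      idl k N N s (Set.Iio l) := by
  have hb : ∀ q : Fin N, (MvPolynomial.X (Sum.inr q) -
      MvPolynomial.C (valTop k N s (Sum.inr q)) : FreeAlg k N) ∈ idl k N N s (Set.Iio l) := by
    intro q
    have := beta_mem_idl (k := k) (N := N) (r := N) (s := s) (L := Set.Iio l) (p := N - 1 - q)
      (by omega)
    have h1 : beta k N (N - 1 - q) s = MvPolynomial.X (Sum.inr q) -
        MvPolynomial.C (valTop k N s (Sum.inr q)) := by
      have h2 : N - 1 - q + 1 = N ↔ q.1 = 0 := by have := q.2; omega
      have h3 : N - 1 - q < N := by omega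
      have h4 : N - 1 - (N - 1 - q) = q.1 := by have := q.2; omega
      simp [beta, h2, h3, h4, valTop]
    rwa [h1] at this
  rcases v with j | q
  · have h0 : valTop k N s (Sum.inl j) = 0 := rfl
    rw [h0, MvPolynomial.C_0, sub_zero]
    by_cases hj : j < s
    · exact av_mem_idl hj
    have hv' : ¬ (s ≤ j ∧ (j = s ∨ l < j + N)) := hv
    have h1 : rel k N (N - 1 + j) ∈ idl k N N s (Set.Iio l) :=
      rel_mem_idl (Set.mem_Iio.2 (by omega))
    have h2 := rel_sub_mem_idl_top (k := k) (L := Set.Iio l) hN s j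
    have h3 : MvPolynomial.C ((s : k) - j) * av k N j ∈ idl k N N s (Set.Iio l) := by
      have := Ideal.sub_mem _ h1 h2
      rwa [sub_sub_cancel] at this
    have h4 : (s : k) - j ≠ 0 := by
      rw [sub_ne_zero, ne_eq, Nat.cast_inj]
      omega
    have := Ideal.mul_mem_left _ (MvPolynomial.C ((s : k) - j)⁻¹) h3
    rwa [← mul_assoc, ← map_mul, inv_mul_cancel₀ h4, map_one, one_mul] at this
  · exact hb q

theorem substHom_top_eq_zero (hN : 0 < N) (l : ℕ) :
    ∀ g ∈ idl k N N s (Set.Iio l), substHom (varsTop N s l) (valTop k N s) g = 0 := by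
  have ha : ∀ j, Sum.inl j ∉ varsTop N s l →
      substHom (varsTop N s l) (valTop k N s) (av k N j) = 0 := fun j hj => by
    rw [substHom_av_of_notMem _ hj]
    simp [valTop]
  suffices h : idl k N N s (Set.Iio l) ≤ RingHom.ker (substHom (varsTop N s l) (valTop k N s)) from
    fun g hg => h hg
  rw [idl_le_iff]
  refine ⟨fun m hm => ?_, fun j hj => ha j fun h => ?_, fun p hp => ?_⟩
  · rw [Set.mem_Iio] at hm
    rw [RingHom.mem_ker]
    by_cases hmN : m + 1 < N
    · exact substHom_rel_top_of_lt inr_notMem_varsTop hmN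
    · obtain ⟨j, rfl⟩ := Nat.exists_eq_add_of_le (show N - 1 ≤ m by omega)
      rw [substHom_rel_top inr_notMem_varsTop hN]
      by_cases hj : j = s
      · rw [hj, sub_self, map_zero, zero_mul]
      · rw [ha, mul_zero]
        rintro ⟨_, h | h⟩
        · exact hj h
        · omega
  · have := h.1
    omega
  · rw [RingHom.mem_ker, substHom_beta_top inr_notMem_varsTop, sub_self, ite_self, map_zero]

/-- The ideal `idl k N N s (Set.Iio l)` is generated by differences of variables and constants. -/
theorem mem_idl_top [CharZero k] (hN : 0 < N) {l : ℕ} {g : FreeAlg k N} :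
    g ∈ idl k N N s (Set.Iio l) ↔ substHom (varsTop N s l) (valTop k N s) g = 0 :=
  mem_iff_substHom_eq_zero (fun _ hv => X_sub_C_mem_idl_top hN hv) (substHom_top_eq_zero hN l) g

theorem of_rel_mul_mem_idl_top [CharZero k] (hN : 0 < N) {l : ℕ} (hl : s + N ≤ l) {g : FreeAlg k N}
    (hg : rel k N l * g ∈ idl k N N s (Set.Iio l)) : g ∈ idl k N N s (Set.Iio l) := by
  obtain ⟨j, rfl⟩ := Nat.exists_eq_add_of_le (show N - 1 ≤ l by omega)
  have hj : Sum.inl j ∈ varsTop N s (N - 1 + j) := ⟨by omega, Or.inr (by omega)⟩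
  rw [mem_idl_top hN, map_mul, substHom_rel_top inr_notMem_varsTop hN, substHom_av _ hj,
    mul_eq_zero, mul_eq_zero] at hg
  refine (mem_idl_top hN).2 (hg.resolve_left ?_)
  rintro (h | h)
  · rw [MvPolynomial.C_eq_zero, sub_eq_zero, Nat.cast_inj] at h
    omega
  · exact MvPolynomial.X_ne_zero _ h

end Base

/-- If `a_s` and `β_{r,s}` are each other's annihilators as far as the relations before the `l`-th
are concerned, then the `l`-th relation is a nonzerodivisor modulo them. -/
theorem of_rel_mul_mem_idl [CharZero k] (hN : 0 < N) {l : ℕ}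
    (h : ∀ {r s : ℕ}, r < N → r + s < l → ∀ g, av k N s * g ∈ idl k N r s (Set.Iio l) →
      g ∈ idl k N (r + 1) s (Set.Iio l)) (t : ℕ) :
    ∀ {r s : ℕ}, r ≤ N → r + s + t = l → ∀ g, rel k N l * g ∈ idl k N r s (Set.Iio l) →
      g ∈ idl k N r s (Set.Iio l) := by
  induction t with
  | zero =>
    intro r s hr hl g hg
    rcases hr.eq_or_lt with rfl | hr
    · exact of_rel_mul_mem_idl_top hN (by omega) hg
    obtain rfl : l = r + s := by omega
    have h1 := Ideal.sub_mem _ hg (Ideal.mul_mem_right g _ (rel_sub_mem_idl hr))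
    rw [← sub_mul, sub_sub_cancel, mul_assoc] at h1
    exact of_av_mul_mem_idl_low hr le_rfl (of_beta_mul_mem_idl_low hr le_rfl h1)
  | succ t ih =>
    intro r s hr hl g hg
    rcases hr.eq_or_lt with rfl | hr
    · exact of_rel_mul_mem_idl_top hN (by omega) hg
    obtain ⟨g', z, hz, rfl⟩ := (mem_idl_succ_right hr).1
      (ih hr.le (by omega) g (idl_le_succ_right hr hg))
    have h1 : av k N s * (rel k N l * g') ∈ idl k N r s (Set.Iio l) := by
      have := Ideal.sub_mem _ hg (Ideal.mul_mem_left _ (rel k N l) hz)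
      convert this using 1
      ring
    obtain ⟨g'', z', hz', rfl⟩ := mem_idl_succ_left.1
      (ih (r := r + 1) hr (by omega) g' (h hr (by omega) _ h1))
    have h2 : beta k N r s * av k N s ∈ idl k N r s (Set.Iio l) :=
      beta_mul_av_mem_idl hr (Set.mem_Iio.2 (by omega))
    have := Ideal.add_mem _ (Ideal.add_mem _ (Ideal.mul_mem_left _ g'' h2)
      (Ideal.mul_mem_left _ (av k N s) hz')) hz
    convert this using 1
    ring

theorem mem_idl_Iio_succ {l : ℕ} {g : FreeAlg k N} : g ∈ idl k N r s (Set.Iio (l + 1)) ↔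
    ∃ h, ∃ z ∈ idl k N r s (Set.Iio l), g = h * rel k N l + z := by
  have : Set.Iio (l + 1) = insert l (Set.Iio l) := by
    ext; simp only [Set.mem_Iio, Set.mem_insert_iff]; omega
  rw [this, mem_idl_insert]

/-- The elements `a_s` and `β_{r,s}` are each other's annihilators modulo `idl k N r s (Set.Iio l)`
for `l > r + s`. The induction on `l` adds one relation at a time: the first of these is
`β_{r,s} a_s` itself, and each later one is a nonzerodivisor modulo its predecessors, so that an
equation modulo `rel k N l` can be lifted. -/
theorem of_mul_mem_idl_Iio [CharZero k] (l : ℕ) :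
    ∀ {r s : ℕ}, r < N → r + s < l → ∀ g,
      (av k N s * g ∈ idl k N r s (Set.Iio l) → g ∈ idl k N (r + 1) s (Set.Iio l)) ∧
      (beta k N r s * g ∈ idl k N r s (Set.Iio l) → g ∈ idl k N r (s + 1) (Set.Iio l)) := by
  induction l with
  | zero => intro r s _ h; omega
  | succ l ih =>
    intro r s hr hl g
    have hsub : Set.Iio l ⊆ Set.Iio (l + 1) := Set.Iio_subset_Iio (Nat.le_succ l)
    have hl' : l ∈ Set.Iio (l + 1) := Set.mem_Iio.2 (Nat.lt_succ_self l)
    have nzd : ∀ {r s : ℕ}, r ≤ N → r + s ≤ l → ∀ g, rel k N l * g ∈ idl k N r s (Set.Iio l) →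
        g ∈ idl k N r s (Set.Iio l) := fun {r s} hr hrs g =>
      of_rel_mul_mem_idl (by omega) (fun hr hrs g => (ih hr hrs g).1) (l - (r + s)) hr (by omega) g
    rcases (Nat.lt_succ_iff.1 hl).eq_or_lt with rfl | hl
    · constructor
      · intro hg
        obtain ⟨h, z, hz, e⟩ := mem_idl_Iio_succ.1 hg
        have h1 : av k N s * (g - h * beta k N r s) ∈ idl k N r s (Set.Iio (r + s)) := by
          have := Ideal.add_mem _ hz (Ideal.mul_mem_left _ h (rel_sub_mem_idl hr))
          convert this using 1
          linear_combination e
        exact mem_idl_succ_left.2 ⟨h, _, idl_mono hsub (of_av_mul_mem_idl_low hr le_rfl h1),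
          by ring⟩
      · intro hg
        obtain ⟨h, z, hz, e⟩ := mem_idl_Iio_succ.1 hg
        have h1 : beta k N r s * (g - h * av k N s) ∈ idl k N r s (Set.Iio (r + s)) := by
          have := Ideal.add_mem _ hz (Ideal.mul_mem_left _ h (rel_sub_mem_idl hr))
          convert this using 1
          linear_combination e
        exact (mem_idl_succ_right hr).2 ⟨h, _, idl_mono hsub (of_beta_mul_mem_idl_low hr le_rfl h1),
          by ring⟩
    · constructor
      · intro hg
        obtain ⟨h, z, hz, e⟩ := mem_idl_Iio_succ.1 hg
        have h1 : rel k N l * h ∈ idl k N r (s + 1) (Set.Iio l) :=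
          (mem_idl_succ_right hr).2 ⟨g, -z, neg_mem hz, by linear_combination -e⟩
        obtain ⟨h', z', hz', rfl⟩ := (mem_idl_succ_right hr).1 (nzd hr.le (by omega) h h1)
        have h2 : av k N s * (g - h' * rel k N l) ∈ idl k N r s (Set.Iio l) := by
          have := Ideal.add_mem _ (Ideal.mul_mem_left _ (rel k N l) hz') hz
          convert this using 1
          linear_combination e
        have h3 := idl_mono hsub ((ih hr hl _).1 h2)
        have := Ideal.add_mem _ h3 (Ideal.mul_mem_left _ h' (rel_mem_idl hl'))
        rwa [sub_add_cancel] at this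
      · intro hg
        obtain ⟨h, z, hz, e⟩ := mem_idl_Iio_succ.1 hg
        have h1 : rel k N l * h ∈ idl k N (r + 1) s (Set.Iio l) :=
          mem_idl_succ_left.2 ⟨g, -z, neg_mem hz, by linear_combination -e⟩
        obtain ⟨h', z', hz', rfl⟩ := mem_idl_succ_left.1 (nzd hr (by omega) h h1)
        have h2 : beta k N r s * (g - h' * rel k N l) ∈ idl k N r s (Set.Iio l) := by
          have := Ideal.add_mem _ (Ideal.mul_mem_left _ (rel k N l) hz') hz
          convert this using 1
          linear_combination e
        have h3 := idl_mono hsub ((ih hr hl _).2 h2)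
        have := Ideal.add_mem _ h3 (Ideal.mul_mem_left _ h' (rel_mem_idl hl'))
        rwa [sub_add_cancel] at this

theorem of_mul_mem_idl_univ [CharZero k] (hr : r < N) (g : FreeAlg k N) :
    (av k N s * g ∈ idl k N r s Set.univ → g ∈ idl k N (r + 1) s Set.univ) ∧
      (beta k N r s * g ∈ idl k N r s Set.univ → g ∈ idl k N r (s + 1) Set.univ) := by
  have hsub : ∀ l, Set.Iio l ⊆ (Set.univ : Set ℕ) := fun l => Set.subset_univ _
  constructor
  · intro hg
    obtain ⟨l, hl, h⟩ := exists_mem_idl_Iio hg (r + s + 1)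
    exact idl_mono (hsub l) ((of_mul_mem_idl_Iio l hr (by omega) g).1 h)
  · intro hg
    obtain ⟨l, hl, h⟩ := exists_mem_idl_Iio hg (r + s + 1)
    exact idl_mono (hsub l) ((of_mul_mem_idl_Iio l hr (by omega) g).2 h)

end Ideals

/-! ### The truncated rings -/

/-- The target `S` of a ring homomorphism `R → S` has flat dimension at most `d` over `R`. -/
def FlatDimHomLE (d : ℕ) {R S : Type u} [CommRing R] [CommRing S] (f : R →+* S) : Prop :=
  @FlatDimLE R _ d S _ f.toAlgebra.toModule

/-- A presentation of the ring `A` as the colimit of a sequence of Noetherian rings `R i`, such that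
`A` has flat dimension at most `d` over each of these. -/
structure NoetherianSystem (A : Type u) [CommRing A] (d : ℕ) where
  /-- The rings of the sequence. -/
  R : ℕ → Type u
  [commRing : ∀ i, CommRing (R i)]
  [noetherian : ∀ i, IsNoetherianRing (R i)]
  /-- The transition homomorphisms. -/
  ρ : ∀ {i j : ℕ}, i ≤ j → R i →+* R j
  /-- The homomorphisms to the colimit. -/
  ι : ∀ i, R i →+* A
  ρ_refl : ∀ i (x : R i), ρ le_rfl x = x
  ρ_trans : ∀ {i j l} (h : i ≤ j) (h' : j ≤ l) (x : R i), ρ h' (ρ h x) = ρ (h.trans h') x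
  ι_ρ : ∀ {i j} (h : i ≤ j) (x : R i), ι j (ρ h x) = ι i x
  surj : ∀ a : A, ∃ i, ∃ x : R i, ι i x = a
  inj : ∀ i (x : R i), ι i x = 0 → ∃ j, ∃ h : i ≤ j, ρ h x = 0
  flatDim : ∀ i, FlatDimHomLE d (ι i)

section Reduction

variable {R R₁ R₂ X X₁ X₂ : Type u} [CommRing R] [CommRing R₁] [CommRing R₂] [CommRing X]
  [CommRing X₁] [CommRing X₂]

theorem isReductionMod_of_ringHom {φ : R →+* X} {φ₁ : R₁ →+* X₁} {f : R →+* R₁} {g : X →+* X₁}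
    {a : R} (hc : ∀ r, g (φ r) = φ₁ (f r)) (hf : Function.Surjective f)
    (hg : Function.Surjective g) (hfk : ∀ r, f r = 0 ↔ ∃ r', r = a * r')
    (hgk : ∀ x, g x = 0 ↔ ∃ x', x = φ a * x') :
    letI := φ.toAlgebra
    letI := φ₁.toAlgebra
    IsReductionMod a f (g : X →+ X₁) :=
  letI := φ.toAlgebra
  letI := φ₁.toAlgebra
  { surj_ring := hf
    ker_ring := hfk
    surj := hg
    map_smul := fun r x => by
      change g (φ r * x) = φ₁ (f r) * g x
      rw [map_mul, hc]
    ker := hgk }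

/-- Dévissage of flat dimension, for algebras. -/
theorem FlatDimHomLE.of_reduction {φ : R →+* X} {φ₁ : R₁ →+* X₁} {φ₂ : R₂ →+* X₂} {a b : R}
    (hab : a * b = 0) (hRa : ∀ r : R, a * r = 0 → ∃ r', r = b * r')
    (hRb : ∀ r : R, b * r = 0 → ∃ r', r = a * r')
    (hXa : ∀ x, φ a * x = 0 → ∃ x', x = φ b * x') (hXb : ∀ x, φ b * x = 0 → ∃ x', x = φ a * x')
    {f₁ : R →+* R₁} {g₁ : X →+* X₁} (hc₁ : ∀ r, g₁ (φ r) = φ₁ (f₁ r))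
    (hf₁ : Function.Surjective f₁) (hg₁ : Function.Surjective g₁)
    (hfk₁ : ∀ r, f₁ r = 0 ↔ ∃ r', r = a * r') (hgk₁ : ∀ x, g₁ x = 0 ↔ ∃ x', x = φ a * x')
    {f₂ : R →+* R₂} {g₂ : X →+* X₂} (hc₂ : ∀ r, g₂ (φ r) = φ₂ (f₂ r))
    (hf₂ : Function.Surjective f₂) (hg₂ : Function.Surjective g₂)
    (hfk₂ : ∀ r, f₂ r = 0 ↔ ∃ r', r = b * r') (hgk₂ : ∀ x, g₂ x = 0 ↔ ∃ x', x = φ b * x')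
    {d : ℕ} (h₁ : FlatDimHomLE d φ₁) (h₂ : FlatDimHomLE d φ₂) : FlatDimHomLE d φ := by
  let := φ.toAlgebra
  let := φ₁.toAlgebra
  let := φ₂.toAlgebra
  exact FlatDimLE.of_isReductionMod hab hRa hRb d
    (isReductionMod_of_ringHom hc₁ hf₁ hg₁ hfk₁ hgk₁)
    (isReductionMod_of_ringHom hc₂ hf₂ hg₂ hfk₂ hgk₂) hXa hXb h₁ h₂

theorem factor_eq_zero_iff {U : Type u} [CommRing U] {I J : Ideal U} (h : I ≤ J) {x : U}
    (hJ : ∀ g, g ∈ J ↔ ∃ y, ∃ z ∈ I, g = y * x + z) (r : U ⧸ I) :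
    Ideal.Quotient.factor h r = 0 ↔ ∃ r', r = Ideal.Quotient.mk I x * r' := by
  obtain ⟨g, rfl⟩ := Ideal.Quotient.mk_surjective r
  rw [Ideal.Quotient.factor_mk, Ideal.Quotient.eq_zero_iff_mem, hJ]
  constructor
  · rintro ⟨y, z, hz, rfl⟩
    refine ⟨Ideal.Quotient.mk I y, ?_⟩
    rw [map_add, Ideal.Quotient.eq_zero_iff_mem.2 hz, add_zero, map_mul, mul_comm]
  · rintro ⟨r', h'⟩
    obtain ⟨y, rfl⟩ := Ideal.Quotient.mk_surjective r'
    rw [← map_mul, Ideal.Quotient.mk_eq_mk_iff_sub_mem] at h'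
    exact ⟨y, _, h', by ring⟩

theorem exists_eq_mk_mul {U : Type u} [CommRing U] {I J : Ideal U} {x a : U}
    (hJ : ∀ g, g ∈ J ↔ ∃ y, ∃ z ∈ I, g = y * x + z) (ha : ∀ g, a * g ∈ I → g ∈ J) (r : U ⧸ I)
    (h : Ideal.Quotient.mk I a * r = 0) : ∃ r', r = Ideal.Quotient.mk I x * r' := by
  obtain ⟨g, rfl⟩ := Ideal.Quotient.mk_surjective r
  rw [← map_mul, Ideal.Quotient.eq_zero_iff_mem] at h
  obtain ⟨y, z, hz, rfl⟩ := (hJ g).1 (ha g h)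
  refine ⟨Ideal.Quotient.mk I y, ?_⟩
  rw [map_add, Ideal.Quotient.eq_zero_iff_mem.2 hz, add_zero, map_mul, mul_comm]

end Reduction

section Truncation

variable (k : Type u) [Field k] (N : ℕ)

/-- The homomorphism that replaces the variables `a_j` with `j ≥ i` by zero. -/
noncomputable def trunc (i : ℕ) : FreeAlg k N →ₐ[k] FreeAlg k N :=
  MvPolynomial.aeval (Sum.elim (fun j => if j < i then MvPolynomial.X (Sum.inl j) else 0)
    (fun q => MvPolynomial.X (Sum.inr q)))

/-- The elements whose truncation lies in `idl k N r s (Set.Iio i)`. -/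
noncomputable def truncIdl (r s i : ℕ) : Ideal (FreeAlg k N) :=
  (idl k N r s (Set.Iio i)).comap (trunc k N i)

variable {k N} {r s i : ℕ}

theorem trunc_av (i j : ℕ) : trunc k N i (av k N j) = if j < i then av k N j else 0 := by
  simp [trunc, av]

theorem trunc_beta (i p s : ℕ) : trunc k N i (beta k N p s) = beta k N p s := by
  rw [beta]
  split_ifs <;> simp [trunc]

theorem trunc_rel {l : ℕ} (h : l < i) : trunc k N i (rel k N l) = rel k N l := by
  rw [rel, map_sum]
  refine Finset.sum_congr rfl fun x hx => ?_
  rw [Finset.HasAntidiagonal.mem_antidiagonal] at hx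
  rw [map_mul, trunc_beta, trunc_av, if_pos (by omega)]

theorem trunc_trunc {i j : ℕ} (h : i ≤ j) (g : FreeAlg k N) :
    trunc k N j (trunc k N i g) = trunc k N i g := by
  have : (trunc k N j).comp (trunc k N i) = trunc k N i := by
    ext v
    rcases v with m | q
    · simp only [trunc, AlgHom.comp_apply, MvPolynomial.aeval_X, Sum.elim_inl]
      split_ifs with hm
      · simp [hm.trans_le h]
      · simp
    · simp [trunc]
  exact AlgHom.congr_fun this g

theorem exists_trunc_eq (g : FreeAlg k N) : ∃ i, trunc k N i g = g := by
  have key : ∃ i, ∀ j, i ≤ j → trunc k N j g = g := by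
    induction g using MvPolynomial.induction_on with
    | C c => exact ⟨0, fun j _ => by rw [MvPolynomial.algHom_C]; rfl⟩
    | add p q hp hq =>
      obtain ⟨i, hi⟩ := hp
      obtain ⟨j, hj⟩ := hq
      exact ⟨max i j, fun l hl => by
        rw [map_add, hi l ((le_max_left _ _).trans hl), hj l ((le_max_right _ _).trans hl)]⟩
    | mul_X p v hp =>
      obtain ⟨i, hi⟩ := hp
      rcases v with m | q
      · refine ⟨max i (m + 1), fun l hl => ?_⟩
        have : m < l := by have := (le_max_right i (m + 1)).trans hl; omega
        rw [map_mul, hi l ((le_max_left _ _).trans hl)]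
        simp [trunc, this]
      · refine ⟨i, fun l hl => ?_⟩
        rw [map_mul, hi l hl]
        simp [trunc]
  obtain ⟨i, hi⟩ := key
  exact ⟨i, hi i le_rfl⟩

theorem mem_truncIdl {g : FreeAlg k N} :
    g ∈ truncIdl k N r s i ↔ trunc k N i g ∈ idl k N r s (Set.Iio i) := Iff.rfl

theorem idl_le_truncIdl : idl k N r s (Set.Iio i) ≤ truncIdl k N r s i := by
  rw [idl_le_iff]
  refine ⟨fun l hl => ?_, fun j hj => ?_, fun p hp => ?_⟩
  · rw [mem_truncIdl, trunc_rel hl]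
    exact rel_mem_idl hl
  · rw [mem_truncIdl, trunc_av]
    split_ifs
    · exact av_mem_idl hj
    · exact zero_mem _
  · rw [mem_truncIdl, trunc_beta]
    exact beta_mem_idl hp

theorem sub_trunc_mem_truncIdl (g : FreeAlg k N) : g - trunc k N i g ∈ truncIdl k N r s i := by
  rw [mem_truncIdl, map_sub, trunc_trunc le_rfl, sub_self]
  exact zero_mem _

theorem mem_truncIdl_iff_of {r' s' : ℕ} {x : FreeAlg k N}
    (hx : trunc k N i x = x)
    (h : ∀ g, g ∈ idl k N r' s' (Set.Iio i) ↔
      ∃ y, ∃ z ∈ idl k N r s (Set.Iio i), g = y * x + z) (g : FreeAlg k N) :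
    g ∈ truncIdl k N r' s' i ↔ ∃ y, ∃ z ∈ truncIdl k N r s i, g = y * x + z := by
  constructor
  · intro hg
    obtain ⟨y, z, hz, e⟩ := (h _).1 hg
    refine ⟨y, z + (g - trunc k N i g),
      Ideal.add_mem _ (idl_le_truncIdl hz) (sub_trunc_mem_truncIdl g), ?_⟩
    rw [← add_assoc, ← e]
    ring
  · rintro ⟨y, z, hz, rfl⟩
    rw [mem_truncIdl, map_add, map_mul, hx, h]
    exact ⟨_, _, hz, rfl⟩

theorem mem_truncIdl_succ_left {g : FreeAlg k N} : g ∈ truncIdl k N (r + 1) s i ↔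
    ∃ y, ∃ z ∈ truncIdl k N r s i, g = y * beta k N r s + z :=
  mem_truncIdl_iff_of (trunc_beta i r s) (fun _ => mem_idl_succ_left) g

theorem mem_truncIdl_succ_right (hr : r < N) (hs : s < i) {g : FreeAlg k N} :
    g ∈ truncIdl k N r (s + 1) i ↔ ∃ y, ∃ z ∈ truncIdl k N r s i, g = y * av k N s + z :=
  mem_truncIdl_iff_of (by rw [trunc_av, if_pos hs]) (fun _ => mem_idl_succ_right hr) g

variable (k N r s i) in
/-- The homomorphism from the `i`-th truncated ring to its limit. -/
noncomputable def toLim :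
    FreeAlg k N ⧸ truncIdl k N r s i →+* FreeAlg k N ⧸ idl k N r s Set.univ :=
  Ideal.quotientMap _ (trunc k N i).toRingHom fun _ hg => idl_mono (Set.subset_univ _) hg

theorem toLim_mk (g : FreeAlg k N) : toLim k N r s i (Ideal.Quotient.mk _ g) =
    Ideal.Quotient.mk _ (trunc k N i g) := rfl

/-- A truncated ring that is defined by variables and differences of variables and constants is a
polynomial ring. -/
theorem weakDimLE_truncIdl {τ : Set (ℕ ⊕ Fin N)} {c : ℕ ⊕ Fin N → k}
    (hc : ∀ j, c (Sum.inl j) = 0)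
    (h : ∀ v ∉ τ, MvPolynomial.X v - MvPolynomial.C (c v) ∈ idl k N r s (Set.Iio i))
    (hI : ∀ g ∈ idl k N r s (Set.Iio i), substHom τ c g = 0) {T : Finset ℕ}
    (hT : ∀ j < i, Sum.inl j ∈ τ → j ∈ T) :
    WeakDimLE (FreeAlg k N ⧸ truncIdl k N r s i) (T.card + N) := by
  let τ' : Set (ℕ ⊕ Fin N) := {v | v ∈ τ ∧ Sum.elim (fun j => j < i) (fun _ => True) v}
  have h1 : (substHom τ' c).comp (((MvPolynomial.rename (Subtype.val : τ → _)).comp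
      (substHom τ c)).comp (trunc k N i)) = substHom τ' c := by
    apply MvPolynomial.algHom_ext
    intro v
    have key : v ∉ τ' → Sum.elim (fun j => j < i) (fun _ => True) v →
        substHom τ' c (MvPolynomial.rename Subtype.val (substHom τ c (MvPolynomial.X v))) =
          substHom τ' c (MvPolynomial.X v) := by
      intro hv hv'
      have : v ∉ τ := fun hvτ => hv ⟨hvτ, hv'⟩
      rw [substHom_X_of_notMem _ this, substHom_X_of_notMem _ hv, MvPolynomial.rename_C,
        MvPolynomial.algHom_C]
      rfl
    have key' : v ∈ τ' →
        substHom τ' c (MvPolynomial.rename Subtype.val (substHom τ c (MvPolynomial.X v))) =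
          substHom τ' c (MvPolynomial.X v) := fun hv => by
      rw [substHom_X_of_mem _ hv.1, MvPolynomial.rename_X]
    have key'' : Sum.elim (fun j => j < i) (fun _ => True) v →
        substHom τ' c (MvPolynomial.rename Subtype.val (substHom τ c (MvPolynomial.X v))) =
          substHom τ' c (MvPolynomial.X v) := fun hv => by
      by_cases hv' : v ∈ τ'
      · exact key' hv'
      · exact key hv' hv
    rcases v with j | q
    · by_cases hj : j < i
      · have : trunc k N i (MvPolynomial.X (Sum.inl j)) = MvPolynomial.X (Sum.inl j) := by
          simp [trunc, hj]
        simp only [AlgHom.comp_apply, this]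
        exact key'' hj
      · have h0 : trunc k N i (MvPolynomial.X (Sum.inl j)) = 0 := by simp [trunc, hj]
        have hj' : Sum.inl j ∉ τ' := fun h => hj h.2
        simp [AlgHom.comp_apply, h0, substHom_X_of_notMem _ hj', hc]
    · have : trunc k N i (MvPolynomial.X (Sum.inr q)) = MvPolynomial.X (Sum.inr q) := by
        simp [trunc]
      simp only [AlgHom.comp_apply, this]
      exact key'' trivial
  have h2 := mem_iff_substHom_eq_zero (τ := τ') (c := c) (I := truncIdl k N r s i) (fun v hv => ?_)
    (fun g hg => ?_)
  · have h3 : truncIdl k N r s i = RingHom.ker (substHom τ' c) := by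
      ext g
      exact h2 g
    let e : (FreeAlg k N ⧸ truncIdl k N r s i) ≃+* MvPolynomial τ' k :=
      (Ideal.quotEquivOfEq h3).trans
        (RingHom.quotientKerEquivOfSurjective (substHom_surjective τ' c))
    classical
    let T' : Finset (ℕ ⊕ Fin N) := T.map Function.Embedding.inl ∪
      (Finset.univ : Finset (Fin N)).map Function.Embedding.inr
    have hsub : τ' ⊆ T' := by
      rintro (j | q) hv
      · simp [T', hT j hv.2 hv.1]
      · simp [T']
    have hfin : Finite τ' := (T'.finite_toSet.subset hsub)
    have hcard : Nat.card τ' ≤ T.card + N := by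
      refine (Set.ncard_le_ncard hsub T'.finite_toSet).trans ?_
      rw [Set.ncard_coe_finset]
      refine (Finset.card_union_le _ _).trans ?_
      simp
    exact (WeakDimLE.mvPolynomial k τ' hcard).of_ringEquiv e.symm
  · by_cases hv' : v ∈ τ
    · rcases v with j | q
      · have hj : ¬ j < i := fun hj => hv ⟨hv', hj⟩
        rw [hc, MvPolynomial.C_0, sub_zero, mem_truncIdl]
        have := trunc_av (k := k) (N := N) i j
        rw [if_neg hj] at this
        rw [show trunc k N i (MvPolynomial.X (Sum.inl j)) = 0 from this]
        exact zero_mem _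
      · exact absurd ⟨hv', trivial⟩ hv
    · exact idl_le_truncIdl (h v hv')
  · rw [← h1]
    simp [AlgHom.comp_apply, hI _ hg]

theorem flatDimHomLE_toLim_of_weakDimLE {d : ℕ}
    (h : WeakDimLE (FreeAlg k N ⧸ truncIdl k N r s i) d) : FlatDimHomLE d (toLim k N r s i) :=
  @h _ _ (toLim k N r s i).toAlgebra.toModule

theorem flatDimHomLE_toLim_top [CharZero k] (hN : 0 < N) (s i : ℕ) :
    FlatDimHomLE (2 * N) (toLim k N N s i) := by
  refine flatDimHomLE_toLim_of_weakDimLE fun X _ _ => (weakDimLE_truncIdl (fun _ => rfl)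
    (fun v hv => X_sub_C_mem_idl_top hN hv) (substHom_top_eq_zero hN i)
    (T := insert s (Finset.Ico (i + 1 - N) i)) (fun j hj hv => ?_) X).mono ?_
  · rw [Finset.mem_insert, Finset.mem_Ico]
    have hv' : s ≤ j ∧ (j = s ∨ i < j + N) := hv
    omega
  · have := Finset.card_insert_le s (Finset.Ico (i + 1 - N) i)
    rw [Nat.card_Ico] at this
    omega

theorem flatDimHomLE_toLim_low (hr : r < N) (hi : i ≤ r + s) :
    FlatDimHomLE (2 * N) (toLim k N r s i) := by
  refine flatDimHomLE_toLim_of_weakDimLE fun X _ _ => (weakDimLE_truncIdl (c := 0) (fun _ => rfl)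
    (fun v hv => by rw [Pi.zero_apply]; exact X_sub_C_mem_idl_low hr hv)
    (substHom_low_eq_zero hr hi) (T := Finset.Ico s i) (fun j hj hv => ?_) X).mono ?_
  · have hv' : s ≤ j := hv
    exact Finset.mem_Ico.2 ⟨hv', hj⟩
  · rw [Nat.card_Ico]
    omega

theorem of_mul_mem_truncIdl [CharZero k] (hr : r < N) (hi : r + s < i) (g : FreeAlg k N) :
    (av k N s * g ∈ truncIdl k N r s i → g ∈ truncIdl k N (r + 1) s i) ∧
      (beta k N r s * g ∈ truncIdl k N r s i → g ∈ truncIdl k N r (s + 1) i) := by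
  simp only [mem_truncIdl, map_mul, trunc_beta, trunc_av, if_pos (show s < i by omega)]
  exact of_mul_mem_idl_Iio i hr hi _

/-- The limit rings have uniformly bounded flat dimension over the truncated rings. The induction
on `t` increases `r` or `s`; for `r = N` and for `i ≤ r + s`, the truncated ring is a polynomial
ring in at most `2 * N` variables. -/
theorem flatDimHomLE_toLim [CharZero k] (hN : 0 < N) (t : ℕ) :
    ∀ {r s : ℕ}, r ≤ N → i ≤ r + s + t → FlatDimHomLE (2 * N) (toLim k N r s i) := by
  induction t with
  | zero =>
    intro r s hr hi
    rcases hr.eq_or_lt with rfl | hr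
    · exact flatDimHomLE_toLim_top hN s i
    · exact flatDimHomLE_toLim_low hr hi
  | succ t ih =>
    intro r s hr hi
    rcases hr.eq_or_lt with rfl | hr
    · exact flatDimHomLE_toLim_top hN s i
    by_cases hi' : i ≤ r + s
    · exact flatDimHomLE_toLim_low hr hi'
    rw [not_le] at hi'
    have hs : s < i := by omega
    have ha : toLim k N r s i (Ideal.Quotient.mk _ (av k N s)) =
        Ideal.Quotient.mk _ (av k N s) := by
      rw [toLim_mk, trunc_av, if_pos hs]
    have hb : toLim k N r s i (Ideal.Quotient.mk _ (beta k N r s)) =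
        Ideal.Quotient.mk _ (beta k N r s) := by
      rw [toLim_mk, trunc_beta]
    have hl : truncIdl k N r s i ≤ truncIdl k N (r + 1) s i := fun g hg =>
      mem_truncIdl_succ_left.2 ⟨0, g, hg, by ring⟩
    have hr' : truncIdl k N r s i ≤ truncIdl k N r (s + 1) i := fun g hg =>
      (mem_truncIdl_succ_right hr hs).2 ⟨0, g, hg, by ring⟩
    refine FlatDimHomLE.of_reduction (a := Ideal.Quotient.mk _ (av k N s))
      (b := Ideal.Quotient.mk _ (beta k N r s))
      (φ₁ := toLim k N r (s + 1) i) (φ₂ := toLim k N (r + 1) s i)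
      (f₁ := Ideal.Quotient.factor hr') (f₂ := Ideal.Quotient.factor hl)
      (g₁ := Ideal.Quotient.factor (idl_le_succ_right hr))
      (g₂ := Ideal.Quotient.factor idl_le_succ_left)
      ?_ ?_ ?_ ?_ ?_ ?_ (Ideal.Quotient.factor_surjective _) (Ideal.Quotient.factor_surjective _)
      ?_ ?_ ?_ (Ideal.Quotient.factor_surjective _) (Ideal.Quotient.factor_surjective _) ?_ ?_
      (ih hr.le (by omega)) (ih hr (by omega))
    · rw [← map_mul, Ideal.Quotient.eq_zero_iff_mem, mul_comm]
      exact idl_le_truncIdl (beta_mul_av_mem_idl hr (Set.mem_Iio.2 hi'))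
    · exact exists_eq_mk_mul (fun _ => mem_truncIdl_succ_left)
        (fun g => (of_mul_mem_truncIdl hr hi' g).1)
    · exact exists_eq_mk_mul (fun _ => mem_truncIdl_succ_right hr hs)
        (fun g => (of_mul_mem_truncIdl hr hi' g).2)
    · rw [ha, hb]
      exact exists_eq_mk_mul (fun _ => mem_idl_succ_left) (fun g => (of_mul_mem_idl_univ hr g).1)
    · rw [ha, hb]
      exact exists_eq_mk_mul (fun _ => mem_idl_succ_right hr)
        (fun g => (of_mul_mem_idl_univ hr g).2)
    · intro x
      obtain ⟨g, rfl⟩ := Ideal.Quotient.mk_surjective x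
      rw [toLim_mk, Ideal.Quotient.factor_mk, Ideal.Quotient.factor_mk, toLim_mk]
    · exact factor_eq_zero_iff _ fun _ => mem_truncIdl_succ_right hr hs
    · rw [ha]
      exact factor_eq_zero_iff _ fun _ => mem_idl_succ_right hr
    · intro x
      obtain ⟨g, rfl⟩ := Ideal.Quotient.mk_surjective x
      rw [toLim_mk, Ideal.Quotient.factor_mk, Ideal.Quotient.factor_mk, toLim_mk]
    · exact factor_eq_zero_iff _ fun _ => mem_truncIdl_succ_left
    · rw [hb]
      exact factor_eq_zero_iff _ fun _ => mem_idl_succ_left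

instance isNoetherianRing_truncIdl : IsNoetherianRing (FreeAlg k N ⧸ truncIdl k N r s i) := by
  let φ : MvPolynomial (Fin i ⊕ Fin N) k →ₐ[k] FreeAlg k N :=
    MvPolynomial.rename (Sum.map Fin.val id)
  refine isNoetherianRing_of_surjective _ _
    ((Ideal.Quotient.mk (truncIdl k N r s i)).comp φ.toRingHom) fun x => ?_
  obtain ⟨g, rfl⟩ := Ideal.Quotient.mk_surjective x
  let ψ : FreeAlg k N →ₐ[k] MvPolynomial (Fin i ⊕ Fin N) k :=
    MvPolynomial.aeval (Sum.elim
      (fun j => if h : j < i then MvPolynomial.X (Sum.inl ⟨j, h⟩) else 0)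
      (fun q => MvPolynomial.X (Sum.inr q)))
  have h : φ.comp ψ = trunc k N i := by
    ext v
    rcases v with j | q
    · by_cases hj : j < i <;> simp [φ, ψ, trunc, hj]
    · simp [φ, ψ, trunc]
  refine ⟨ψ g, ?_⟩
  have h' : φ (ψ g) = trunc k N i g := AlgHom.congr_fun h g
  change Ideal.Quotient.mk _ (φ (ψ g)) = _
  rw [h']
  exact ((Ideal.Quotient.mk_eq_mk_iff_sub_mem _ _).2 (sub_trunc_mem_truncIdl g)).symm

theorem truncIdl_le_comap {i j : ℕ} (h : i ≤ j) : truncIdl k N r s i ≤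
    (truncIdl k N r s j).comap (trunc k N i) := fun g hg => by
  rw [Ideal.mem_comap, mem_truncIdl, trunc_trunc h]
  exact idl_mono (Set.Iio_subset_Iio h) hg

variable (k N) in
/-- The presentation of the ring `FreeAlg k N ⧸ idl k N 0 0 Set.univ`, which is `A k N`, as the
colimit of the truncated rings. -/
noncomputable def noetherianSystem [CharZero k] (hN : 0 < N) :
    NoetherianSystem (FreeAlg k N ⧸ idl k N 0 0 Set.univ) (2 * N) where
  R i := FreeAlg k N ⧸ truncIdl k N 0 0 i
  ρ {i j} h := Ideal.quotientMap _ (trunc k N i).toRingHom (truncIdl_le_comap h)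
  ι i := toLim k N 0 0 i
  ρ_refl i x := by
    obtain ⟨g, rfl⟩ := Ideal.Quotient.mk_surjective x
    exact ((Ideal.Quotient.mk_eq_mk_iff_sub_mem _ _).2 (sub_trunc_mem_truncIdl g)).symm
  ρ_trans {i j l} h h' x := by
    obtain ⟨g, rfl⟩ := Ideal.Quotient.mk_surjective x
    exact congrArg (Ideal.Quotient.mk _) (trunc_trunc h g)
  ι_ρ {i j} h x := by
    obtain ⟨g, rfl⟩ := Ideal.Quotient.mk_surjective x
    exact congrArg (Ideal.Quotient.mk _) (trunc_trunc h g)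
  surj a := by
    obtain ⟨g, rfl⟩ := Ideal.Quotient.mk_surjective a
    obtain ⟨i, hi⟩ := exists_trunc_eq g
    exact ⟨i, Ideal.Quotient.mk _ g, by rw [toLim_mk, hi]⟩
  inj i x hx := by
    obtain ⟨g, rfl⟩ := Ideal.Quotient.mk_surjective x
    rw [toLim_mk, Ideal.Quotient.eq_zero_iff_mem] at hx
    obtain ⟨l, hl, h⟩ := exists_mem_idl_Iio hx i
    exact ⟨l, hl, Ideal.Quotient.eq_zero_iff_mem.2 (idl_le_truncIdl h)⟩
  flatDim i := flatDimHomLE_toLim hN i (Nat.zero_le _) (by omega)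

end Truncation

/-- A Noetherian ring is the colimit of a constant system. -/
def NoetherianSystem.const (A : Type u) [CommRing A] [IsNoetherianRing A] :
    NoetherianSystem A 0 where
  R _ := A
  ρ _ := RingHom.id A
  ι _ := RingHom.id A
  ρ_refl _ _ := rfl
  ρ_trans _ _ _ := rfl
  ι_ρ _ _ := rfl
  surj a := ⟨0, a, rfl⟩
  inj i _ hx := ⟨i, le_rfl, hx⟩
  flatDim _ := (inferInstance : Module.Flat A A)

/-! ### Complexes of modules -/

/-- A cochain complex of `R`-modules, in elementary terms: the differential is given only between
consecutive degrees. -/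
structure Cx (R : Type u) [CommRing R] where
  /-- The module in degree `q`. -/
  X : ℤ → Type u
  [acg : ∀ q, AddCommGroup (X q)]
  [mod : ∀ q, Module R (X q)]
  /-- The differential. -/
  d : ∀ q, X q →ₗ[R] X (q + 1)
  dd : ∀ q x, d (q + 1) (d q x) = 0

attribute [instance] Cx.acg Cx.mod

namespace Cx

variable {R : Type u} [CommRing R]

/-- Morphisms of complexes. -/
structure Hom (C D : Cx R) where
  /-- The component in degree `q`. -/
  f : ∀ q, C.X q →ₗ[R] D.X q
  comm : ∀ q x, f (q + 1) (C.d q x) = D.d q (f q x)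

/-- The associated object of the category of cochain complexes. -/
noncomputable def toCC (C : Cx R) : CochainComplex (ModuleCat.{u} R) ℤ :=
  CochainComplex.of (fun q => ModuleCat.of R (C.X q)) (fun q => ModuleCat.ofHom (C.d q))
    fun q => by ext x; exact C.dd q x

theorem toCC_d (C : Cx R) (q : ℤ) : C.toCC.d q (q + 1) = ModuleCat.ofHom (C.d q) :=
  CochainComplex.of_d (fun q => ModuleCat.of R (C.X q)) (fun q => ModuleCat.ofHom (C.d q)) q

/-- The associated morphism of cochain complexes. -/
noncomputable def Hom.toCC {C D : Cx R} (φ : Hom C D) : C.toCC ⟶ D.toCC where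
  f q := ModuleCat.ofHom (φ.f q)
  comm' q q' h := by
    obtain rfl : q + 1 = q' := h
    rw [toCC_d, toCC_d]
    ext x
    exact (φ.comm q x).symm

/-- The complex underlying an object of the category of cochain complexes. -/
noncomputable def ofCC (K : CochainComplex (ModuleCat.{u} R) ℤ) : Cx R where
  X q := K.X q
  d q := (K.d q (q + 1)).hom
  dd q x := by
    have := congrArg (fun f => f.hom x) (K.d_comp_d q (q + 1) (q + 1 + 1))
    exact this

/-- Passing to the elementary description of a complex and back does not change it. -/
noncomputable def toCCOfCC (K : CochainComplex (ModuleCat.{u} R) ℤ) : (ofCC K).toCC ≅ K :=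
  HomologicalComplex.Hom.isoOfComponents (fun q => Iso.refl (K.X q)) fun q q' h => by
    obtain rfl : q + 1 = q' := h
    rw [toCC_d]
    ext x
    rfl

/-- The complex of kernels of a morphism. -/
def ker {C D : Cx R} (φ : Hom C D) : Cx R where
  X q := LinearMap.ker (φ.f q)
  d q := (C.d q).restrict fun x hx => by
    rw [LinearMap.mem_ker] at hx ⊢
    rw [φ.comm, hx, map_zero]
  dd q x := Subtype.ext (C.dd q x.1)

/-- The inclusion of the complex of kernels. -/
def kerι {C D : Cx R} (φ : Hom C D) : Hom (ker φ) C where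
  f q := (LinearMap.ker (φ.f q)).subtype
  comm _ _ := rfl

theorem shortExact {C₁ C₂ C₃ : Cx R} (i : Hom C₁ C₂) (p : Hom C₂ C₃)
    (hi : ∀ q, Function.Injective (i.f q)) (hip : ∀ q, Function.Exact (i.f q) (p.f q))
    (hp : ∀ q, Function.Surjective (p.f q)) :
    ∃ w : i.toCC ≫ p.toCC = 0, (ShortComplex.mk i.toCC p.toCC w).ShortExact := by
  have w : i.toCC ≫ p.toCC = 0 := by
    ext q x
    exact (hip q).apply_apply_eq_zero x
  refine ⟨w, HomologicalComplex.shortExact_of_degreewise_shortExact _ fun q => ?_⟩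
  have e : (ShortComplex.mk i.toCC p.toCC w).map (HomologicalComplex.eval _ _ q) =
    ShortComplex.mk (ModuleCat.ofHom (i.f q)) (ModuleCat.ofHom (p.f q))
      (by ext x; exact (hip q).apply_apply_eq_zero x) := rfl
  rw [e]
  refine { exact := ?_, mono_f := ?_, epi_g := ?_ }
  · rw [ShortComplex.moduleCat_exact_iff]
    intro x hx
    exact (hip q x).1 hx
  · exact (ModuleCat.mono_iff_injective _).2 (hi q)
  · exact (ModuleCat.epi_iff_surjective _).2 (hp q)

theorem acyclic_toCC {C : Cx R} (h : ∀ q x, C.d (q + 1) x = 0 → ∃ y, C.d q y = x) :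
    C.toCC.Acyclic := by
  intro q
  obtain ⟨q, rfl⟩ : ∃ q', q = q' + 1 := ⟨q - 1, by ring⟩
  rw [HomologicalComplex.exactAt_iff' _ q (q + 1) (q + 1 + 1) (by simp) (by simp),
    ShortComplex.moduleCat_exact_iff]
  intro x hx
  have hx' : (C.toCC.d (q + 1) (q + 1 + 1)).hom x = 0 := hx
  rw [toCC_d] at hx'
  obtain ⟨y, hy⟩ := h q x hx'
  refine ⟨y, ?_⟩
  change (C.toCC.d q (q + 1)).hom y = x
  rw [toCC_d]
  exact hy

variable [HasDerivedCategory.{w} (ModuleCat.{u} R)]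

/-- A surjection of complexes with acyclic kernel is an isomorphism in the derived category. -/
theorem isIso_Q_map {C D : Cx R} (φ : Hom C D) (hφ : ∀ q, Function.Surjective (φ.f q))
    (h : ∀ q x, φ.f (q + 1) x = 0 → C.d (q + 1) x = 0 → ∃ y, φ.f q y = 0 ∧ C.d q y = x) :
    IsIso (DerivedCategory.Q.map φ.toCC) := by
  obtain ⟨hw, hS⟩ := shortExact (kerι φ) φ (fun q => Submodule.injective_subtype _)
    (fun q => LinearMap.exact_subtype_ker_map _) hφ
  have hK : (ker φ).toCC.Acyclic := acyclic_toCC fun q x hx => by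
    obtain ⟨y, hy, hyx⟩ := h q x.1 x.2 (congrArg Subtype.val hx)
    exact ⟨⟨y, hy⟩, Subtype.ext hyx⟩
  have hz : IsZero (DerivedCategory.Q.obj (ker φ).toCC) := by
    have h0 : QuasiIso (0 : (ker φ).toCC ⟶ (ker φ).toCC) :=
      ⟨fun q => (quasiIsoAt_iff_exactAt _ q (hK q)).2 (hK q)⟩
    rw [← DerivedCategory.isIso_Q_map_iff_quasiIso, Functor.map_zero] at h0
    rw [IsZero.iff_id_eq_zero, ← IsIso.hom_inv_id (0 : DerivedCategory.Q.obj (ker φ).toCC ⟶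
      DerivedCategory.Q.obj (ker φ).toCC),
      zero_comp]
  exact (Pretriangulated.Triangle.isZero₁_iff_isIso₂ _
    (DerivedCategory.triangleOfSES_distinguished hS)).1 hz

end Cx

section Res

variable {R : Type u} [CommRing R] (C : Cx R) (G : ∀ q, Set (C.X q))

/-- The canonical surjection onto `C.X q` from the free module on its underlying set. -/
noncomputable abbrev Cx.lc (q : ℤ) : (C.X q →₀ R) →ₗ[R] C.X q :=
  Finsupp.linearCombination R id

/-- The pairs `(f, g)` of formal combinations of elements of `G (q + 1)` and of `G q` such that the
value of `f` is the differential of that of `g`. -/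
noncomputable def resSub (q : ℤ) : Submodule R ((C.X (q + 1) →₀ R) × (C.X q →₀ R)) :=
  (Finsupp.supported R R (G (q + 1))).prod (Finsupp.supported R R (G q)) ⊓
    LinearMap.ker (C.lc (q + 1) ∘ₗ LinearMap.fst R _ _ - C.d q ∘ₗ C.lc q ∘ₗ LinearMap.snd R _ _)

variable {C G} in
theorem mem_resSub {q : ℤ} {x : (C.X (q + 1) →₀ R) × (C.X q →₀ R)} :
    x ∈ resSub C G q ↔ x.1 ∈ Finsupp.supported R R (G (q + 1)) ∧ x.2 ∈ Finsupp.supported R R (G q) ∧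
      C.lc (q + 1) x.1 = C.d q (C.lc q x.2) := by
  simp [resSub, sub_eq_zero, and_assoc]

/-- For generating sets `G q`, a complex that is quasi-isomorphic to `C` and has shorter flat
resolutions: its term in degree `q` is the first syzygy of `C.X (q + 1)` with respect to the
presentation by the free module on `G (q + 1) ⊔ G q`, where the second summand acts through the
differential. -/
noncomputable def res : Cx R where
  X q := resSub C G q
  d q := (LinearMap.inr R _ _ ∘ₗ LinearMap.fst R _ _).restrict fun x hx => by
    rw [mem_resSub] at hx ⊢
    refine ⟨zero_mem _, hx.1, ?_⟩
    change C.lc _ 0 = C.d _ (C.lc _ x.1)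
    rw [hx.2.2, C.dd, map_zero]
  dd _ _ := rfl

/-- The quasi-isomorphism from `res C G` to `C`. -/
noncomputable def resπ : Cx.Hom (res C G) C where
  f q := C.lc q ∘ₗ LinearMap.snd R _ _ ∘ₗ (resSub C G q).subtype
  comm _ x := (mem_resSub.1 x.2).2.2

variable {C G}

theorem isIso_Q_map_resπ [HasDerivedCategory.{w} (ModuleCat.{u} R)]
    (hG : ∀ q x, ∃ f ∈ Finsupp.supported R R (G q), C.lc q f = x) :
    IsIso (DerivedCategory.Q.map (resπ C G).toCC) := by
  refine Cx.isIso_Q_map _ (fun q x => ?_) fun q x hx hdx => ?_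
  · obtain ⟨g, hg, rfl⟩ := hG q x
    obtain ⟨f, hf, h⟩ := hG (q + 1) (C.d q (C.lc q g))
    exact ⟨⟨(f, g), mem_resSub.2 ⟨hf, hg, h⟩⟩, rfl⟩
  · obtain ⟨⟨f, g⟩, hfg⟩ := x
    obtain rfl : f = 0 := congrArg (fun z => z.1.2) hdx
    have hg : C.lc (q + 1) g = 0 := hx
    refine ⟨⟨(g, 0), mem_resSub.2 ⟨(mem_resSub.1 hfg).2.1, zero_mem _, ?_⟩⟩,
      map_zero (C.lc q), rfl⟩
    change C.lc (q + 1) g = C.d q (C.lc q 0)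
    rw [hg, map_zero, map_zero]

theorem finite_res [IsNoetherianRing R] (hG : ∀ q, (G q).Finite) (q : ℤ) :
    Module.Finite R ((res C G).X q) := by
  have key : ∀ q, (Finsupp.supported R R (G q)).FG := fun q => by
    have := (hG q).to_subtype
    have : Module.Finite R (Finsupp.supported R R (G q)) :=
      Module.Finite.equiv (Finsupp.supportedEquivFinsupp (G q)).symm
    exact Module.Finite.iff_fg.1 this
  let P := (Finsupp.supported R R (G (q + 1))).prod (Finsupp.supported R R (G q))
  have h : IsNoetherian R P :=
    isNoetherian_of_fg_of_noetherian _ ((key _).prod (key _))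
  have : IsNoetherian R (resSub C G q) := isNoetherian_of_le (t := P) inf_le_left
  exact (inferInstance : Module.Finite R (resSub C G q))

theorem subsingleton_res {q : ℤ} (h₁ : G (q + 1) = ∅) (h₂ : G q = ∅) :
    Subsingleton ((res C G).X q) := by
  have key : ∀ q, G q = ∅ → ∀ f, f ∈ Finsupp.supported R R (G q) → f = 0 := by
    intro q hq f hf
    rw [hq] at hf
    simpa using hf
  exact subsingleton_of_forall_eq 0 fun x => Subtype.ext (Prod.ext
    (key _ h₁ _ (mem_resSub.1 x.2).1) (key _ h₂ _ (mem_resSub.1 x.2).2.1))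

theorem TorVanish.res {p : ℕ} {X : Type u} [AddCommGroup X] [Module R X]
    (hG : ∀ q x, ∃ f ∈ Finsupp.supported R R (G q), C.lc q f = x) (q : ℤ)
    (h : TorVanish (R := R) (C.X (q + 1)) (p + 1) X) :
    TorVanish (R := R) ((res C G).X q) p X := by
  let s := Finsupp.supported R R (G (q + 1))
  let s' := Finsupp.supported R R (G q)
  let π : (s × s') →ₗ[R] C.X (q + 1) := (C.lc (q + 1) ∘ₗ s.subtype) ∘ₗ LinearMap.fst R _ _ -
    (C.d q ∘ₗ C.lc q ∘ₗ s'.subtype) ∘ₗ LinearMap.snd R _ _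
  let j : resSub C G q →ₗ[R] s × s' :=
    { toFun := fun x => (⟨x.1.1, (mem_resSub.1 x.2).1⟩, ⟨x.1.2, (mem_resSub.1 x.2).2.1⟩)
      map_add' := fun _ _ => rfl
      map_smul' := fun _ _ => rfl }
  have : Module.Free R s := Module.Free.of_equiv (Finsupp.supportedEquivFinsupp (G (q + 1))).symm
  have : Module.Free R s' := Module.Free.of_equiv (Finsupp.supportedEquivFinsupp (G q)).symm
  refine TorVanish.of_succ (S₁ := resSub C G q) (G := s × s') (S := C.X (q + 1)) (j := j) (π := π)
    ?_ ?_ ?_ p h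
  · intro x y hxy
    refine Subtype.ext (Prod.ext ?_ ?_)
    · exact congrArg (fun z => z.1.1) hxy
    · exact congrArg (fun z => z.2.1) hxy
  · rintro ⟨⟨f, hf⟩, ⟨g, hg⟩⟩
    have : π (⟨f, hf⟩, ⟨g, hg⟩) = C.lc (q + 1) f - C.d q (C.lc q g) := rfl
    rw [this, sub_eq_zero]
    constructor
    · intro h
      exact ⟨⟨(f, g), mem_resSub.2 ⟨hf, hg, h⟩⟩, rfl⟩
    · rintro ⟨x, hx⟩
      have h1 : x.1.1 = f := congrArg (fun z => z.1.1) hx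
      have h2 : x.1.2 = g := congrArg (fun z => z.2.1) hx
      rw [← h1, ← h2]
      exact (mem_resSub.1 x.2).2.2
  · intro x
    obtain ⟨f, hf, rfl⟩ := hG _ x
    refine ⟨(⟨f, hf⟩, 0), ?_⟩
    simp [π]

end Res

/-! ### Systems of complexes over Noetherian rings -/

section Push

variable {R R' R'' : Type u} [CommRing R] [CommRing R'] [CommRing R''] {M M' M'' : Type u}

/-- The map on formal combinations induced by a ring homomorphism on coefficients and a map on
basis elements. -/
noncomputable def push (φ : R →+* R') (h : M → M') : (M →₀ R) →+ (M' →₀ R') :=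
  (Finsupp.mapDomain.addMonoidHom h).comp (Finsupp.mapRange.addMonoidHom (φ : R →+ R'))

@[simp]
theorem push_single (φ : R →+* R') (h : M → M') (x : M) (r : R) :
    push φ h (Finsupp.single x r) = Finsupp.single (h x) (φ r) := by
  simp [push, Finsupp.mapDomain_single]

theorem push_push {φ : R →+* R'} {φ' : R' →+* R''} {φ'' : R →+* R''} {h : M → M'} {h' : M' → M''}
    {h'' : M → M''} (hφ : ∀ r, φ' (φ r) = φ'' r) (hh : ∀ x, h' (h x) = h'' x) (f : M →₀ R) :
    push φ' h' (push φ h f) = push φ'' h'' f := by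
  induction f using Finsupp.induction_linear with
  | zero => simp
  | add f g hf hg => simp only [map_add, hf, hg]
  | single x r => simp [hφ, hh]

theorem push_id {φ : R →+* R} {h : M → M} (hφ : ∀ r, φ r = r) (hh : ∀ x, h x = x) (f : M →₀ R) :
    push φ h f = f := by
  induction f using Finsupp.induction_linear with
  | zero => simp
  | add f g hf hg => simp only [map_add, hf, hg]
  | single x r => simp [hφ, hh]

theorem push_smul (φ : R →+* R') (h : M → M') (r : R) (f : M →₀ R) :
    push φ h (r • f) = φ r • push φ h f := by
  induction f using Finsupp.induction_linear with
  | zero => simp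
  | add f g hf hg => simp only [smul_add, map_add, hf, hg]
  | single x s =>
    rw [Finsupp.smul_single, push_single, push_single, Finsupp.smul_single, smul_eq_mul, map_mul,
      smul_eq_mul]

theorem push_mem_supported {φ : R →+* R'} {h : M → M'} {s : Set M} {s' : Set M'}
    (hs : ∀ x ∈ s, h x ∈ s') {f : M →₀ R} (hf : f ∈ Finsupp.supported R R s) :
    push φ h f ∈ Finsupp.supported R' R' s' := by
  have : f.sum (fun x r => Finsupp.single x r) = f := Finsupp.sum_single f
  rw [← this, Finsupp.sum, map_sum]
  refine Submodule.sum_mem _ fun x hx => ?_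
  rw [push_single]
  exact Finsupp.single_mem_supported _ _ (hs x (hf hx))

theorem linearCombination_push [AddCommGroup M] [Module R M] [AddCommGroup M'] [Module R' M']
    {φ : R →+* R'} {h : M →+ M'} (hs : ∀ r x, h (r • x) = φ r • h x) (f : M →₀ R) :
    Finsupp.linearCombination R' (id : M' → M') (push φ h f) =
      h (Finsupp.linearCombination R (id : M → M) f) := by
  induction f using Finsupp.induction_linear with
  | zero => simp
  | add f g hf hg => simp only [map_add, hf, hg]
  | single x r => simp [hs]

end Push

section Systems

variable {A : Type u} [CommRing A] {d : ℕ}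

attribute [instance] NoetherianSystem.commRing NoetherianSystem.noetherian

instance (Sy : NoetherianSystem A d) (i : ℕ) : Algebra (Sy.R i) A := (Sy.ι i).toAlgebra

/-- A presentation of the complex `K` over the colimit `A` of the rings `Sy.R i` as a filtered
colimit of bounded complexes of finite modules over the rings `Sy.R i`, which vanish in degrees
below `m`. -/
structure CxSystem (Sy : NoetherianSystem A d) (K : Cx A) (m : ℤ) where
  /-- The index set. -/
  J : Type u
  [preorder : Preorder J]
  [directed : IsDirectedOrder J]
  [nonempty : Nonempty J]
  /-- The index of the base ring. -/
  idx : J → ℕ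
  idx_mono : ∀ {j j'}, j ≤ j' → idx j ≤ idx j'
  cofinal : ∀ j i, ∃ j', j ≤ j' ∧ i ≤ idx j'
  /-- The complexes of the system. -/
  S : ∀ j, Cx (Sy.R (idx j))
  /-- The transition maps. -/
  t : ∀ {j j'} (_ : j ≤ j') (q : ℤ), (S j).X q →+ (S j').X q
  t_smul : ∀ {j j'} (h : j ≤ j') q r x, t h q (r • x) = Sy.ρ (idx_mono h) r • t h q x
  t_d : ∀ {j j'} (h : j ≤ j') q x, t h (q + 1) ((S j).d q x) = (S j').d q (t h q x)
  t_refl : ∀ j q x, t (le_refl j) q x = x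
  t_trans : ∀ {j j' j''} (h : j ≤ j') (h' : j' ≤ j'') q x, t h' q (t h q x) = t (h.trans h') q x
  /-- The maps to the colimit. -/
  g : ∀ j q, (S j).X q →+ K.X q
  g_smul : ∀ j q r x, g j q (r • x) = Sy.ι (idx j) r • g j q x
  g_d : ∀ j q x, g j (q + 1) ((S j).d q x) = K.d q (g j q x)
  g_t : ∀ {j j'} (h : j ≤ j') q x, g j' q (t h q x) = g j q x
  surj : ∀ q y, ∃ j x, g j q x = y
  inj : ∀ j q x, g j q x = 0 → ∃ j', ∃ h : j ≤ j', t h q x = 0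
  fg : ∀ j q, Module.Finite (Sy.R (idx j)) ((S j).X q)
  lower : ∀ j, ∀ q < m, Subsingleton ((S j).X q)
  upper : ∀ j, ∃ b : ℤ, ∀ q, b < q → Subsingleton ((S j).X q)

attribute [instance] CxSystem.preorder CxSystem.directed CxSystem.nonempty

namespace CxSystem

variable {Sy : NoetherianSystem A d} {K : Cx A} {m : ℤ} (T : CxSystem Sy K m)

/-- The transition maps on formal combinations. -/
noncomputable def pt {j j' : T.J} (h : j ≤ j') (q : ℤ) :
    ((T.S j).X q →₀ Sy.R (T.idx j)) →+ ((T.S j').X q →₀ Sy.R (T.idx j')) :=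
  push (Sy.ρ (T.idx_mono h)) (T.t h q)

/-- The maps to the colimit on formal combinations. -/
noncomputable def pg (j : T.J) (q : ℤ) : ((T.S j).X q →₀ Sy.R (T.idx j)) →+ (K.X q →₀ A) :=
  push (Sy.ι (T.idx j)) (T.g j q)

/-- The transition maps on homogeneous elements. -/
def tσ {j j' : T.J} (h : j ≤ j') (x : Σ q, (T.S j).X q) : Σ q, (T.S j').X q := ⟨x.1, T.t h x.1 x.2⟩

theorem pg_pt {j j' : T.J} (h : j ≤ j') (q : ℤ) (f) : T.pg j' q (T.pt h q f) = T.pg j q f :=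
  push_push (Sy.ι_ρ _) (T.g_t h q) f

theorem pt_pt {j j' j'' : T.J} (h : j ≤ j') (h' : j' ≤ j'') (q : ℤ) (f) :
    T.pt h' q (T.pt h q f) = T.pt (h.trans h') q f :=
  push_push (Sy.ρ_trans _ _) (T.t_trans h h' q) f

theorem lc_pt {j j' : T.J} (h : j ≤ j') (q : ℤ) (f) :
    (T.S j').lc q (T.pt h q f) = T.t h q ((T.S j).lc q f) :=
  linearCombination_push (T.t_smul h q) f

theorem lc_pg (j : T.J) (q : ℤ) (f) : K.lc q (T.pg j q f) = T.g j q ((T.S j).lc q f) :=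
  linearCombination_push (T.g_smul j q) f

theorem exists_pg_eq (q : ℤ) (f : K.X q →₀ A) : ∃ j f', T.pg j q f' = f := by
  induction f using Finsupp.induction_linear with
  | zero => exact ⟨Classical.arbitrary _, 0, map_zero _⟩
  | add f g hf hg =>
    obtain ⟨j, f', rfl⟩ := hf
    obtain ⟨j', g', rfl⟩ := hg
    obtain ⟨l, h, h'⟩ := exists_ge_ge j j'
    exact ⟨l, T.pt h q f' + T.pt h' q g', by rw [map_add, pg_pt, pg_pt]⟩
  | single y a =>
    obtain ⟨j, x, rfl⟩ := T.surj q y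
    obtain ⟨i, r, rfl⟩ := Sy.surj a
    obtain ⟨j', h, h'⟩ := T.cofinal j i
    refine ⟨j', Finsupp.single (T.t h q x) (Sy.ρ h' r), ?_⟩
    rw [pg, push_single, T.g_t, Sy.ι_ρ]

theorem exists_ring_eq_zero (j : T.J) (r : Sy.R (T.idx j)) (hr : Sy.ι _ r = 0) :
    ∃ j', ∃ h : j ≤ j', Sy.ρ (T.idx_mono h) r = 0 := by
  obtain ⟨i, hi, h⟩ := Sy.inj _ r hr
  obtain ⟨j', hj, hi'⟩ := T.cofinal j i
  refine ⟨j', hj, ?_⟩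
  rw [← Sy.ρ_trans hi hi', h, map_zero]

/-- Finitely many properties that hold at large indices hold simultaneously at some index. -/
theorem exists_forall_finset {ι : Type*} (P : ι → T.J → Prop)
    (hP : ∀ i j' j'', j' ≤ j'' → P i j' → P i j'') (j : T.J) (s : Finset ι)
    (h : ∀ i ∈ s, ∃ j', j ≤ j' ∧ P i j') : ∃ j', j ≤ j' ∧ ∀ i ∈ s, P i j' := by
  classical
  induction s using Finset.induction_on with
  | empty => exact ⟨j, le_rfl, by simp⟩
  | insert a s _ ih =>
    obtain ⟨j₁, h₁, h₁'⟩ := ih fun i hi => h i (Finset.mem_insert_of_mem hi)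
    obtain ⟨j₂, h₂, h₂'⟩ := h a (Finset.mem_insert_self a s)
    obtain ⟨l, hl₁, hl₂⟩ := exists_ge_ge j₁ j₂
    refine ⟨l, h₁.trans hl₁, fun i hi => ?_⟩
    rcases Finset.mem_insert.1 hi with rfl | hi
    · exact hP _ _ _ hl₂ h₂'
    · exact hP _ _ _ hl₁ (h₁' i hi)

theorem exists_pt_eq_zero (j : T.J) (q : ℤ) (f) (hf : T.pg j q f = 0) :
    ∃ j', ∃ h : j ≤ j', T.pt h q f = 0 := by
  classical
  -- at some stage, elements of the support with the same image in the colimit become equal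
  obtain ⟨j₁, h₁, H₁⟩ := T.exists_forall_finset (ι := (T.S j).X q × (T.S j).X q)
    (fun p j' => ∃ h : j ≤ j', T.t h q p.1 = T.t h q p.2)
    (fun p j' j'' h ⟨h', e⟩ => ⟨h'.trans h, by rw [← T.t_trans h' h, e, T.t_trans]⟩) j
    ((f.support ×ˢ f.support).filter fun p => T.g j q p.1 = T.g j q p.2) (fun p hp => by
      have hp' := (Finset.mem_filter.1 hp).2
      obtain ⟨j', h, e⟩ := T.inj j q (p.1 - p.2) (by rw [map_sub, hp', sub_self])
      exact ⟨j', h, h, by rwa [map_sub, sub_eq_zero] at e⟩)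
  set f₁ := T.pt h₁ q f with hf₁
  have hsupp : ∀ x ∈ f₁.support, ∃ y ∈ f.support, T.t h₁ q y = x := by
    intro x hx
    have h1 : f₁ ∈ Finsupp.supported _ (Sy.R (T.idx j₁)) (T.t h₁ q '' f.support) :=
      push_mem_supported (fun y hy => Set.mem_image_of_mem _ hy)
        (Finsupp.mem_supported_support (Sy.R (T.idx j)) f)
    exact (Finsupp.mem_supported _ _).1 h1 hx
  have hinj : ∀ x ∈ f₁.support, ∀ x' ∈ f₁.support, T.g j₁ q x = T.g j₁ q x' → x = x' := by
    intro x hx x' hx' e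
    obtain ⟨y, hy, rfl⟩ := hsupp x hx
    obtain ⟨y', hy', rfl⟩ := hsupp x' hx'
    rw [T.g_t, T.g_t] at e
    obtain ⟨_, h⟩ := H₁ (y, y') (Finset.mem_filter.2 ⟨Finset.mk_mem_product hy hy', e⟩)
    exact h
  -- the coefficients therefore vanish in the colimit
  have hcoef : ∀ x ∈ f₁.support, Sy.ι _ (f₁ x) = 0 := by
    intro x hx
    have h1 : T.pg j₁ q f₁ = 0 := by rw [hf₁, pg_pt, hf]
    have h2 : f₁.sum (fun x r => Finsupp.single x r) = f₁ := Finsupp.sum_single f₁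
    rw [← h2, Finsupp.sum, map_sum] at h1
    have h3 := DFunLike.congr_fun h1 (T.g j₁ q x)
    rw [Finsupp.finsetSum_apply, Finset.sum_eq_single x] at h3
    · simpa [pg] using h3
    · intro x' hx' hne
      rw [pg, push_single, Finsupp.single_apply, if_neg fun e => hne (hinj _ hx' _ hx e)]
    · exact fun h => absurd hx h
  obtain ⟨j₂, h₂, H₂⟩ := T.exists_forall_finset (ι := (T.S j₁).X q)
    (fun x j' => ∃ h : j₁ ≤ j', Sy.ρ (T.idx_mono h) (f₁ x) = 0)
    (fun p j' j'' h ⟨h', e⟩ => ⟨h'.trans h, by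
      rw [← Sy.ρ_trans (T.idx_mono h') (T.idx_mono h), e, map_zero]⟩) j₁ f₁.support
    (fun x hx => by
      obtain ⟨j', h, e⟩ := T.exists_ring_eq_zero j₁ _ (hcoef x hx)
      exact ⟨j', h, h, e⟩)
  refine ⟨j₂, h₁.trans h₂, ?_⟩
  rw [← T.pt_pt h₁ h₂, ← hf₁]
  have h2 : f₁.sum (fun x r => Finsupp.single x r) = f₁ := Finsupp.sum_single f₁
  rw [← h2, Finsupp.sum, map_sum]
  refine Finset.sum_eq_zero fun x hx => ?_
  obtain ⟨_, h⟩ := H₂ x hx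
  rw [pt, push_single, h, Finsupp.single_zero]

section Res

/-- The indices for the system of the complexes `res`: an index of the original system, together
with finite generating sets. -/
structure ResIndex where
  /-- The index of the original system. -/
  j : T.J
  /-- The generating sets. -/
  G : ∀ q, Finset ((T.S j).X q)
  gen : ∀ q x, ∃ f ∈ Finsupp.supported (Sy.R (T.idx j)) (Sy.R (T.idx j)) (G q : Set ((T.S j).X q)),
    (T.S j).lc q f = x
  lower : ∀ q < m, G q = ∅
  upper : ∃ b : ℤ, ∀ q, b < q → G q = ∅

instance : Preorder T.ResIndex where
  le a a' := ∃ h : a.j ≤ a'.j, ∀ q, ∀ x ∈ a.G q, T.t h q x ∈ a'.G q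
  le_refl a := ⟨le_rfl, fun q x hx => by rwa [T.t_refl]⟩
  le_trans a a' a'' h h' := ⟨h.1.trans h'.1, fun q x hx => by
    rw [← T.t_trans h.1 h'.1]
    exact h'.2 q _ (h.2 q x hx)⟩

variable {T} in
theorem ResIndex.le_j {a a' : T.ResIndex} (h : a ≤ a') : a.j ≤ a'.j := h.1

theorem exists_resIndex (j : T.J) (Y : Finset (Σ q, (T.S j).X q)) :
    ∃ a : T.ResIndex, ∃ h : j = a.j, ∀ q x, m ≤ q → ⟨q, x⟩ ∈ Y → T.t h.le q x ∈ a.G q := by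
  classical
  obtain ⟨b, hb⟩ := T.upper j
  have hfg := fun q => (T.fg j q).fg_top
  choose F hF using hfg
  obtain ⟨c, hc⟩ := (Y.image Sigma.fst).bddAbove
  refine ⟨⟨j, fun q => if m ≤ q ∧ q ≤ max b c then
    F q ∪ Y.preimage (Sigma.mk q) sigma_mk_injective.injOn else ∅, fun q x => ?_, fun q hq => ?_,
    ⟨max b c, fun q hq => ?_⟩⟩, rfl, fun q x hq hx => ?_⟩
  · by_cases h : m ≤ q ∧ q ≤ max b c
    · rw [if_pos h]
      have hx : x ∈ Submodule.span (Sy.R (T.idx j)) (F q : Set ((T.S j).X q)) := by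
        rw [hF]; trivial
      rw [← Set.image_id (F q : Set ((T.S j).X q)),
          Finsupp.mem_span_image_iff_linearCombination] at hx
      obtain ⟨f, hf, e⟩ := hx
      exact ⟨f, Finsupp.supported_mono (by simp) hf, e⟩
    · have : Subsingleton ((T.S j).X q) := by
        by_cases h' : m ≤ q
        · exact hb q ((le_max_left b c).trans_lt (not_le.1 fun h'' => h ⟨h', h''⟩))
        · exact T.lower j q (not_le.1 h')
      exact ⟨0, zero_mem _, Subsingleton.elim _ _⟩
  · rw [if_neg fun h => absurd h.1 (not_le.2 hq)]
  · rw [if_neg fun h => absurd h.2 (not_le.2 hq)]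
  · have hqc : q ≤ c := hc (Finset.mem_coe.2 (Finset.mem_image.2 ⟨_, hx, rfl⟩))
    rw [T.t_refl]
    dsimp only
    rw [if_pos (And.intro hq (hqc.trans (le_max_right _ _)))]
    exact Finset.mem_union_right _ (Finset.mem_preimage.2 hx)

theorem exists_resIndex_ge (a : T.ResIndex) {j : T.J} (h : a.j ≤ j)
    (Y : Finset (Σ q, (T.S j).X q)) :
    ∃ a' : T.ResIndex, a ≤ a' ∧ ∃ h : j = a'.j,
      ∀ q x, m ≤ q → ⟨q, x⟩ ∈ Y → T.t h.le q x ∈ a'.G q := by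
  classical
  obtain ⟨b, hb⟩ := a.upper
  obtain ⟨a', h', ha'⟩ := T.exists_resIndex j
    (Y ∪ ((Finset.Icc m b).sigma a.G).image (T.tσ h))
  refine ⟨a', ⟨h.trans h'.le, fun q x hx => ?_⟩, h', fun q x hq hx =>
    ha' q x hq (Finset.mem_union_left _ hx)⟩
  have hmq : m ≤ q := by
    by_contra hq
    rw [a.lower q (not_le.1 hq)] at hx
    exact Finset.notMem_empty _ hx
  have hqb : q ≤ b := by
    by_contra hq
    rw [hb q (not_le.1 hq)] at hx
    exact Finset.notMem_empty _ hx
  rw [← T.t_trans h h'.le]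
  refine ha' q _ hmq (Finset.mem_union_right _ (Finset.mem_image.2 ⟨⟨q, x⟩, ?_, rfl⟩))
  exact Finset.mem_sigma.2 ⟨Finset.mem_Icc.2 ⟨hmq, hqb⟩, hx⟩

theorem le_of_pt_mem {a a' : T.ResIndex} (h : a ≤ a') (q : ℤ) {f}
    (hf : f ∈ Finsupp.supported (Sy.R (T.idx a.j)) (Sy.R (T.idx a.j)) (a.G q : Set _)) :
    T.pt (ResIndex.le_j h) q f ∈ Finsupp.supported (Sy.R (T.idx a'.j)) (Sy.R (T.idx a'.j))
      (a'.G q : Set _) :=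
  push_mem_supported (fun x hx => h.2 q x hx) hf

theorem exists_pg_eq_of_mem_resSub (q : ℤ) (f : K.X (q + 1) →₀ A) (g : K.X q →₀ A)
    (hy : (f, g) ∈ resSub K (fun q => {_x | m ≤ q}) q) :
    ∃ a : T.ResIndex, ∃ x ∈ resSub (T.S a.j) (fun q => (a.G q : Set ((T.S a.j).X q))) q,
      T.pg a.j (q + 1) x.1 = f ∧ T.pg a.j q x.2 = g := by
  classical
  obtain ⟨hf, hg, hfg⟩ := mem_resSub.1 hy
  have key : ∀ q (f : K.X q →₀ A), f ∈ Finsupp.supported A A {_x : K.X q | m ≤ q} →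
      ∃ j f', T.pg j q f' = f ∧ (q < m → f' = 0) := by
    intro q f hf
    by_cases hq : m ≤ q
    · obtain ⟨j, f', e⟩ := T.exists_pg_eq q f
      exact ⟨j, f', e, fun h => absurd hq (not_le.2 h)⟩
    · refine ⟨Classical.arbitrary _, 0, ?_, fun _ => rfl⟩
      rw [map_zero, eq_comm]
      ext x
      by_contra hx
      exact hq ((Finsupp.mem_supported _ _).1 hf (Finsupp.mem_support_iff.2 hx))
  obtain ⟨j₁, f, rfl, hf0⟩ := key _ _ hf
  obtain ⟨j₂, g, rfl, hg0⟩ := key _ _ hg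
  obtain ⟨j₃, h₁, h₂⟩ := exists_ge_ge j₁ j₂
  have hz : T.g j₃ (q + 1) ((T.S j₃).lc (q + 1) (T.pt h₁ (q + 1) f) -
      (T.S j₃).d q ((T.S j₃).lc q (T.pt h₂ q g))) = 0 := by
    dsimp only at hfg
    rw [map_sub, T.g_d, ← lc_pg, ← lc_pg, pg_pt, pg_pt, hfg, sub_self]
  obtain ⟨j₄, h₄, e⟩ := T.inj _ _ _ hz
  rw [map_sub, T.t_d, ← lc_pt, ← lc_pt, pt_pt, pt_pt, sub_eq_zero] at e
  obtain ⟨a, rfl, H⟩ := T.exists_resIndex j₄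
    ((T.pt (h₁.trans h₄) (q + 1) f).support.map (Function.Embedding.sigmaMk (q + 1)) ∪
      (T.pt (h₂.trans h₄) q g).support.map (Function.Embedding.sigmaMk q))
  simp only [T.t_refl] at H
  refine ⟨a, (T.pt (h₁.trans h₄) (q + 1) f, T.pt (h₂.trans h₄) q g), mem_resSub.2 ⟨?_, ?_, e⟩,
    T.pg_pt _ _ _, T.pg_pt _ _ _⟩
  · by_cases hq : q + 1 < m
    · dsimp only
      rw [hf0 hq, map_zero]
      exact zero_mem _
    · rw [Finsupp.mem_supported]
      exact fun x hx => H _ x (not_lt.1 hq) (Finset.mem_union_left _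
        (Finset.mem_map_of_mem (Function.Embedding.sigmaMk (q + 1)) hx))
  · by_cases hq : q < m
    · dsimp only
      rw [hg0 hq, map_zero]
      exact zero_mem _
    · rw [Finsupp.mem_supported]
      exact fun x hx => H _ x (not_lt.1 hq) (Finset.mem_union_right _
        (Finset.mem_map_of_mem (Function.Embedding.sigmaMk q) hx))

/-- The member of the system `T.res` with index `a`. -/
noncomputable abbrev resS (a : T.ResIndex) : Cx (Sy.R (T.idx a.j)) :=
  SemiCoh.res (T.S a.j) fun q => (a.G q : Set ((T.S a.j).X q))

/-- The complex presented by the system `T.res`. -/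
noncomputable abbrev _root_.SemiCoh.resGE (K : Cx A) (m : ℤ) : Cx A :=
  SemiCoh.res K fun q => {_x | m ≤ q}

theorem resS_ext {a : T.ResIndex} {q : ℤ} {x y : (T.resS a).X q} (h₁ : x.1.1 = y.1.1)
    (h₂ : x.1.2 = y.1.2) : x = y :=
  Subtype.ext (Prod.ext h₁ h₂)

/-- The transition maps of the system `T.res`. -/
noncomputable def resT {a a' : T.ResIndex} (h : a ≤ a') (q : ℤ) :
    (T.resS a).X q →+ (T.resS a').X q where
  toFun x := ⟨(T.pt (ResIndex.le_j h) (q + 1) x.1.1, T.pt (ResIndex.le_j h) q x.1.2), by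
    obtain ⟨h1, h2, h3⟩ := mem_resSub.1 x.2
    exact mem_resSub.2 ⟨T.le_of_pt_mem h _ h1, T.le_of_pt_mem h _ h2, by
      rw [lc_pt, lc_pt, h3, T.t_d]⟩⟩
  map_zero' := T.resS_ext (map_zero _) (map_zero _)
  map_add' _ _ := T.resS_ext (map_add _ _ _) (map_add _ _ _)

theorem pg_mem_supported (a : T.ResIndex) {q : ℤ} {f}
    (hf : f ∈ Finsupp.supported (Sy.R (T.idx a.j)) (Sy.R (T.idx a.j)) (a.G q : Set _)) :
    T.pg a.j q f ∈ Finsupp.supported A A {_x : K.X q | m ≤ q} := by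
  refine push_mem_supported (fun x hx => ?_) hf
  by_contra hq
  have hx' : x ∈ a.G q := hx
  rw [a.lower q (not_le.1 hq)] at hx'
  exact Finset.notMem_empty _ hx'

/-- The maps to the colimit of the system `T.res`. -/
noncomputable def resG (a : T.ResIndex) (q : ℤ) : (T.resS a).X q →+ (resGE K m).X q where
  toFun x := ⟨(T.pg a.j (q + 1) x.1.1, T.pg a.j q x.1.2), by
    obtain ⟨h1, h2, h3⟩ := mem_resSub.1 x.2
    exact mem_resSub.2 ⟨T.pg_mem_supported a h1, T.pg_mem_supported a h2, by
      rw [lc_pg, lc_pg, h3, T.g_d]⟩⟩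
  map_zero' := Subtype.ext (Prod.ext (map_zero _) (map_zero _))
  map_add' _ _ := Subtype.ext (Prod.ext (map_add _ _ _) (map_add _ _ _))

theorem exists_resG_eq (q : ℤ) (y : (resGE K m).X q) : ∃ a x, T.resG a q x = y := by
  obtain ⟨a, x, hx, e₁, e₂⟩ := T.exists_pg_eq_of_mem_resSub q y.1.1 y.1.2 y.2
  exact ⟨a, ⟨x, hx⟩, Subtype.ext (Prod.ext e₁ e₂)⟩

theorem exists_resT_eq_zero (a : T.ResIndex) (q : ℤ) (x : (T.resS a).X q) (hx : T.resG a q x = 0) :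
    ∃ a', ∃ h : a ≤ a', T.resT h q x = 0 := by
  have hx₁ : T.pg a.j (q + 1) x.1.1 = 0 :=
    congrArg (fun z : (resGE K m).X q => z.1.1) hx
  have hx₂ : T.pg a.j q x.1.2 = 0 := congrArg (fun z : (resGE K m).X q => z.1.2) hx
  obtain ⟨j₁, h₁, e₁⟩ := T.exists_pt_eq_zero a.j (q + 1) x.1.1 hx₁
  obtain ⟨j₂, h₂, e₂⟩ := T.exists_pt_eq_zero a.j q x.1.2 hx₂
  obtain ⟨j₃, h₁', h₂'⟩ := exists_ge_ge j₁ j₂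
  obtain ⟨a', h, rfl, -⟩ := T.exists_resIndex_ge a (h₁.trans h₁') ∅
  refine ⟨a', h, T.resS_ext ?_ ?_⟩
  · change T.pt (h₁.trans h₁') (q + 1) x.1.1 = 0
    rw [← T.pt_pt h₁ h₁', e₁, map_zero]
  · change T.pt (h₂.trans h₂') q x.1.2 = 0
    rw [← T.pt_pt h₂ h₂', e₂, map_zero]

theorem subsingleton_resS (a : T.ResIndex) {q : ℤ} (h₁ : a.G (q + 1) = ∅) (h₂ : a.G q = ∅) :
    Subsingleton ((T.resS a).X q) :=
  subsingleton_res (G := fun q => (a.G q : Set ((T.S a.j).X q)))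
    (by rw [h₁, Finset.coe_empty]) (by rw [h₂, Finset.coe_empty])

theorem directed_resIndex : IsDirectedOrder T.ResIndex := ⟨fun a a' => by
  obtain ⟨l, h, h'⟩ := exists_ge_ge a.j a'.j
  classical
  obtain ⟨b, hb⟩ := a.upper
  obtain ⟨c, hc, e, H⟩ := T.exists_resIndex_ge a' h'
    (((Finset.Icc m b).sigma a.G).image (T.tσ h))
  refine ⟨c, ⟨h.trans e.le, fun q x hx => ?_⟩, hc⟩
  have hmq : m ≤ q := by
    by_contra hq
    rw [a.lower q (not_le.1 hq)] at hx
    exact Finset.notMem_empty _ hx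
  have hqb : q ≤ b := by
    by_contra hq
    rw [hb q (not_le.1 hq)] at hx
    exact Finset.notMem_empty _ hx
  rw [← T.t_trans h e.le]
  refine H q _ hmq (Finset.mem_image.2 ⟨⟨q, x⟩, ?_, rfl⟩)
  exact Finset.mem_sigma.2 ⟨Finset.mem_Icc.2 ⟨hmq, hqb⟩, hx⟩⟩

/-- The complexes `res` of the members of a system form a system for the complex `res` of
its colimit. -/
noncomputable def res : CxSystem Sy (resGE K m) (m - 1) where
  J := T.ResIndex
  directed := T.directed_resIndex
  nonempty := by
    obtain ⟨a, _⟩ := T.exists_resIndex (Classical.arbitrary _) ∅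
    exact ⟨a⟩
  idx a := T.idx a.j
  idx_mono h := T.idx_mono (ResIndex.le_j h)
  cofinal a i := by
    obtain ⟨j, h, hi⟩ := T.cofinal a.j i
    obtain ⟨a', ha', rfl, _⟩ := T.exists_resIndex_ge a h ∅
    exact ⟨a', ha', hi⟩
  S := T.resS
  t := T.resT
  t_smul _ _ _ _ := T.resS_ext (push_smul _ _ _ _) (push_smul _ _ _ _)
  t_d _ _ _ := T.resS_ext (map_zero _) rfl
  t_refl _ _ _ := T.resS_ext (push_id (Sy.ρ_refl _) (T.t_refl _ _) _)
    (push_id (Sy.ρ_refl _) (T.t_refl _ _) _)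
  t_trans _ _ _ _ := T.resS_ext (T.pt_pt _ _ _ _) (T.pt_pt _ _ _ _)
  g := T.resG
  g_smul _ _ _ _ := Subtype.ext (Prod.ext (push_smul _ _ _ _) (push_smul _ _ _ _))
  g_d _ _ _ := Subtype.ext (Prod.ext (map_zero _) rfl)
  g_t _ _ _ := Subtype.ext (Prod.ext (T.pg_pt _ _ _) (T.pg_pt _ _ _))
  surj := T.exists_resG_eq
  inj := T.exists_resT_eq_zero
  fg a q := finite_res (G := fun q => (a.G q : Set ((T.S a.j).X q)))
    (fun q => (a.G q).finite_toSet) q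
  lower a q hq := T.subsingleton_resS a (a.lower _ (by omega)) (a.lower _ (by omega))
  upper a := by
    obtain ⟨b, hb⟩ := a.upper
    exact ⟨b, fun q hq => T.subsingleton_resS a (hb _ (by omega)) (hb _ hq)⟩

end Res

/-- `Tor_p(A, S)` vanishes for `p > e` and for all modules `S` of the system. -/
def TorLE (e : ℕ) : Prop :=
  ∀ j q p, e ≤ p → TorVanish (R := Sy.R (T.idx j)) ((T.S j).X q) p A

theorem TorLE.res {T : CxSystem Sy K m} {e : ℕ} (h : T.TorLE (e + 1)) : T.res.TorLE e :=
  fun a q p hp => TorVanish.res (G := fun q => (a.G q : Set ((T.S a.j).X q)))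
    a.gen q (h a.j (q + 1) (p + 1) (by omega))

theorem torLE : T.TorLE d := fun j _ _ hp => FlatDimLE.torVanish _ hp (Sy.flatDim (T.idx j))

end CxSystem

end Systems

/-! ### Bounded below complexes as colimits of systems -/

section InitialSystem

variable {A : Type u} [CommRing A] {d : ℕ}

section Initial

variable (Sy : NoetherianSystem A d) (K : Cx A)

instance (i : ℕ) (q : ℤ) : Module (Sy.R i) (K.X q) := Module.compHom (K.X q) (Sy.ι i)

/-- The finite sets of homogeneous elements that are closed under the nonzero values of the
differential. -/
abbrev ClosedFinset : Type u :=
  {Y : Finset (Σ q, K.X q) // ∀ y ∈ Y, K.d y.1 y.2 = 0 ∨ ⟨y.1 + 1, K.d y.1 y.2⟩ ∈ Y}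

variable {K} in
theorem exists_closedFinset (Y : Finset (Σ q, K.X q)) : ∃ Y' : ClosedFinset K, Y ⊆ Y'.1 := by
  classical
  refine ⟨⟨Y ∪ Y.image fun y => ⟨y.1 + 1, K.d y.1 y.2⟩, fun y hy => ?_⟩, Finset.subset_union_left⟩
  rcases Finset.mem_union.1 hy with h | h
  · exact Or.inr (Finset.mem_union_right _ (Finset.mem_image_of_mem _ h))
  · obtain ⟨x, _, rfl⟩ := Finset.mem_image.1 h
    exact Or.inl (K.dd _ _)

/-- The span over `Sy.R i` of the elements of degree `q` of a set of homogeneous elements. -/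
def initSpan (i : ℕ) (Y : Finset (Σ q, K.X q)) (q : ℤ) : Submodule (Sy.R i) (K.X q) :=
  Submodule.span (Sy.R i) {x | ⟨q, x⟩ ∈ Y}

variable {Sy K}

theorem initSpan_mono {i j : ℕ} (h : i ≤ j) {Y Y' : Finset (Σ q, K.X q)} (hY : Y ⊆ Y') {q : ℤ}
    {x : K.X q} (hx : x ∈ initSpan Sy K i Y q) : x ∈ initSpan Sy K j Y' q := by
  induction hx using Submodule.span_induction with
  | mem x hx => exact Submodule.subset_span (hY hx)
  | zero => exact zero_mem _
  | add x y _ _ hx hy => exact add_mem hx hy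
  | smul r x _ hx =>
    have : r • x = Sy.ρ h r • x := by
      change Sy.ι i r • x = Sy.ι j (Sy.ρ h r) • x
      rw [Sy.ι_ρ]
    rw [this]
    exact Submodule.smul_mem _ _ hx

theorem d_mem_initSpan {i : ℕ} (Y : ClosedFinset K) {q : ℤ} {x : K.X q}
    (hx : x ∈ initSpan Sy K i Y.1 q) : K.d q x ∈ initSpan Sy K i Y.1 (q + 1) := by
  induction hx using Submodule.span_induction with
  | mem x hx =>
    rcases Y.2 _ hx with h | h
    · dsimp only at h
      rw [h]
      exact zero_mem _
    · exact Submodule.subset_span h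
  | zero => rw [map_zero]; exact zero_mem _
  | add x y _ _ hx hy => rw [map_add]; exact add_mem hx hy
  | smul r x _ hx =>
    have : K.d q (r • x) = r • K.d q x := map_smul (K.d q) (Sy.ι i r) x
    rw [this]
    exact Submodule.smul_mem _ _ hx

theorem le_initIndex {a a' : ℕ × ClosedFinset K} :
    a ≤ a' ↔ a.1 ≤ a'.1 ∧ a.2.1 ⊆ a'.2.1 := Iff.rfl

variable (Sy K) in
/-- A bounded below complex is the filtered union of its bounded subcomplexes of finite modules
over the rings `Sy.R i`. -/
noncomputable def CxSystem.initial {m : ℤ} (hK : ∀ q < m, Subsingleton (K.X q)) :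
    CxSystem Sy K m where
  J := ℕ × ClosedFinset K
  directed := ⟨fun a a' => by
    classical
    obtain ⟨Y, hY⟩ := exists_closedFinset (a.2.1 ∪ a'.2.1)
    exact ⟨(max a.1 a'.1, Y), ⟨le_max_left _ _, Finset.subset_union_left.trans hY⟩,
      ⟨le_max_right _ _, Finset.subset_union_right.trans hY⟩⟩⟩
  nonempty := ⟨(0, ⟨∅, by simp⟩)⟩
  idx a := a.1
  idx_mono h := (le_initIndex.1 h).1
  cofinal a i := ⟨(max a.1 i, a.2), le_initIndex.2 ⟨le_max_left _ _, subset_rfl⟩, le_max_right _ _⟩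
  S a :=
    { X := fun q => initSpan Sy K a.1 a.2.1 q
      d := fun q =>
        { toFun := fun x => ⟨K.d q x.1, d_mem_initSpan a.2 x.2⟩
          map_add' := fun x y => Subtype.ext (map_add (K.d q) _ _)
          map_smul' := fun r x => Subtype.ext (map_smul (K.d q) (Sy.ι a.1 r) x.1) }
      dd := fun q x => Subtype.ext (K.dd q x.1) }
  t {a a'} h q :=
    { toFun := fun x => ⟨x.1, initSpan_mono (le_initIndex.1 h).1 (le_initIndex.1 h).2 x.2⟩
      map_zero' := rfl
      map_add' := fun _ _ => rfl }
  t_smul {a a'} h q r x := Subtype.ext (by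
    change Sy.ι a.1 r • x.1 = Sy.ι a'.1 (Sy.ρ _ r) • x.1
    rw [Sy.ι_ρ])
  t_d _ _ _ := rfl
  t_refl _ _ _ := rfl
  t_trans _ _ _ _ := rfl
  g a q := (initSpan Sy K a.1 a.2.1 q).subtype.toAddMonoidHom
  g_smul _ _ _ _ := rfl
  g_d _ _ _ := rfl
  g_t _ _ _ := rfl
  surj q y := by
    obtain ⟨Y, hY⟩ := exists_closedFinset ({⟨q, y⟩} : Finset (Σ q, K.X q))
    exact ⟨(0, Y), ⟨y, Submodule.subset_span (hY (Finset.mem_singleton_self _))⟩, rfl⟩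
  inj a q x hx := ⟨a, le_rfl, Subtype.ext hx⟩
  fg a q := by
    refine Module.Finite.iff_fg.2 (Submodule.fg_span ?_)
    exact (a.2.1.finite_toSet.preimage (sigma_mk_injective (i := q)).injOn)
  lower a q hq := by
    have := hK q hq
    exact inferInstanceAs (Subsingleton (initSpan Sy K a.1 a.2.1 q))
  upper a := by
    classical
    obtain ⟨b, hb⟩ := (a.2.1.image Sigma.fst).bddAbove
    refine ⟨b, fun q hq => ?_⟩
    have h : initSpan Sy K a.1 a.2.1 q = ⊥ := by
      rw [initSpan, Submodule.span_eq_bot]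
      intro x hx
      have : q ≤ b := hb (Finset.mem_coe.2 (Finset.mem_image.2 ⟨_, hx, rfl⟩))
      omega
    change Subsingleton (initSpan Sy K a.1 a.2.1 q)
    rw [h]
    infer_instance

end Initial

/-- Each bounded below complex of `A`-modules is isomorphic in the derived category to the colimit
of a system with Tor-acyclic terms. -/
theorem exists_cxSystem [HasDerivedCategory.{w} (ModuleCat.{u} A)] (Sy : NoetherianSystem A d)
    (M : DerivedCategory (ModuleCat.{u} A)) (n : ℤ) [M.IsGE n] :
    ∃ (m : ℤ) (K : Cx A) (T : CxSystem Sy K m), T.TorLE 0 ∧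
      Nonempty (DerivedCategory.Q.obj K.toCC ≅ M) := by
  have key : ∀ e : ℕ, e ≤ d → ∃ (m : ℤ) (K : Cx A) (T : CxSystem Sy K m), T.TorLE (d - e) ∧
      (∀ q < m, Subsingleton (K.X q)) ∧
      Nonempty (DerivedCategory.Q.obj K.toCC ≅ M) := by
    intro e
    induction e with
    | zero =>
      intro _
      obtain ⟨K, _, ⟨e⟩⟩ := M.exists_iso_Q_obj_of_isGE n
      have hK : ∀ q < n, Subsingleton ((Cx.ofCC K).X q) := fun q hq =>
        ModuleCat.subsingleton_of_isZero (K.isZero_of_isStrictlyGE n q)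
      let T := CxSystem.initial Sy (Cx.ofCC K) hK
      exact ⟨n, Cx.ofCC K, T, T.torLE, hK,
        ⟨DerivedCategory.Q.mapIso (Cx.toCCOfCC K) ≪≫ e.symm⟩⟩
    | succ e ih =>
      intro he
      obtain ⟨m, K, T, hT, hK, ⟨i⟩⟩ := ih (by omega)
      refine ⟨m - 1, resGE K m, T.res, CxSystem.TorLE.res ?_, ?_, ?_⟩
      · rwa [show d - (e + 1) + 1 = d - e by omega]
      · intro q hq
        exact subsingleton_res (Set.eq_empty_of_forall_notMem fun _ h => by
            have : m ≤ q + 1 := h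
            omega)
          (Set.eq_empty_of_forall_notMem fun _ h => by
            have : m ≤ q := h
            omega)
      · have : IsIso (DerivedCategory.Q.map (resπ K fun q => {_x | m ≤ q}).toCC) :=
          isIso_Q_map_resπ fun q x => by
            by_cases hq : m ≤ q
            · exact ⟨Finsupp.single x 1, Finsupp.single_mem_supported _ _ hq, by simp⟩
            · have := hK q (not_le.1 hq)
              exact ⟨0, zero_mem _, Subsingleton.elim _ _⟩
        exact ⟨asIso (DerivedCategory.Q.map (resπ K fun q => {_x | m ≤ q}).toCC) ≪≫ i⟩
  obtain ⟨m, K, T, hT, -, h⟩ := key d le_rfl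
  exact ⟨m, K, T, by rwa [Nat.sub_self] at hT, h⟩

end InitialSystem

/-! ### Base change to the colimit -/

section BaseChange

open TensorProduct

variable {R A : Type u} [CommRing R] [CommRing A] [Algebra R A]

/-- The `A`-linear map on `A ⊗ M` induced by a map to an `A`-module that is linear over `R`. -/
noncomputable def baseChangeLift {M P : Type u} [AddCommGroup M] [Module R M] [AddCommGroup P]
    [Module A P] (h : M →+ P) (hs : ∀ (r : R) x, h (r • x) = algebraMap R A r • h x) :
    A ⊗[R] M →ₗ[A] P :=
  letI := Module.compHom P (algebraMap R A)
  haveI : IsScalarTower R A P := .of_algebraMap_smul fun _ _ => rfl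
  LinearMap.liftBaseChange A { h with map_smul' := hs }

@[simp]
theorem baseChangeLift_tmul {M P : Type u} [AddCommGroup M] [Module R M] [AddCommGroup P]
    [Module A P] (h : M →+ P) (hs : ∀ (r : R) x, h (r • x) = algebraMap R A r • h x) (a : A)
    (x : M) : baseChangeLift h hs (a ⊗ₜ x) = a • h x := by
  let := Module.compHom P (algebraMap R A)
  have : IsScalarTower R A P := .of_algebraMap_smul fun _ _ => rfl
  exact LinearMap.liftBaseChange_tmul _ _ _ _

theorem linearMap_ext_tmul {M P : Type u} [AddCommGroup M] [Module R M] [AddCommGroup P]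
    [Module A P] {f g : A ⊗[R] M →ₗ[A] P} (h : ∀ x, f (1 ⊗ₜ x) = g (1 ⊗ₜ x)) (z : A ⊗[R] M) :
    f z = g z := by
  induction z with
  | zero => rw [map_zero, map_zero]
  | add a b ha hb => rw [map_add, map_add, ha, hb]
  | tmul a x =>
    have : (a ⊗ₜ x : A ⊗[R] M) = a • (1 ⊗ₜ x) := by rw [smul_tmul', smul_eq_mul, mul_one]
    rw [this, map_smul, map_smul, h]

variable (A) in
/-- The base change of a complex. -/
noncomputable def Cx.baseChange (S : Cx R) : Cx A where
  X q := A ⊗[R] S.X q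
  d q := (S.d q).baseChange A
  dd q x := by
    rw [← LinearMap.comp_apply, ← LinearMap.baseChange_comp]
    have : S.d (q + 1) ∘ₗ S.d q = 0 := LinearMap.ext (S.dd q)
    rw [this, LinearMap.baseChange_zero, LinearMap.zero_apply]

end BaseChange

section SystemBaseChange

namespace CxSystem

open TensorProduct

variable {A : Type u} [CommRing A] {d : ℕ} {Sy : NoetherianSystem A d} {K : Cx A} {m : ℤ}
  (T : CxSystem Sy K m)

/-- The term in degree `q` of the base change of the complex with index `j`. -/
abbrev btX (j : T.J) (q : ℤ) : Type u := A ⊗[Sy.R (T.idx j)] (T.S j).X q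

/-- The differential after base change. -/
noncomputable abbrev btd (j : T.J) (q : ℤ) : T.btX j q →ₗ[A] T.btX j (q + 1) :=
  ((T.S j).d q).baseChange A

theorem one_tmul_t_smul {j j' : T.J} (h : j ≤ j') (q : ℤ) (r : Sy.R (T.idx j)) (x : (T.S j).X q) :
    ((1 : A) ⊗ₜ T.t h q (r • x) : T.btX j' q) = Sy.ι (T.idx j) r • ((1 : A) ⊗ₜ T.t h q x) := by
  rw [T.t_smul, ← smul_tmul, ← Sy.ι_ρ (T.idx_mono h), smul_tmul', Algebra.smul_def]
  rfl

/-- The transition maps after base change, degreewise. -/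
noncomputable def btf {j j' : T.J} (h : j ≤ j') (q : ℤ) : T.btX j q →ₗ[A] T.btX j' q :=
  baseChangeLift (R := Sy.R (T.idx j)) (A := A)
    (((TensorProduct.mk (Sy.R (T.idx j')) A ((T.S j').X q)) 1).toAddMonoidHom.comp (T.t h q))
    (T.one_tmul_t_smul h q)

@[simp]
theorem btf_tmul {j j' : T.J} (h : j ≤ j') (q : ℤ) (a : A) (x : (T.S j).X q) :
    T.btf h q (a ⊗ₜ x) = a ⊗ₜ T.t h q x := by
  refine (baseChangeLift_tmul _ _ _ _).trans ?_
  change a • ((1 : A) ⊗ₜ T.t h q x : T.btX j' q) = a ⊗ₜ T.t h q x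
  rw [smul_tmul', smul_eq_mul, mul_one]

/-- The maps to the colimit after base change, degreewise. -/
noncomputable def bgf (j : T.J) (q : ℤ) : T.btX j q →ₗ[A] K.X q :=
  baseChangeLift (R := Sy.R (T.idx j)) (A := A) (T.g j q) (T.g_smul j q)

@[simp]
theorem bgf_tmul (j : T.J) (q : ℤ) (a : A) (x : (T.S j).X q) :
    T.bgf j q (a ⊗ₜ x) = a • T.g j q x :=
  baseChangeLift_tmul _ _ _ _

theorem btf_d {j j' : T.J} (h : j ≤ j') (q : ℤ) (z : T.btX j q) :
    T.btf h (q + 1) (T.btd j q z) = T.btd j' q (T.btf h q z) :=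
  linearMap_ext_tmul (f := T.btf h (q + 1) ∘ₗ T.btd j q) (g := T.btd j' q ∘ₗ T.btf h q)
    (fun x => by simp [T.t_d]) z

theorem bgf_d (j : T.J) (q : ℤ) (z : T.btX j q) :
    T.bgf j (q + 1) (T.btd j q z) = K.d q (T.bgf j q z) :=
  linearMap_ext_tmul (f := T.bgf j (q + 1) ∘ₗ T.btd j q) (g := K.d q ∘ₗ T.bgf j q)
    (fun x => by simp [T.g_d]) z

theorem btf_refl (j : T.J) (q : ℤ) (z : T.btX j q) : T.btf (le_refl j) q z = z :=
  linearMap_ext_tmul (f := T.btf (le_refl j) q) (g := LinearMap.id)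
    (fun x => by simp [T.t_refl]) z

theorem btf_btf {j j' j'' : T.J} (h : j ≤ j') (h' : j' ≤ j'') (q : ℤ) (z : T.btX j q) :
    T.btf h' q (T.btf h q z) = T.btf (h.trans h') q z :=
  linearMap_ext_tmul (f := T.btf h' q ∘ₗ T.btf h q) (g := T.btf (h.trans h') q)
    (fun x => by simp [T.t_trans]) z

theorem bgf_btf {j j' : T.J} (h : j ≤ j') (q : ℤ) (z : T.btX j q) :
    T.bgf j' q (T.btf h q z) = T.bgf j q z :=
  linearMap_ext_tmul (f := T.bgf j' q ∘ₗ T.btf h q) (g := T.bgf j q)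
    (fun x => by simp [T.g_t]) z

theorem exists_btf_eq_tmul (j : T.J) (q : ℤ) (z : T.btX j q) :
    ∃ j', ∃ h : j ≤ j', ∃ x, T.btf h q z = 1 ⊗ₜ x := by
  induction z using TensorProduct.induction_on with
  | zero => exact ⟨j, le_rfl, 0, by rw [map_zero, tmul_zero]⟩
  | tmul a x =>
    obtain ⟨i, r, rfl⟩ := Sy.surj a
    obtain ⟨j', h, hi⟩ := T.cofinal j i
    refine ⟨j', h, Sy.ρ hi r • T.t h q x, ?_⟩
    rw [btf_tmul, ← smul_tmul, Algebra.smul_def, mul_one, ← Sy.ι_ρ hi]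
    rfl
  | add y z hy hz =>
    obtain ⟨j₁, h₁, x₁, e₁⟩ := hy
    obtain ⟨j₂, h₂, x₂, e₂⟩ := hz
    obtain ⟨l, h₁', h₂'⟩ := exists_ge_ge j₁ j₂
    refine ⟨l, h₁.trans h₁', T.t h₁' q x₁ + T.t h₂' q x₂, ?_⟩
    rw [map_add, ← T.btf_btf h₁ h₁' q y, ← T.btf_btf h₂ h₂' q z, e₁, e₂, btf_tmul, btf_tmul,
      tmul_add]

theorem exists_btf_eq_zero (j : T.J) (q : ℤ) (z : T.btX j q) (hz : T.bgf j q z = 0) :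
    ∃ j', ∃ h : j ≤ j', T.btf h q z = 0 := by
  obtain ⟨j₁, h₁, x, e⟩ := T.exists_btf_eq_tmul j q z
  have h0 : T.g j₁ q x = 0 := by
    rw [← T.bgf_btf h₁, e, bgf_tmul, one_smul] at hz
    exact hz
  obtain ⟨j₂, h₂, e₂⟩ := T.inj j₁ q x h0
  exact ⟨j₂, h₁.trans h₂, by rw [← T.btf_btf h₁ h₂, e, btf_tmul, e₂, tmul_zero]⟩

/-- The diagram of base changed complexes. -/
noncomputable def diagram : T.J ⥤ CochainComplex (ModuleCat.{u} A) ℤ where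
  obj j := ((T.S j).baseChange A).toCC
  map f := Cx.Hom.toCC ⟨T.btf (leOfHom f), T.btf_d (leOfHom f)⟩
  map_id j := by
    ext q z
    exact T.btf_refl j q z
  map_comp f g := by
    ext q z
    exact (T.btf_btf (leOfHom f) (leOfHom g) q z).symm

/-- The cocone over the diagram of base changed complexes. -/
noncomputable def cocone : Cocone T.diagram where
  pt := K.toCC
  ι :=
    { app := fun j => Cx.Hom.toCC (C := (T.S j).baseChange A) ⟨T.bgf j, T.bgf_d j⟩
      naturality := fun j j' f => by
        ext q z
        exact T.bgf_btf (leOfHom f) q z }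

/-- The complex `K` is the colimit of the base changes of the complexes of the system. -/
noncomputable def isColimitCocone : IsColimit T.cocone :=
  HomologicalComplex.isColimitOfEval _ _ fun q => by
    refine isColimitOfReflects (forget (ModuleCat.{u} A)) ?_
    refine Types.FilteredColimit.isColimitOf' _ _ (fun y => ?_) fun j x y h => ?_
    · obtain ⟨j, x, rfl⟩ := T.surj q y
      exact ⟨j, (1 ⊗ₜ x : T.btX j q), ((T.bgf_tmul j q 1 x).trans (one_smul _ _)).symm⟩
    · have key : ∀ x y : T.btX j q, T.bgf j q x = T.bgf j q y →
          ∃ j', ∃ h : j ≤ j', T.btf h q x = T.btf h q y := by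
        intro x y h
        obtain ⟨j', hj, e⟩ := T.exists_btf_eq_zero j q (x - y) (by rw [map_sub, h, sub_self])
        exact ⟨j', hj, by rwa [map_sub, sub_eq_zero] at e⟩
      obtain ⟨j', hj, e⟩ := key x y h
      exact ⟨j', homOfLE hj, e⟩

end CxSystem

end SystemBaseChange

/-! ### Maps to filtered colimits in a pretriangulated category -/

section LiftsKills

universe v' u' v'' u''

open Pretriangulated

variable {D : Type u'} [Category.{v'} D] {J : Type u''} [Category.{v''} J] {G : J ⥤ D}
  (c : Cocone G)

/-- Every morphism from `M` to the vertex of the cocone `c` factors through the diagram. -/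
def Lifts (M : D) : Prop :=
  ∀ φ : M ⟶ c.pt, ∃ j, ∃ ψ : M ⟶ G.obj j, ψ ≫ c.ι.app j = φ

/-- Every morphism from `M` to the diagram that vanishes at the vertex of the cocone `c` vanishes
further along the diagram. -/
def Kills [HasZeroMorphisms D] (M : D) : Prop :=
  ∀ j (ψ : M ⟶ G.obj j), ψ ≫ c.ι.app j = 0 → ∃ j', ∃ f : j ⟶ j', ψ ≫ G.map f = 0

variable {c}

theorem Lifts.of_iso {M M' : D} (h : Lifts c M) (e : M ≅ M') : Lifts c M' := fun φ => by
  obtain ⟨j, ψ, hψ⟩ := h (e.hom ≫ φ)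
  exact ⟨j, e.inv ≫ ψ, by rw [Category.assoc, hψ, Iso.inv_hom_id_assoc]⟩

theorem Kills.of_iso [HasZeroMorphisms D] {M M' : D} (h : Kills c M) (e : M ≅ M') :
    Kills c M' := fun j ψ hψ => by
  obtain ⟨j', f, hf⟩ := h j (e.hom ≫ ψ) (by rw [Category.assoc, hψ, comp_zero])
  exact ⟨j', f, by rw [← cancel_epi e.hom, ← Category.assoc, hf, comp_zero]⟩

variable [Preadditive D] [HasZeroObject D] [HasShift D ℤ] [∀ n : ℤ, (shiftFunctor D n).Additive]
  [Pretriangulated D] [IsFiltered J]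

/-- The injectivity part of the five lemma, for maps from a distinguished triangle to a filtered
colimit. -/
theorem Kills.obj₃ {T : Triangle D} (hT : T ∈ distTriang D) (h₂ : Kills c T.obj₂)
    (h₂' : Lifts c (T.obj₂⟦(1 : ℤ)⟧)) (h₁ : Kills c (T.obj₁⟦(1 : ℤ)⟧)) : Kills c T.obj₃ := by
  intro j ψ hψ
  obtain ⟨j₁, f₁, e₁⟩ := h₂ j (T.mor₂ ≫ ψ) (by rw [Category.assoc, hψ, comp_zero])
  obtain ⟨θ, hθ⟩ := Triangle.yoneda_exact₃ T hT (ψ ≫ G.map f₁) (by rw [← Category.assoc, e₁])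
  have e₂ : T.mor₃ ≫ θ ≫ c.ι.app j₁ = 0 := by
    rw [← Category.assoc, ← hθ, Category.assoc, c.w, hψ]
  obtain ⟨μ, hμ⟩ : ∃ μ : T.obj₂⟦(1 : ℤ)⟧ ⟶ c.pt, θ ≫ c.ι.app j₁ = (-T.mor₁⟦(1 : ℤ)⟧') ≫ μ :=
    Triangle.yoneda_exact₃ T.rotate (rot_of_distTriang T hT) (θ ≫ c.ι.app j₁) e₂
  obtain ⟨j₂, μ', hμ'⟩ := h₂' μ
  let j₃ := IsFiltered.max j₁ j₂
  let l : j₁ ⟶ j₃ := IsFiltered.leftToMax j₁ j₂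
  let r : j₂ ⟶ j₃ := IsFiltered.rightToMax j₁ j₂
  obtain ⟨j₄, f₄, e₄⟩ := h₁ j₃ (θ ≫ G.map l + T.mor₁⟦(1 : ℤ)⟧' ≫ μ' ≫ G.map r) (by
    rw [Preadditive.add_comp, Category.assoc, Category.assoc, Category.assoc, c.w, c.w, hμ, hμ',
      Preadditive.neg_comp, neg_add_cancel])
  refine ⟨j₄, f₁ ≫ l ≫ f₄, ?_⟩
  have h0 : T.mor₃ ≫ T.mor₁⟦(1 : ℤ)⟧' = 0 := comp_distTriang_mor_zero₃₁ T hT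
  have := congrArg (fun x => T.mor₃ ≫ x) e₄
  simp only [Preadditive.add_comp, Preadditive.comp_add, Category.assoc, comp_zero,
    reassoc_of% h0, zero_comp, add_zero] at this
  rw [G.map_comp, G.map_comp, ← Category.assoc, hθ, Category.assoc, this]

/-- The surjectivity part of the five lemma, for maps from a distinguished triangle to a filtered
colimit. -/
theorem Lifts.obj₃ {T : Triangle D} (hT : T ∈ distTriang D) (h₂ : Lifts c T.obj₂)
    (h₁ : Kills c T.obj₁) (h₁' : Lifts c (T.obj₁⟦(1 : ℤ)⟧)) : Lifts c T.obj₃ := by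
  intro φ
  obtain ⟨j, η, hη⟩ := h₂ (T.mor₂ ≫ φ)
  obtain ⟨j₁, f₁, e₁⟩ := h₁ j (T.mor₁ ≫ η) (by
    rw [Category.assoc, hη, ← Category.assoc, comp_distTriang_mor_zero₁₂ T hT, zero_comp])
  obtain ⟨ζ, hζ⟩ := Triangle.yoneda_exact₂ T hT (η ≫ G.map f₁) (by rw [← Category.assoc, e₁])
  let φ' : T.obj₃ ⟶ c.pt := ζ ≫ c.ι.app j₁
  have hφ' : T.mor₂ ≫ φ' = T.mor₂ ≫ φ := by
    rw [← hη, ← c.w f₁, ← Category.assoc, ← hζ, Category.assoc]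
  obtain ⟨θ, hθ⟩ := Triangle.yoneda_exact₃ T hT (φ - φ') (by
    rw [Preadditive.comp_sub, hφ', sub_self])
  obtain ⟨j₂, θ', hθ'⟩ := h₁' θ
  let j₃ := IsFiltered.max j₁ j₂
  let l : j₁ ⟶ j₃ := IsFiltered.leftToMax j₁ j₂
  let r : j₂ ⟶ j₃ := IsFiltered.rightToMax j₁ j₂
  refine ⟨j₃, ζ ≫ G.map l + T.mor₃ ≫ θ' ≫ G.map r, ?_⟩
  rw [Preadditive.add_comp, Category.assoc, Category.assoc, Category.assoc, c.w, c.w, hθ', ← hθ]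
  exact add_sub_cancel φ' φ

end LiftsKills

/-! ### Filtered colimits of complexes of modules -/

section Elementwise

variable {A : Type u} [CommRing A] {J : Type u} [SmallCategory J] [IsFiltered J]
  {F : J ⥤ CochainComplex (ModuleCat.{u} A) ℤ} {c : Cocone F} (hc : IsColimit c)

include hc in
theorem exists_rep_of_isColimit (q : ℤ) (x : c.pt.X q) :
    ∃ j, ∃ y : (F.obj j).X q, ((c.ι.app j).f q).hom y = x :=
  Concrete.isColimit_exists_rep _
    (isColimitOfPreserves (HomologicalComplex.eval (ModuleCat.{u} A) _ q) hc) x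

include hc in
theorem exists_map_eq_zero_of_isColimit (q : ℤ) (j : J) (y : (F.obj j).X q)
    (hy : ((c.ι.app j).f q).hom y = 0) : ∃ j', ∃ f : j ⟶ j', ((F.map f).f q).hom y = 0 := by
  obtain ⟨j', f, g, h⟩ := (Concrete.isColimit_rep_eq_iff_exists
    (F := F ⋙ HomologicalComplex.eval (ModuleCat.{u} A) _ q)
    (isColimitOfPreserves (HomologicalComplex.eval (ModuleCat.{u} A) _ q) hc)
      (i := j) (j := j) y 0).1
    (hy.trans (map_zero ((c.ι.app j).f q).hom).symm)
  exact ⟨j', f, h.trans (map_zero ((F.map g).f q).hom)⟩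

variable [HasDerivedCategory.{w} (ModuleCat.{u} A)]

include hc in
theorem isGE_of_isColimit (n : ℤ) (hF : ∀ j, (DerivedCategory.Q.obj (F.obj j)).IsGE n) :
    (DerivedCategory.Q.obj c.pt).IsGE n := by
  simp only [DerivedCategory.isGE_Q_obj_iff] at hF ⊢
  rw [CochainComplex.isGE_iff]
  intro i hi
  rw [HomologicalComplex.exactAt_iff' _ (i - 1) i (i + 1) (by simp) (by simp),
    ShortComplex.moduleCat_exact_iff]
  intro x hx
  obtain ⟨j, y, rfl⟩ := exists_rep_of_isColimit hc i x
  have h0 : ((c.ι.app j).f (i + 1)).hom (((F.obj j).d i (i + 1)).hom y) = 0 := by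
    refine Eq.trans ?_ hx
    exact (congrArg (fun φ => φ.hom y) ((c.ι.app j).comm i (i + 1))).symm
  obtain ⟨j', f, hf⟩ := exists_map_eq_zero_of_isColimit hc (i + 1) j _ h0
  have hE := (CochainComplex.isGE_iff _ n).1 (hF j') i hi
  rw [HomologicalComplex.exactAt_iff' _ (i - 1) i (i + 1) (by simp) (by simp),
    ShortComplex.moduleCat_exact_iff] at hE
  obtain ⟨z, hz⟩ := hE (((F.map f).f i).hom y) (by
    refine Eq.trans ?_ hf
    exact congrArg (fun φ => φ.hom y) ((F.map f).comm i (i + 1)))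
  refine ⟨((c.ι.app j').f (i - 1)).hom z, ?_⟩
  have h1 := congrArg (fun φ => φ.hom z) ((c.ι.app j').comm (i - 1) i)
  refine h1.trans ?_
  change ((c.ι.app j').f i).hom (((F.obj j').d (i - 1) i).hom z) = _
  refine (congrArg ((c.ι.app j').f i).hom hz).trans ?_
  exact congrArg (fun φ => (φ.f i).hom y) (c.w f)

end Elementwise

/-! ### Maps from bounded complexes of finite free modules to filtered colimits -/

/-- A bounded complex of finitely generated free modules. -/
structure IsFinFree {A : Type u} [CommRing A] (P : CochainComplex (ModuleCat.{u} A) ℤ) : Prop where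
  free : ∀ q, Module.Free A (P.X q)
  finite : ∀ q, Module.Finite A (P.X q)
  bounded : ∃ s : Finset ℤ, ∀ q ∉ s, Subsingleton (P.X q)

namespace IsFinFree

variable {A : Type u} [CommRing A] {P : CochainComplex (ModuleCat.{u} A) ℤ} (hP : IsFinFree P)

include hP

theorem shift (k : ℤ) : IsFinFree (P⟦k⟧) where
  free q := hP.free (q + k)
  finite q := hP.finite (q + k)
  bounded := by
    obtain ⟨s, hs⟩ := hP.bounded
    refine ⟨s.image (· - k), fun q hq => hs (q + k) fun h => hq ?_⟩
    exact Finset.mem_image.2 ⟨q + k, h, by ring⟩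

theorem isKProjective : P.IsKProjective := by
  obtain ⟨s, hs⟩ := hP.bounded
  obtain ⟨b, hb⟩ := s.bddAbove
  have : P.IsStrictlyLE b := by
    rw [CochainComplex.isStrictlyLE_iff]
    intro i hi
    have := hs i fun h => absurd (hb h) (not_le.2 hi)
    exact ModuleCat.isZero_of_subsingleton _
  have (n : ℤ) : Projective (P.X n) := by
    have := hP.free n
    exact (IsProjective.iff_projective (P.X n)).1 inferInstance
  exact CochainComplex.isKProjective_of_projective P b

variable {J : Type u} [SmallCategory J] [IsFiltered J]
  {F : J ⥤ CochainComplex (ModuleCat.{u} A) ℤ} {c : Cocone F} (hc : IsColimit c)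

include hc

/-- A family of maps out of the terms of `P` lifts to the diagram. -/
theorem exists_lift (τ : ℤ → ℤ) (φ : ∀ q, P.X q ⟶ c.pt.X (τ q)) :
    ∃ j, ∀ q, ∃ ψ : P.X q ⟶ (F.obj j).X (τ q), ψ ≫ (c.ι.app j).f (τ q) = φ q := by
  have step (q : ℤ) : ∃ j, ∃ ψ : P.X q ⟶ (F.obj j).X (τ q), ψ ≫ (c.ι.app j).f (τ q) = φ q := by
    have := hP.free q
    have := hP.finite q
    let b := Module.Free.chooseBasis A (P.X q)
    choose j y hy using fun i => exists_rep_of_isColimit hc (τ q) ((φ q).hom (b i))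
    classical
    obtain ⟨l, hl⟩ := IsFiltered.sup_objs_exists (Finset.univ.image j)
    let f (i) : j i ⟶ l := (hl (Finset.mem_image_of_mem j (Finset.mem_univ i))).some
    refine ⟨l, ModuleCat.ofHom (b.constr A fun i => ((F.map (f i)).f (τ q)).hom (y i)), ?_⟩
    refine ModuleCat.hom_ext (b.ext fun i => ?_)
    rw [ModuleCat.hom_comp, LinearMap.comp_apply, ← hy i, ModuleCat.hom_ofHom, b.constr_basis]
    exact congrArg (fun g => (g.f (τ q)).hom (y i)) (c.w (f i))
  obtain ⟨s, hs⟩ := hP.bounded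
  choose j ψ hψ using step
  classical
  obtain ⟨l, hl⟩ := IsFiltered.sup_objs_exists (s.image j)
  refine ⟨l, fun q => ?_⟩
  by_cases hq : q ∈ s
  · let f : j q ⟶ l := (hl (Finset.mem_image_of_mem j hq)).some
    refine ⟨ψ q ≫ (F.map f).f (τ q), ?_⟩
    rw [← hψ q, Category.assoc]
    exact congrArg (fun g => ψ q ≫ g.f (τ q)) (c.w f)
  · have := hs q hq
    exact ⟨0, (ModuleCat.isZero_of_subsingleton (P.X q)).eq_of_src _ _⟩

/-- A family of maps from the terms of `P` to the diagram that vanishes in the colimit vanishes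
further along the diagram. -/
theorem exists_map_eq_zero (τ : ℤ → ℤ) (j : J) (ψ : ∀ q, P.X q ⟶ (F.obj j).X (τ q))
    (hψ : ∀ q, ψ q ≫ (c.ι.app j).f (τ q) = 0) :
    ∃ j', ∃ f : j ⟶ j', ∀ q, ψ q ≫ (F.map f).f (τ q) = 0 := by
  classical
  have step (q : ℤ) (j : J) (ψ : P.X q ⟶ (F.obj j).X (τ q)) (hψ : ψ ≫ (c.ι.app j).f (τ q) = 0) :
      ∃ j', ∃ f : j ⟶ j', ψ ≫ (F.map f).f (τ q) = 0 := by
    have := hP.finite q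
    obtain ⟨t, ht⟩ := Module.finite_def.1 (hP.finite q)
    have key : ∀ t : Finset (P.X q), ∃ j', ∃ f : j ⟶ j', ∀ x ∈ t,
        ((F.map f).f (τ q)).hom (ψ.hom x) = 0 := by
      intro t
      induction t using Finset.induction_on with
      | empty => exact ⟨j, 𝟙 j, fun x hx => absurd hx (Finset.notMem_empty x)⟩
      | insert x t _ ih =>
        obtain ⟨j₁, f₁, h₁⟩ := ih
        obtain ⟨j₂, f₂, h₂⟩ := exists_map_eq_zero_of_isColimit hc (τ q) j₁
          (((F.map f₁).f (τ q)).hom (ψ.hom x)) ((congrArg (fun g => (g.f (τ q)).hom (ψ.hom x))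
            (c.w f₁)).trans (congrArg (fun g => g.hom x) hψ))
        refine ⟨j₂, f₁ ≫ f₂, fun y hy => ?_⟩
        rw [F.map_comp]
        change ((F.map f₂).f (τ q)).hom (((F.map f₁).f (τ q)).hom (ψ.hom y)) = 0
        rcases Finset.mem_insert.1 hy with rfl | hy
        · exact h₂
        · rw [h₁ y hy, map_zero]
    obtain ⟨j', f, h⟩ := key t
    refine ⟨j', f, ModuleCat.hom_ext (LinearMap.ext_on ht fun x hx => ?_)⟩
    exact h x hx
  obtain ⟨s, hs⟩ := hP.bounded
  have key : ∀ s : Finset ℤ, ∃ j', ∃ f : j ⟶ j', ∀ q ∈ s, ψ q ≫ (F.map f).f (τ q) = 0 := by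
    intro s
    induction s using Finset.induction_on with
    | empty => exact ⟨j, 𝟙 j, fun q hq => absurd hq (Finset.notMem_empty q)⟩
    | insert q s _ ih =>
      obtain ⟨j₁, f₁, h₁⟩ := ih
      obtain ⟨j₂, f₂, h₂⟩ := step q j₁ (ψ q ≫ (F.map f₁).f (τ q)) (by
        rw [Category.assoc]
        exact (congrArg (fun g => ψ q ≫ g.f (τ q)) (c.w f₁)).trans (hψ q))
      refine ⟨j₂, f₁ ≫ f₂, fun p hp => ?_⟩
      rw [F.map_comp, HomologicalComplex.comp_f, ← Category.assoc]
      rcases Finset.mem_insert.1 hp with rfl | hp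
      · exact h₂
      · rw [h₁ p hp, zero_comp]
  obtain ⟨j', f, h⟩ := key s
  refine ⟨j', f, fun q => ?_⟩
  by_cases hq : q ∈ s
  · exact h q hq
  · have := hs q hq
    exact (ModuleCat.isZero_of_subsingleton (P.X q)).eq_of_src _ _

/-- A morphism of complexes from `P` lifts to the diagram. -/
theorem exists_hom_lift (φ : P ⟶ c.pt) : ∃ j, ∃ ψ : P ⟶ F.obj j, ψ ≫ c.ι.app j = φ := by
  obtain ⟨j, h⟩ : ∃ j, ∀ q, ∃ ψ : P.X q ⟶ (F.obj j).X q, ψ ≫ (c.ι.app j).f q = φ.f q :=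
    hP.exists_lift hc id φ.f
  choose ψ hψ using h
  obtain ⟨j', f, hf⟩ := hP.exists_map_eq_zero hc (· + 1) j
    (fun q => ψ q ≫ (F.obj j).d q (q + 1) - P.d q (q + 1) ≫ ψ (q + 1)) fun q => by
      rw [Preadditive.sub_comp, Category.assoc, Category.assoc, ← (c.ι.app j).comm, hψ (q + 1),
        ← Category.assoc, hψ q]
      exact sub_eq_zero.2 (φ.comm q (q + 1))
  refine ⟨j', { f := fun q => ψ q ≫ (F.map f).f q, comm' := fun q q' h => ?_ }, ?_⟩
  · obtain rfl : q + 1 = q' := h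
    have := hf q
    rw [Preadditive.sub_comp, sub_eq_zero, Category.assoc, Category.assoc] at this
    rw [Category.assoc, (F.map f).comm, this]
  · ext1 q
    rw [HomologicalComplex.comp_f, Category.assoc, ← hψ q]
    exact congrArg (fun g => ψ q ≫ g.f q) (c.w f)

/-- A morphism of complexes from `P` to the diagram that vanishes in the colimit vanishes further
along the diagram. -/
theorem exists_hom_map_eq_zero (j : J) (ψ : P ⟶ F.obj j) (hψ : ψ ≫ c.ι.app j = 0) :
    ∃ j', ∃ f : j ⟶ j', ψ ≫ F.map f = 0 := by
  obtain ⟨j', f, h⟩ := hP.exists_map_eq_zero hc id j ψ.f fun q => congrArg (fun g => g.f q) hψ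
  exact ⟨j', f, by ext1 q; exact h q⟩

variable [HasDerivedCategory.{w} (ModuleCat.{u} A)]

omit hc in
/-- As `P` is K-projective, its maps in the derived category are homotopy classes of maps. -/
theorem exists_Q_map_eq {X : CochainComplex (ModuleCat.{u} A) ℤ}
    (φ : DerivedCategory.Q.obj P ⟶ DerivedCategory.Q.obj X) :
    ∃ f : P ⟶ X, DerivedCategory.Q.map f = φ := by
  have := hP.isKProjective
  obtain ⟨g, hg⟩ := (CochainComplex.IsKProjective.Qh_map_bijective P
    ((HomotopyCategory.quotient _ _).obj X)).surjective
    ((DerivedCategory.quotientCompQhIso _).hom.app P ≫ φ ≫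
      (DerivedCategory.quotientCompQhIso _).inv.app X)
  obtain ⟨f, rfl⟩ := (HomotopyCategory.quotient _ _).map_surjective g
  refine ⟨f, ?_⟩
  rw [← cancel_mono ((DerivedCategory.quotientCompQhIso _).inv.app X),
    DerivedCategory.quotientCompQhIso_inv_naturality, hg, Iso.inv_hom_id_app_assoc]

omit hc in
theorem nonempty_homotopy {X : CochainComplex (ModuleCat.{u} A) ℤ} (f : P ⟶ X)
    (hf : DerivedCategory.Q.map f = 0) : Nonempty (Homotopy f 0) := by
  have := hP.isKProjective
  rw [← HomotopyCategory.quotient_map_eq_zero_iff]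
  refine (CochainComplex.IsKProjective.Qh_map_bijective P
    ((HomotopyCategory.quotient _ _).obj X)).injective ?_
  rw [← cancel_mono ((DerivedCategory.quotientCompQhIso _).hom.app X),
    DerivedCategory.quotientCompQhIso_hom_naturality, hf, comp_zero, Functor.map_zero, zero_comp]

theorem lifts : Lifts (DerivedCategory.Q.mapCocone c) (DerivedCategory.Q.obj P) := by
  intro φ
  obtain ⟨f, rfl⟩ := hP.exists_Q_map_eq φ
  obtain ⟨j, ψ, rfl⟩ := hP.exists_hom_lift hc f
  exact ⟨j, DerivedCategory.Q.map ψ, (DerivedCategory.Q.map_comp _ _).symm⟩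

/-- A null homotopy over the colimit descends to a term `i` of the diagram; the difference between
the given map and the map with that null homotopy vanishes further along. -/
theorem kills : Kills (DerivedCategory.Q.mapCocone c) (DerivedCategory.Q.obj P) := by
  intro j φ hφ
  obtain ⟨ψ, rfl⟩ := hP.exists_Q_map_eq φ
  obtain ⟨H⟩ := hP.nonempty_homotopy (ψ ≫ c.ι.app j)
    ((DerivedCategory.Q.map_comp _ _).trans hφ)
  obtain ⟨l, h⟩ := hP.exists_lift hc (· - 1) fun q => H.hom q (q - 1)
  have h' : ∀ q q' (_ : (ComplexShape.up ℤ).Rel q' q), ∃ η : P.X q ⟶ (F.obj l).X q',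
      η ≫ (c.ι.app l).f q' = H.hom q q' := by
    intro q q' hq
    obtain rfl : q' + 1 = q := hq
    have := h (q' + 1)
    rwa [add_sub_cancel_right] at this
  choose η hη using h'
  let i := IsFiltered.max j l
  let u : j ⟶ i := IsFiltered.leftToMax j l
  let v : l ⟶ i := IsFiltered.rightToMax j l
  have key : (ψ ≫ F.map u - Homotopy.nullHomotopicMap' η ≫ F.map v) ≫ c.ι.app i = 0 := by
    rw [Preadditive.sub_comp, Category.assoc, Category.assoc, c.w, c.w,
      Homotopy.nullHomotopicMap'_comp, sub_eq_zero]
    ext1 q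
    rw [Homotopy.nullHomotopicMap'_f (k₂ := q - 1) (k₁ := q) (k₀ := q + 1) (by simp) (by simp),
      hη, hη]
    have := H.comm q
    rw [dNext_eq H.hom (i' := q + 1) (by simp), prevD_eq H.hom (j' := q - 1) (by simp)] at this
    rw [this, HomologicalComplex.zero_f, add_zero]
    rfl
  obtain ⟨i', f, hf⟩ := hP.exists_hom_map_eq_zero hc i _ key
  refine ⟨i', u ≫ f, ?_⟩
  rw [Preadditive.sub_comp, sub_eq_zero, Category.assoc, Category.assoc, ← F.map_comp,
    ← F.map_comp] at hf
  have h0 : DerivedCategory.Q.map (Homotopy.nullHomotopicMap' η) = 0 :=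
    (DerivedCategory.Q_map_eq_of_homotopy _ (Homotopy.nullHomotopy' η)).trans
      (DerivedCategory.Q.map_zero _ _)
  refine (DerivedCategory.Q.map_comp _ _).symm.trans ?_
  rw [hf, DerivedCategory.Q.map_comp, h0, zero_comp]

end IsFinFree

/-! ### Coherence of base changes of Tor-acyclic complexes -/

section Cover

open TensorProduct

variable {R : Type u} [CommRing R]

/-- The nonzero elements of degree `q` of a closed finite set. -/
abbrev ClosedFinset.gen {S : Cx R} (Y : ClosedFinset S) (q : ℤ) : Type u :=
  {x : S.X q // x ≠ 0 ∧ ⟨q, x⟩ ∈ Y.1}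

instance {S : Cx R} (Y : ClosedFinset S) (q : ℤ) : Finite (Y.gen q) :=
  Finite.of_injective (β := Y.1) (fun x => ⟨⟨q, x.1⟩, x.2.2⟩) fun x y h => by
    have := congrArg Subtype.val h
    simp only [Sigma.mk.injEq, heq_eq_eq, true_and] at this
    exact Subtype.ext this

open Classical in
/-- The value of the differential of `Cx.cover` on a generator: the generator `dx`, or zero if
`dx = 0`. -/
noncomputable def ClosedFinset.dgen {S : Cx R} (Y : ClosedFinset S) (q : ℤ) (x : Y.gen q) :
    Y.gen (q + 1) →₀ R :=
  if h : S.d q x.1 = 0 then 0 else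
    Finsupp.single ⟨S.d q x.1, h, (Y.2 ⟨q, x.1⟩ x.2.2).resolve_left h⟩ 1

/-- The complex of free modules on the nonzero elements of a closed finite set; as zero is not a
generator, it vanishes in all degrees in which `S` does. -/
noncomputable def Cx.cover {S : Cx R} (Y : ClosedFinset S) : Cx R where
  X q := Y.gen q →₀ R
  d q := Finsupp.linearCombination R (Y.dgen q)
  dd q x := by
    rw [← LinearMap.comp_apply, ← LinearMap.zero_apply (σ₁₂ := RingHom.id R) x]
    congr 1
    ext1 y
    refine LinearMap.ext_ring ?_
    simp only [LinearMap.comp_apply, Finsupp.lsingle_apply, Finsupp.linearCombination_single,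
      one_smul, LinearMap.zero_apply]
    rw [ClosedFinset.dgen]
    split_ifs with h
    · rw [map_zero]
    · rw [Finsupp.linearCombination_single, one_smul, ClosedFinset.dgen, dif_pos (S.dd q y.1)]

/-- The canonical map from `Cx.cover Y`. -/
noncomputable def Cx.coverπ {S : Cx R} (Y : ClosedFinset S) : Hom (Cx.cover Y) S where
  f q := Finsupp.linearCombination R fun x : Y.gen q => x.1
  comm q x := by
    suffices h : (Finsupp.linearCombination R fun x : Y.gen (q + 1) => x.1) ∘ₗ
        Finsupp.linearCombination R (Y.dgen q) =
        S.d q ∘ₗ Finsupp.linearCombination R fun x : Y.gen q => x.1 from LinearMap.congr_fun h x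
    ext1 y
    refine LinearMap.ext_ring ?_
    simp only [LinearMap.comp_apply, Finsupp.lsingle_apply, Finsupp.linearCombination_single,
      one_smul]
    rw [ClosedFinset.dgen]
    split_ifs with h
    · rw [map_zero, h]
    · rw [Finsupp.linearCombination_single, one_smul]

/-- A complex of finite modules in degrees between `a` and `b`, all of whose terms are
Tor-acyclic with respect to `A`. -/
structure Cx.FinTor (S : Cx R) (A : Type u) [AddCommGroup A] [Module R A] (a b : ℤ) : Prop where
  fg : ∀ q, Module.Finite R (S.X q)
  lower : ∀ q < a, Subsingleton (S.X q)
  upper : ∀ q, b < q → Subsingleton (S.X q)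
  tor : ∀ q p, TorVanish (R := R) (S.X q) p A

theorem Cx.FinTor.exists_closedFinset {S : Cx R} {A : Type u} [AddCommGroup A] [Module R A]
    {a b : ℤ} (hS : S.FinTor A a b) :
    ∃ Y : ClosedFinset S, ∀ q, Function.Surjective ((coverπ Y).f q) := by
  classical
  choose s hs using fun q => Module.finite_def.1 (hS.fg q)
  obtain ⟨Y, hY⟩ := SemiCoh.exists_closedFinset
    ((Finset.Icc a b).sigma s : Finset (Σ q, S.X q))
  refine ⟨Y, fun q => ?_⟩
  rw [← LinearMap.range_eq_top]
  refine (Finsupp.range_linearCombination R).trans (top_unique ?_)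
  by_cases hq : q ∈ Finset.Icc a b
  · rw [← hs q, Submodule.span_le]
    intro x hx
    by_cases h : x = 0
    · rw [h]
      exact zero_mem _
    · exact Submodule.subset_span ⟨⟨x, h, hY (Finset.mem_sigma.2 ⟨hq, hx⟩)⟩, rfl⟩
  · have : Subsingleton (S.X q) := by
      rw [Finset.mem_Icc, not_and_or, not_le, not_le] at hq
      exact hq.elim (hS.lower q) (hS.upper q)
    intro x _
    rw [Subsingleton.elim x 0]
    exact zero_mem _

theorem Cx.subsingleton_cover {S : Cx R} (Y : ClosedFinset S) {q : ℤ} (h : Subsingleton (S.X q)) :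
    Subsingleton ((cover Y).X q) := by
  have : IsEmpty (Y.gen q) := ⟨fun x => x.2.1 (Subsingleton.elim _ _)⟩
  exact (inferInstance : Subsingleton (Y.gen q →₀ R))

/-- The kernel of a free cover of a complex of Tor-acyclic modules is again such a complex, in the
same degrees. -/
theorem Cx.FinTor.ker [IsNoetherianRing R] {S : Cx R} {A : Type u} [AddCommGroup A] [Module R A]
    {a b : ℤ} (hS : S.FinTor A a b) {Y : ClosedFinset S}
    (hY : ∀ q, Function.Surjective ((coverπ Y).f q)) : (Cx.ker (coverπ Y)).FinTor A a b where
  fg q := by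
    have : Module.Finite R (Y.gen q →₀ R) := inferInstance
    exact (inferInstance : Module.Finite R
      (LinearMap.ker (Finsupp.linearCombination R fun x : Y.gen q => x.1)))
  lower q hq := by
    have := subsingleton_cover Y (hS.lower q hq)
    exact ⟨fun x y => Subtype.ext (Subsingleton.elim _ _)⟩
  upper q hq := by
    have := subsingleton_cover Y (hS.upper q hq)
    exact ⟨fun x y => Subtype.ext (Subsingleton.elim _ _)⟩
  tor q p := by
    have : Module.Flat R ((cover Y).X q) := (inferInstance : Module.Flat R (Y.gen q →₀ R))
    exact TorVanish.of_succ (j := (kerι (coverπ Y)).f q) (π := (coverπ Y).f q)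
      (Submodule.injective_subtype _) (LinearMap.exact_subtype_ker_map _) (hY q) p
      (hS.tor q (p + 1))

variable {A : Type u} [CommRing A] [Algebra R A]

variable (A) in
/-- The base change of a morphism of complexes. -/
noncomputable def Cx.Hom.baseChange {S S' : Cx R} (φ : Hom S S') :
    Hom (S.baseChange A) (S'.baseChange A) where
  f q := (φ.f q).baseChange A
  comm q x := linearMap_ext_tmul (f := (φ.f (q + 1)).baseChange A ∘ₗ (S.d q).baseChange A)
    (g := (S'.d q).baseChange A ∘ₗ (φ.f q).baseChange A) (fun y => by simp [φ.comm]) x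

/-- The base change of a free cover remains exact. -/
theorem Cx.FinTor.shortExact_baseChange {S : Cx R} {a b : ℤ} (hS : S.FinTor A a b)
    {Y : ClosedFinset S} (hY : ∀ q, Function.Surjective ((coverπ Y).f q)) :
    ∃ w : ((kerι (coverπ Y)).baseChange A).toCC ≫ ((coverπ Y).baseChange A).toCC = 0,
      (ShortComplex.mk _ _ w).ShortExact :=
  Cx.shortExact _ _
    (fun q => (hS.tor q 0).lTensor_injective (Submodule.injective_subtype _)
      (LinearMap.exact_subtype_ker_map _) (hY q))
    (fun q => lTensor_exact A (LinearMap.exact_subtype_ker_map ((coverπ Y).f q)) (hY q))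
    (fun q => LinearMap.lTensor_surjective A (hY q))

theorem Cx.FinTor.isFinFree {S : Cx R} {a b : ℤ} (hS : S.FinTor A a b) (Y : ClosedFinset S) :
    IsFinFree ((cover Y).baseChange A).toCC where
  free q := (inferInstance : Module.Free A (A ⊗[R] (Y.gen q →₀ R)))
  finite q := (inferInstance : Module.Finite A (A ⊗[R] (Y.gen q →₀ R)))
  bounded := by
    refine ⟨Finset.Icc a b, fun q hq => ?_⟩
    have : Subsingleton ((cover Y).X q) := by
      rw [Finset.mem_Icc, not_and_or, not_le, not_le] at hq
      exact subsingleton_cover Y (hq.elim (hS.lower q) (hS.upper q))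
    exact (inferInstance : Subsingleton (A ⊗[R] (cover Y).X q))

end Cover

section Coherent

open TensorProduct

variable {R A : Type u} [CommRing R] [IsNoetherianRing R] [CommRing A] [Algebra R A]
  [HasDerivedCategory.{w} (ModuleCat.{u} A)]

namespace Cx.FinTor

omit [IsNoetherianRing R] in
theorem isGE {S : Cx R} {a b : ℤ} (hS : S.FinTor A a b) :
    (DerivedCategory.Q.obj (S.baseChange A).toCC).IsGE a := by
  have : (S.baseChange A).toCC.IsStrictlyGE a := by
    rw [CochainComplex.isStrictlyGE_iff]
    intro i hi
    have := hS.lower i hi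
    have : Subsingleton ((S.baseChange A).toCC.X i) :=
      (inferInstance : Subsingleton (A ⊗[R] S.X i))
    exact ModuleCat.isZero_of_subsingleton _
  infer_instance

omit [IsNoetherianRing R] in
theorem isLE {S : Cx R} {a b : ℤ} (hS : S.FinTor A a b) :
    (DerivedCategory.Q.obj (S.baseChange A).toCC).IsLE b := by
  have : (S.baseChange A).toCC.IsStrictlyLE b := by
    rw [CochainComplex.isStrictlyLE_iff]
    intro i hi
    have := hS.upper i hi
    have : Subsingleton ((S.baseChange A).toCC.X i) :=
      (inferInstance : Subsingleton (A ⊗[R] S.X i))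
    exact ModuleCat.isZero_of_subsingleton _
  infer_instance

variable {J : Type u} [SmallCategory J] [IsFiltered J]
  {F : J ⥤ CochainComplex (ModuleCat.{u} A) ℤ} {c : Cocone F} {n : ℤ}

/-- The isomorphism between a twofold shift and a shift. -/
noncomputable abbrev shiftOne (M : DerivedCategory (ModuleCat.{u} A)) (k : ℤ) :
    M⟦k + 1⟧ ≅ (M⟦k⟧)⟦(1 : ℤ)⟧ := (shiftFunctorAdd _ k 1).app M

variable (hc : IsColimit c) (hF : ∀ j, (DerivedCategory.Q.obj (F.obj j)).IsGE n)

include hc hF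

/-- The induction is on the amplitude of the complex relative to `n`: it starts because there are
no nonzero morphisms from objects in degrees `< n` to objects in degrees `≥ n`. -/
theorem kills (e : ℕ) {S : Cx R} {a b k : ℤ} (hS : S.FinTor A a b) (hk : b - k < n + e) :
    Kills (DerivedCategory.Q.mapCocone c)
      ((DerivedCategory.Q.obj (S.baseChange A).toCC)⟦k⟧) := by
  induction e generalizing S a k with
  | zero =>
    intro j ψ _
    have := hS.isLE
    have : ((DerivedCategory.Q.obj (S.baseChange A).toCC)⟦k⟧).IsLE (b - k) :=
      Triangulated.TStructure.isLE_shift _ _ b k (b - k) (by ring)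
    have h0 : ψ = 0 :=
      DerivedCategory.TStructure.t.zero_of_isLE_of_isGE ψ (b - k) n (by simpa using hk) this (hF j)
    exact ⟨j, 𝟙 j, by rw [h0, zero_comp]⟩
  | succ e ih =>
    obtain ⟨Y, hY⟩ := hS.exists_closedFinset
    obtain ⟨w, hw⟩ := hS.shortExact_baseChange hY
    have hG := hS.isFinFree Y
    have hT := Pretriangulated.Triangle.shift_distinguished _
      (DerivedCategory.triangleOfSES_distinguished hw) k
    refine Kills.obj₃ hT ?_ ?_ ?_
    · exact ((hG.shift k).kills hc).of_iso ((DerivedCategory.Q.commShiftIso k).app _)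
    · exact (((hG.shift (k + 1)).lifts hc).of_iso
        ((DerivedCategory.Q.commShiftIso (k + 1)).app _)).of_iso (shiftOne _ k)
    · exact (ih (hS.ker hY) (by push_cast at hk; omega)).of_iso (shiftOne _ k)

theorem lifts (e : ℕ) {S : Cx R} {a b k : ℤ} (hS : S.FinTor A a b) (hk : b - k < n + e) :
    Lifts (DerivedCategory.Q.mapCocone c)
      ((DerivedCategory.Q.obj (S.baseChange A).toCC)⟦k⟧) := by
  induction e generalizing S a k with
  | zero =>
    intro φ
    have := hS.isLE
    have : ((DerivedCategory.Q.obj (S.baseChange A).toCC)⟦k⟧).IsLE (b - k) :=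
      Triangulated.TStructure.isLE_shift _ _ b k (b - k) (by ring)
    have h0 : φ = 0 := DerivedCategory.TStructure.t.zero_of_isLE_of_isGE φ (b - k) n
      (by simpa using hk) this (isGE_of_isColimit hc n hF)
    exact ⟨IsFiltered.nonempty.some, 0, by rw [h0, zero_comp]⟩
  | succ e ih =>
    obtain ⟨Y, hY⟩ := hS.exists_closedFinset
    obtain ⟨w, hw⟩ := hS.shortExact_baseChange hY
    have hG := hS.isFinFree Y
    have hT := Pretriangulated.Triangle.shift_distinguished _
      (DerivedCategory.triangleOfSES_distinguished hw) k
    refine Lifts.obj₃ hT ?_ ?_ ?_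
    · exact ((hG.shift k).lifts hc).of_iso ((DerivedCategory.Q.commShiftIso k).app _)
    · exact kills hc hF (e + 1) (hS.ker hY) hk
    · exact (ih (hS.ker hY) (by push_cast at hk; omega)).of_iso (shiftOne _ k)

omit hc hF in
theorem isCoherent {S : Cx R} {a b : ℤ} (hS : S.FinTor A a b) :
    IsCoherent (DerivedCategory.Q.obj (S.baseChange A).toCC) where
  bounded_below := ⟨a, hS.isGE⟩
  preserves n J _ _ F hF := by
    have hc := colimit.isColimit F
    obtain ⟨e, he⟩ : ∃ e : ℕ, b - 0 < n + e := ⟨(b - n + 1).toNat, by omega⟩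
    have e0 : (DerivedCategory.Q.obj (S.baseChange A).toCC)⟦(0 : ℤ)⟧ ≅
        DerivedCategory.Q.obj (S.baseChange A).toCC := (shiftFunctorZero _ ℤ).app _
    have hk := (kills hc hF e hS he).of_iso e0
    have hl := (lifts hc hF e hS he).of_iso e0
    refine preservesColimit_of_preserves_colimit_cocone hc
      (Types.FilteredColimit.isColimitOf' _ _ (fun φ => ?_) fun j x y h => ?_)
    · obtain ⟨j, ψ, hψ⟩ := hl φ
      exact ⟨j, ψ, hψ.symm⟩
    · have key : ∀ x y : DerivedCategory.Q.obj (S.baseChange A).toCC ⟶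
          DerivedCategory.Q.obj (F.obj j),
          x ≫ DerivedCategory.Q.map ((colimit.cocone F).ι.app j) =
            y ≫ DerivedCategory.Q.map ((colimit.cocone F).ι.app j) →
          ∃ j', ∃ f : j ⟶ j', x ≫ DerivedCategory.Q.map (F.map f) =
            y ≫ DerivedCategory.Q.map (F.map f) := by
        intro x y h
        obtain ⟨j', f, hf⟩ := hk j (x - y)
          ((Preadditive.sub_comp _ _ _).trans (sub_eq_zero.2 h))
        exact ⟨j', f, sub_eq_zero.1 ((Preadditive.sub_comp _ _ _).symm.trans hf)⟩
      exact key x y h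

end Cx.FinTor

end Coherent

/-- A ring that is the colimit of a system of Noetherian rings over which it has bounded flat
dimension is semi-coherent. -/
theorem NoetherianSystem.isSemiCoherent {A : Type u} [CommRing A] {d : ℕ}
    (Sy : NoetherianSystem A d) [HasDerivedCategory.{w} (ModuleCat.{u} A)] :
    IsSemiCoherent A := by
  rintro M ⟨n, hM⟩
  obtain ⟨m, K, T, hT, ⟨e⟩⟩ := exists_cxSystem Sy M n
  have key (j : T.J) : ∃ b, (T.S j).FinTor A m b := by
    obtain ⟨b, hb⟩ := T.upper j
    exact ⟨b, T.fg j, T.lower j, hb, fun q p => hT j q p (Nat.zero_le p)⟩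
  have noeth (i : ℕ) : IsNoetherianRing (Sy.R i) := inferInstance
  refine ⟨-m, T.J, inferInstance, inferInstance, T.diagram, fun j => ?_, fun j => ?_,
    ⟨DerivedCategory.Q.mapIso
      (colimit.isColimit _ |>.coconePointUniqueUpToIso T.isColimitCocone) ≪≫ e⟩⟩
  · obtain ⟨b, hb⟩ := key j
    exact hb.isCoherent
  · obtain ⟨b, hb⟩ := key j
    rw [neg_neg]
    exact hb.isGE

/-! ### The defining relations -/

section Relations

variable (k : Type u) [Field k] (N : ℕ)

theorem coeff_aSeries_natCast (i : ℕ) : (aSeries k N).coeff (i : ℤ) = av k N i := by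
  rw [aSeries, LaurentSeries.coeff_coe_powerSeries, PowerSeries.coeff_mk, av]

theorem coeff_aSeries_of_neg {m : ℤ} (hm : m < 0) : (aSeries k N).coeff m = 0 := by
  rw [aSeries, PowerSeries.coeff_coe, if_pos hm]

theorem coeff_relation (m : ℤ) :
    (LaurentSeries.derivative (FreeAlg k N) (aSeries k N)).coeff m -
      (aSeries k N * bSeries k N).coeff m =
    MvPolynomial.C ((m + 1 : ℤ) : k) * (aSeries k N).coeff (m + 1) -
      ∑ j : Fin N, (aSeries k N).coeff (m + 1 + j) * MvPolynomial.X (Sum.inr j) := by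
  rw [LaurentSeries.derivative_apply, LaurentSeries.hasseDeriv_coeff, bSeries, Finset.mul_sum,
    HahnSeries.coeff_sum]
  congr 1
  · rw [Nat.cast_one, Ring.choose_one_right, zsmul_eq_mul]
    simp
  · refine Finset.sum_congr rfl fun j _ => ?_
    rw [HahnSeries.coeff_mul_single]
    congr 2
    ring

theorem rel_eq (hN : 0 < N) (l : ℕ) : rel k N l =
    -((LaurentSeries.derivative (FreeAlg k N) (aSeries k N)).coeff ((l : ℤ) - N) -
      (aSeries k N * bSeries k N).coeff ((l : ℤ) - N)) := by
  let g (p : ℕ) : FreeAlg k N := if h : p < N then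
    (MvPolynomial.X (Sum.inr ⟨N - 1 - p, by omega⟩) -
      MvPolynomial.C (if p + 1 = N then (((l : ℤ) - p : ℤ) : k) else 0)) *
      (aSeries k N).coeff ((l : ℤ) - p) else 0
  have hg₁ (p : ℕ) (hp : ¬ p < N) : g p = 0 := dif_neg hp
  have hg₂ (p : ℕ) (hp : l < p) : g p = 0 := by
    by_cases h : p < N
    · simp only [g, dif_pos h]
      rw [coeff_aSeries_of_neg k N (by omega), mul_zero]
    · exact hg₁ p h
  have h1 : rel k N l = ∑ p ∈ Finset.range (l + 1), g p := by
    rw [rel, Finset.Nat.sum_antidiagonal_eq_sum_range_succ (fun p s => beta k N p s * av k N s)]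
    refine Finset.sum_congr rfl fun p hp => ?_
    have hp : p ≤ l := Nat.lt_succ_iff.1 (Finset.mem_range.1 hp)
    have e : (l : ℤ) - p = ((l - p : ℕ) : ℤ) := by omega
    simp only [g, e, coeff_aSeries_natCast, beta]
    split_ifs
    · simp
    · rfl
    · rw [zero_mul]
  have h2 : ∑ p ∈ Finset.range (l + 1), g p = ∑ p ∈ Finset.range N, g p := by
    rw [Finset.sum_subset (Finset.range_mono (le_max_left (l + 1) N)) fun p _ hp =>
        hg₂ p (by simpa using hp),
      Finset.sum_subset (Finset.range_mono (le_max_right (l + 1) N)) fun p _ hp =>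
        hg₁ p (by simpa using hp)]
  have h3 (j : Fin N) : g (N - 1 - j) =
      (aSeries k N).coeff ((l : ℤ) - N + 1 + j) * MvPolynomial.X (Sum.inr j) -
        if j = ⟨0, hN⟩ then MvPolynomial.C (((l : ℤ) - N + 1 : ℤ) : k) *
          (aSeries k N).coeff ((l : ℤ) - N + 1) else 0 := by
    have hj := j.2
    have e : (l : ℤ) - (N - 1 - j : ℕ) = l - N + 1 + j := by omega
    have e' : (⟨N - 1 - (N - 1 - j), by omega⟩ : Fin N) = j := Fin.ext (by simp; omega)
    simp only [g, dif_pos (show N - 1 - (j : ℕ) < N by omega), e, e']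
    by_cases h : j = ⟨0, hN⟩
    · subst h
      rw [if_pos (by simp; omega), if_pos rfl]
      simp only [Nat.cast_zero, add_zero]
      ring
    · have : (j : ℕ) ≠ 0 := fun h' => h (Fin.ext h')
      rw [if_neg (by omega), if_neg h, MvPolynomial.C_0]
      ring
  rw [h1, h2, ← Finset.sum_range_reflect, Finset.sum_range, Finset.sum_congr rfl fun j _ => h3 j,
    Finset.sum_sub_distrib, Finset.sum_ite_eq' Finset.univ, if_pos (Finset.mem_univ _),
    coeff_relation]
  ring

theorem relations_eq_idl (hN : 0 < N) : relations k N = idl k N 0 0 Set.univ := by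
  apply le_antisymm
  · rw [relations, Ideal.span_le]
    rintro _ ⟨m, rfl⟩
    rw [SetLike.mem_coe]
    dsimp only
    by_cases hm : 0 ≤ m + N
    · obtain ⟨l, hl⟩ := Int.eq_ofNat_of_zero_le hm
      obtain rfl : m = (l : ℤ) - N := by omega
      rw [← neg_mem_iff, ← rel_eq k N hN]
      exact rel_mem_idl (Set.mem_univ l)
    · rw [coeff_relation, coeff_aSeries_of_neg k N (by omega), mul_zero, zero_sub, neg_mem_iff]
      refine Ideal.sum_mem _ fun j _ => ?_
      have := j.2
      rw [coeff_aSeries_of_neg k N (by omega), zero_mul]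
      exact zero_mem _
  · refine idl_le_iff.2 ⟨fun l _ => ?_, fun j hj => absurd hj (Nat.not_lt_zero j),
      fun p hp => absurd hp (Nat.not_lt_zero p)⟩
    rw [rel_eq k N hN, neg_mem_iff]
    exact Ideal.subset_span ⟨_, rfl⟩

/-- The ring `A_0` is generated by `a_0`, because the relations are `i a_i = 0`. -/
theorem isNoetherianRing_A_zero [CharZero k] : IsNoetherianRing (A k 0) := by
  let φ : Polynomial k →ₐ[k] A k 0 := Polynomial.aeval (Ideal.Quotient.mk _ (av k 0 0))
  have ha (j : ℕ) : Ideal.Quotient.mk (relations k 0) (av k 0 (j + 1)) = 0 := by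
    have h : (MvPolynomial.C ((j : k) + 1) * av k 0 (j + 1) : FreeAlg k 0) ∈ relations k 0 := by
      refine Ideal.subset_span ⟨(j : ℤ), ?_⟩
      dsimp only
      rw [coeff_relation]
      have := coeff_aSeries_natCast k 0 (j + 1)
      rw [Nat.cast_add, Nat.cast_one] at this
      simp [this]
    have hj : (j : k) + 1 ≠ 0 := Nat.cast_add_one_ne_zero j
    rw [Ideal.Quotient.eq_zero_iff_mem]
    have := Ideal.mul_mem_left _ (MvPolynomial.C ((j : k) + 1)⁻¹) h
    rwa [← mul_assoc, ← MvPolynomial.C_mul, inv_mul_cancel₀ hj, MvPolynomial.C_1, one_mul] at this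
  have hφ : Function.Surjective φ := by
    rw [← AlgHom.range_eq_top, eq_top_iff]
    rintro x -
    obtain ⟨g, rfl⟩ := Ideal.Quotient.mk_surjective x
    induction g using MvPolynomial.induction_on with
    | C a => exact ⟨Polynomial.C a, Polynomial.aeval_C _ _⟩
    | add p q hp hq => exact add_mem hp hq
    | mul_X p v hp =>
      rw [map_mul]
      refine mul_mem hp ?_
      rcases v with (_ | j) | q
      · exact ⟨Polynomial.X, Polynomial.aeval_X _⟩
      · have := ha j
        rw [av] at this
        rw [this]
        exact zero_mem _
      · exact q.elim0
  exact isNoetherianRing_of_surjective _ _ φ.toRingHom hφ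

open Classical in
/-- The homomorphism to a polynomial ring with `b_{-1} ↦ j` and `a_j ↦ y`, which maps all other
generators to zero. -/
noncomputable def evalAt (j : ℕ) : FreeAlg k N →ₐ[k] Polynomial k :=
  MvPolynomial.aeval (Sum.elim (fun i => if i = j then Polynomial.X else 0)
    fun q => if q.1 = 0 then Polynomial.C (j : k) else 0)

theorem evalAt_av_self (j : ℕ) : evalAt k N j (av k N j) = Polynomial.X := by
  simp [evalAt, av]

theorem evalAt_av_of_ne {i j : ℕ} (h : i ≠ j) : evalAt k N j (av k N i) = 0 := by
  simp [evalAt, av, h]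

theorem evalAt_rel (j l : ℕ) : evalAt k N j (rel k N l) = 0 := by
  rw [rel, map_sum]
  refine Finset.sum_eq_zero fun x _ => ?_
  rw [map_mul]
  by_cases hx : x.2 = j
  · have : evalAt k N j (beta k N x.1 x.2) = 0 := by
      rw [beta]
      split_ifs with h₁ h₂
      · simp [evalAt, hx, show N - 1 - x.1 = 0 by omega]
      · simp [evalAt, show ¬ N - 1 - x.1 = 0 by omega]
      · exact map_zero _
    rw [this, zero_mul]
  · rw [evalAt_av_of_ne k N hx, mul_zero]

/-- The ideals generated by the `a_j` with `j < i` form a strictly increasing chain. -/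
theorem not_isNoetherianRing :
    ¬ IsNoetherianRing (FreeAlg k N ⧸ idl k N 0 0 Set.univ) := by
  intro h
  let a (i : ℕ) : FreeAlg k N ⧸ idl k N 0 0 Set.univ := Ideal.Quotient.mk _ (av k N i)
  let f : ℕ →o Ideal (FreeAlg k N ⧸ idl k N 0 0 Set.univ) :=
    ⟨fun i => Ideal.span (a '' Set.Iio i), fun i j hij =>
      Ideal.span_mono (Set.image_mono (Set.Iio_subset_Iio hij))⟩
  obtain ⟨n, hn⟩ := monotone_stabilizes_iff_noetherian.2 h f
  have h1 : a n ∈ f n := by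
    rw [hn (n + 1) n.le_succ]
    exact Ideal.subset_span ⟨n, Nat.lt_succ_self n, rfl⟩
  have hle : idl k N 0 0 Set.univ ≤ RingHom.ker (evalAt k N n : FreeAlg k N →+* Polynomial k) :=
    idl_le_iff.2 ⟨fun l _ => evalAt_rel k N n l, fun j hj => absurd hj (Nat.not_lt_zero j),
      fun p hp => absurd hp (Nat.not_lt_zero p)⟩
  let χ := Ideal.Quotient.lift _ (evalAt k N n : FreeAlg k N →+* Polynomial k) hle
  have h2 : f n ≤ RingHom.ker χ := by
    refine Ideal.span_le.2 ?_
    rintro _ ⟨i, hi, rfl⟩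
    exact evalAt_av_of_ne k N (Nat.ne_of_lt hi)
  exact Polynomial.X_ne_zero ((evalAt_av_self k N n).symm.trans (h2 h1))

end Relations

/-! ### Coherence of the ring with one polar generator -/

section Generation

variable {B : Type u} [CommRing B] {r : ℕ} {g : Fin r → B} {J : Ideal B}

variable (g J) in
/-- The relations between the elements `g l` with coefficients in the ideal `J` belong to the module
generated by finitely many relations, whose coefficients may lie outside of `J`. -/
def FinitelyManyRelations : Prop :=
  ∃ E : Set (Fin r → B), E.Finite ∧ (∀ e ∈ E, Fintype.linearCombination B g e = 0) ∧
    ∀ y, Fintype.linearCombination B g y = 0 → (∀ l, y l ∈ J) → y ∈ Submodule.span B E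

/-- If `g m` acts invertibly on the ideal `J`, then the relations with coefficients in `J` come from
the Koszul relations with `g m`. -/
theorem FinitelyManyRelations.of_koszul (m : Fin r) (hJ : ∀ z ∈ J, ∃ q, g m * (q * z) = z) :
    FinitelyManyRelations g J := by
  refine ⟨Set.range fun l => Pi.single l (g m) - Pi.single m (g l), Set.finite_range _, ?_,
    fun y hy hyJ => ?_⟩
  · rintro _ ⟨l, rfl⟩
    rw [map_sub, Fintype.linearCombination_apply_single, Fintype.linearCombination_apply_single,
      smul_eq_mul, smul_eq_mul, mul_comm, sub_self]
  choose q hq using fun l => hJ (y l) (hyJ l)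
  have hz : ∑ l, q l * y l * g l = 0 := by
    obtain ⟨p, hp⟩ := hJ (∑ l, q l * y l * g l) (Ideal.sum_mem _ fun l _ =>
      Ideal.mul_mem_right _ _ (Ideal.mul_mem_left _ _ (hyJ l)))
    have h : g m * ∑ l, q l * y l * g l = 0 := by
      rw [Finset.mul_sum, ← hy, Fintype.linearCombination_apply]
      exact Finset.sum_congr rfl fun l _ => by rw [← mul_assoc, hq, smul_eq_mul]
    rw [← hp, mul_left_comm, h, mul_zero]
  have e : ∑ l, (q l * y l) • (Pi.single m (g l) : Fin r → B) = 0 := by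
    rw [← Pi.single_zero m, ← hz, ← LinearMap.coe_single B, map_sum]
    simp only [← smul_eq_mul, map_smul]
  have : y = ∑ l, (q l * y l) • (Pi.single l (g m) - Pi.single m (g l)) := by
    simp only [smul_sub, Finset.sum_sub_distrib]
    rw [e, sub_zero]
    ext x
    rw [Finset.sum_apply, Finset.sum_eq_single x]
    · rw [Pi.smul_apply, Pi.single_eq_same, smul_eq_mul, mul_comm, hq]
    · intro l _ hl
      rw [Pi.smul_apply, Pi.single_eq_of_ne hl.symm, smul_zero]
    · exact fun h => absurd (Finset.mem_univ x) h
  rw [this]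
  exact Submodule.sum_mem _ fun l _ => Submodule.smul_mem _ _ (Submodule.subset_span ⟨l, rfl⟩)

/-- If all `g l` are annihilated by an element that acts invertibly on the ideal `J`, then the
relations with coefficients in `J` are multiples of the trivial relations given by that element. -/
theorem FinitelyManyRelations.of_annihilator {c : B} (hc : ∀ l, c * g l = 0)
    (hJ : ∀ z ∈ J, ∃ q, c * (q * z) = z) : FinitelyManyRelations g J := by
  refine ⟨Set.range fun l => Pi.single l c, Set.finite_range _, ?_, fun y _ hyJ => ?_⟩
  · rintro _ ⟨l, rfl⟩
    rw [Fintype.linearCombination_apply_single, smul_eq_mul, hc]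
  choose q hq using fun l => hJ (y l) (hyJ l)
  have : y = ∑ l, (q l * y l) • Pi.single l c := by
    ext x
    rw [Finset.sum_apply, Finset.sum_eq_single x]
    · rw [Pi.smul_apply, Pi.single_eq_same, smul_eq_mul, mul_comm, hq]
    · intro l _ hl
      rw [Pi.smul_apply, Pi.single_eq_of_ne hl.symm, smul_zero]
    · exact fun h => absurd (Finset.mem_univ x) h
  rw [this]
  exact Submodule.sum_mem _ fun l _ => Submodule.smul_mem _ _ (Submodule.subset_span ⟨l, rfl⟩)

/-- A criterion for the finite generation of a module of relations between elements of `B` that are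
fixed by an endomorphism `ρ` of `B` whose image comes from a Noetherian ring: it suffices to
consider the relations with coefficients in the kernel of `ρ`. -/
theorem fg_ker_linearCombination {P : Type u} [CommRing P] [IsNoetherianRing P]
    (θ : P →+* B) (ρ : B →+* B) (hρ : ∀ x, ∃ t, θ t = ρ x) (hg : ∀ l, ρ (g l) = g l)
    (hJ : ∀ x, x - ρ x ∈ J) (h : FinitelyManyRelations g J) :
    (LinearMap.ker (Fintype.linearCombination B g)).FG := by
  classical
  obtain ⟨E, hE, hEg, hy⟩ := h
  let := θ.toAlgebra
  let M : Submodule P (Fin r → P) := LinearMap.ker (Fintype.linearCombination P g)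
  have hM (t : Fin r → P) : t ∈ M ↔ Fintype.linearCombination B g (fun l => θ (t l)) = 0 := Iff.rfl
  obtain ⟨T, hT⟩ : M.FG := IsNoetherian.noetherian M
  refine ⟨hE.toFinset ∪ T.image fun t l => θ (t l), le_antisymm (Submodule.span_le.2 ?_) ?_⟩
  · intro e he
    simp only [Finset.coe_union, Set.Finite.coe_toFinset, Finset.coe_image] at he
    rcases he with he | ⟨t, ht, rfl⟩
    · exact hEg e he
    · exact (hM t).1 (hT ▸ Submodule.subset_span ht)
  · intro x hx
    rw [LinearMap.mem_ker] at hx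
    choose t ht using fun l => hρ (x l)
    have h1 : Fintype.linearCombination B g (fun l => θ (t l)) = 0 := by
      have := congrArg ρ hx
      simp only [Fintype.linearCombination_apply, smul_eq_mul, map_sum, map_mul, hg, map_zero]
        at this ⊢
      simpa only [ht] using this
    have h2 : x - (fun l => θ (t l)) ∈ Submodule.span B E :=
      hy _ (by rw [map_sub, hx, h1, sub_zero]) fun l => by
        rw [Pi.sub_apply, ht]
        exact hJ (x l)
    have h3 : (fun l => θ (t l)) ∈
        Submodule.span B ((T.image fun t l => θ (t l) : Finset (Fin r → B)) : Set (Fin r → B)) := by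
      have htT : t ∈ Submodule.span P (T : Set (Fin r → P)) := hT ▸ (hM t).2 h1
      clear ht h2 h1
      induction htT using Submodule.span_induction with
      | mem t ht => exact Submodule.subset_span (Finset.mem_coe.2 (Finset.mem_image_of_mem _ ht))
      | zero =>
        simp only [Pi.zero_apply, map_zero]
        exact zero_mem _
      | add t t' _ _ h h' =>
        simp only [Pi.add_apply, map_add]
        exact add_mem h h'
      | smul p t _ h =>
        simp only [Pi.smul_apply, smul_eq_mul, map_mul]
        exact Submodule.smul_mem _ (θ p) h
    rw [← sub_add_cancel x fun l => θ (t l), Finset.coe_union, Set.Finite.coe_toFinset]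
    exact add_mem (Submodule.span_mono Set.subset_union_left h2)
      (Submodule.span_mono Set.subset_union_right h3)

theorem isCoherentRing_of_fg_ker
    (h : ∀ (r : ℕ) (g : Fin r → B), (LinearMap.ker (Fintype.linearCombination B g)).FG) :
    IsCoherentRing B := by
  intro I hI
  obtain ⟨r, g, hg⟩ := Submodule.fg_iff_exists_fin_generating_family.1 hI
  obtain rfl : LinearMap.range (Fintype.linearCombination B g) = I := by
    rw [Fintype.range_linearCombination, hg]
  refine Module.finitePresentation_of_surjective
    (Fintype.linearCombination B g).rangeRestrict (LinearMap.surjective_rangeRestrict _) ?_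
  rw [LinearMap.ker_rangeRestrict]
  exact h r g

end Generation

section Coherence

variable (k : Type u) [Field k]

/-- The ring `A_1`, presented by the elements `rel k 1 l`. -/
abbrev B : Type u := FreeAlg k 1 ⧸ idl k 1 0 0 Set.univ

namespace B

/-- The class of `a_j`. -/
noncomputable abbrev a (j : ℕ) : B k := Ideal.Quotient.mk _ (av k 1 j)

/-- The class of `b_{-1}`. -/
noncomputable abbrev b : B k := Ideal.Quotient.mk _ (MvPolynomial.X (Sum.inr 0))

theorem b_mul_a (j : ℕ) : b k * a k j = (j : k) • a k j := by
  have h : rel k 1 j = (MvPolynomial.X (Sum.inr 0) - MvPolynomial.C (j : k)) * av k 1 j := by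
    rw [rel, Finset.Nat.sum_antidiagonal_eq_sum_range_succ (fun p s => beta k 1 p s * av k 1 s),
      Finset.sum_range_succ', Finset.sum_eq_zero]
    · simp [beta]
    · intro p _
      rw [beta, dif_neg (by omega), zero_mul]
  have h' := rel_mem_idl (k := k) (N := 1) (r := 0) (s := 0) (Set.mem_univ j)
  rw [h, sub_mul, ← MvPolynomial.smul_eq_C_mul] at h'
  exact (Ideal.Quotient.mk_eq_mk_iff_sub_mem _ _).2 h'

theorem a_mul_a [CharZero k] {i j : ℕ} (h : i ≠ j) : a k i * a k j = 0 := by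
  have h1 : b k * (a k i * a k j) = (i : k) • (a k i * a k j) := by
    rw [← mul_assoc, b_mul_a, smul_mul_assoc]
  have h2 : b k * (a k i * a k j) = (j : k) • (a k i * a k j) := by
    rw [mul_left_comm, b_mul_a, mul_smul_comm]
  have h3 : ((i : k) - j) • (a k i * a k j) = 0 := by rw [sub_smul, ← h1, ← h2, sub_self]
  exact (smul_eq_zero.1 h3).resolve_left (sub_ne_zero.2 (Nat.cast_injective.ne h))

theorem aeval_b_mul_a (G : Polynomial k) (j : ℕ) :
    Polynomial.aeval (b k) G * a k j = G.eval (j : k) • a k j := by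
  induction G using Polynomial.induction_on' with
  | add p q hp hq => rw [map_add, add_mul, hp, hq, Polynomial.eval_add, add_smul]
  | monomial n c =>
    rw [Polynomial.aeval_monomial, Polynomial.eval_monomial]
    induction n with
    | zero =>
      rw [pow_zero, pow_zero, mul_one, mul_one]
      exact (Algebra.smul_def c _).symm
    | succ n ih =>
      rw [pow_succ, ← mul_assoc, mul_assoc, b_mul_a, mul_smul_comm, ih, smul_smul, pow_succ]
      congr 1
      ring

/-- The ideal generated by the `a_j` with `j` in `S`. -/
noncomputable abbrev aIdl (S : Set ℕ) : Ideal (B k) := Ideal.span (a k '' S)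

theorem exists_sub_aeval_mem (g : B k) :
    ∃ (G : Polynomial k) (i : ℕ), g - Polynomial.aeval (b k) G ∈ aIdl k (Set.Iio i) := by
  obtain ⟨f, rfl⟩ := Ideal.Quotient.mk_surjective g
  have mono {i j : ℕ} (h : i ≤ j) : aIdl k (Set.Iio i) ≤ aIdl k (Set.Iio j) :=
    Ideal.span_mono (Set.image_mono (Set.Iio_subset_Iio h))
  induction f using MvPolynomial.induction_on with
  | C c =>
    refine ⟨Polynomial.C c, 0, ?_⟩
    rw [Polynomial.aeval_C]
    have : Ideal.Quotient.mk (idl k 1 0 0 Set.univ) (MvPolynomial.C c) - algebraMap k (B k) c = 0 :=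
      sub_self _
    rw [this]
    exact zero_mem _
  | add p q hp hq =>
    obtain ⟨G, i, h⟩ := hp
    obtain ⟨G', i', h'⟩ := hq
    refine ⟨G + G', max i i', ?_⟩
    rw [map_add, map_add, add_sub_add_comm]
    exact add_mem (mono (le_max_left _ _) h) (mono (le_max_right _ _) h')
  | mul_X p v hp =>
    rcases v with j | q
    · refine ⟨0, j + 1, ?_⟩
      rw [map_zero, sub_zero, map_mul]
      exact Ideal.mul_mem_left _ _ (Ideal.subset_span ⟨j, Nat.lt_succ_self j, rfl⟩)
    · obtain rfl : q = 0 := Subsingleton.elim _ _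
      obtain ⟨G, i, h⟩ := hp
      refine ⟨G * Polynomial.X, i, ?_⟩
      rw [map_mul, map_mul, Polynomial.aeval_X, ← sub_mul]
      exact Ideal.mul_mem_right _ _ h

variable {k}

theorem mul_a_eq_zero [CharZero k] {i j : ℕ} (h : i ≤ j) {x : B k}
    (hx : x ∈ aIdl k (Set.Iio i)) : x * a k j = 0 := by
  have : aIdl k (Set.Iio i) ≤ LinearMap.ker (LinearMap.mulRight (B k) (a k j)) := by
    refine Ideal.span_le.2 ?_
    rintro _ ⟨s, hs, rfl⟩
    exact a_mul_a k (Nat.ne_of_lt (lt_of_lt_of_le hs h))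
  exact this hx

/-- The elements that act on every `a_j`, for `j ≥ i`, by multiplication with a nonzero scalar. -/
def ScalesAbove (i : ℕ) (x : B k) : Prop := ∀ j, i ≤ j → ∃ v : k, v ≠ 0 ∧ x * a k j = v • a k j

theorem scalesAbove_or_mem [CharZero k] (g : B k) :
    ∃ i, ScalesAbove i g ∨ g ∈ aIdl k (Set.Iio i) := by
  obtain ⟨G, i, h⟩ := exists_sub_aeval_mem k g
  by_cases hG : G = 0
  · rw [hG, map_zero, sub_zero] at h
    exact ⟨i, Or.inr h⟩
  · have hfin : {j : ℕ | G.eval (j : k) = 0}.Finite :=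
      Set.Finite.preimage (s := {x : k | G.IsRoot x}) Nat.cast_injective.injOn
        (Polynomial.finite_setOfPred_isRoot hG)
    obtain ⟨m, hm⟩ := hfin.bddAbove
    refine ⟨max i (m + 1), Or.inl fun j hj => ⟨G.eval (j : k), fun h0 => ?_, ?_⟩⟩
    · have : j ≤ m := hm h0
      have := le_of_max_le_right hj
      omega
    · rw [← aeval_b_mul_a, ← sub_eq_zero, ← sub_mul]
      exact mul_a_eq_zero (le_of_max_le_left hj) h

theorem ScalesAbove.exists_mul_eq {i : ℕ} {x : B k} (hx : ScalesAbove i x) {z : B k}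
    (hz : z ∈ aIdl k (Set.Ici i)) : ∃ q, x * (q * z) = z := by
  induction hz using Submodule.span_induction with
  | mem z hz =>
    obtain ⟨j, hj, rfl⟩ := hz
    obtain ⟨v, hv, h⟩ := hx j hj
    refine ⟨algebraMap k _ v⁻¹, ?_⟩
    rw [mul_left_comm, h, ← Algebra.smul_def, smul_smul, inv_mul_cancel₀ hv, one_smul]
  | zero => exact ⟨0, by ring⟩
  | add y z _ _ hy hz =>
    obtain ⟨q, hq⟩ := hy
    obtain ⟨q', hq'⟩ := hz
    -- `1 - x * q''` is the product of `1 - x * q` and `1 - x * q'`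
    refine ⟨q + q' - x * q * q', ?_⟩
    linear_combination (1 - x * q') * hq + (1 - x * q) * hq'
  | smul c z _ hz =>
    obtain ⟨q, hq⟩ := hz
    exact ⟨q, by rw [smul_eq_mul]; linear_combination c * hq⟩

theorem ScalesAbove.mono {i i' : ℕ} {x : B k} (hx : ScalesAbove i x) (h : i ≤ i') :
    ScalesAbove i' x := fun j hj => hx j (h.trans hj)

variable (k) in
/-- The product of the elements `b_{-1} - s` for `s < i`. -/
noncomputable def annihilator (i : ℕ) : B k :=
  Polynomial.aeval (b k) (∏ s ∈ Finset.range i, (Polynomial.X - Polynomial.C (s : k)))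

theorem annihilator_mul {i : ℕ} {x : B k} (hx : x ∈ aIdl k (Set.Iio i)) :
    annihilator k i * x = 0 := by
  have : aIdl k (Set.Iio i) ≤ LinearMap.ker (LinearMap.mulLeft (B k) (annihilator k i)) := by
    refine Ideal.span_le.2 ?_
    rintro _ ⟨s, hs, rfl⟩
    refine (aeval_b_mul_a k _ s).trans ?_
    rw [Polynomial.eval_prod, Finset.prod_eq_zero (Finset.mem_range.2 hs) (by simp), zero_smul]
  exact this hx

theorem scalesAbove_annihilator [CharZero k] (i : ℕ) : ScalesAbove i (annihilator k i) :=
  fun j hj => ⟨_, by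
    rw [Polynomial.eval_prod, Finset.prod_ne_zero_iff]
    intro s hs
    have := Finset.mem_range.1 hs
    simpa [sub_eq_zero] using Nat.ne_of_gt (lt_of_lt_of_le this hj), aeval_b_mul_a k _ j⟩

variable (k) in
/-- The endomorphism that maps `a_j` to zero for `j ≥ i` and keeps the other generators. -/
noncomputable def retr (i : ℕ) : B k →ₐ[k] B k :=
  Ideal.Quotient.liftₐ _ ((Ideal.Quotient.mkₐ k _).comp (trunc k 1 i)) fun x hx => by
    have : idl k 1 0 0 Set.univ ≤
        RingHom.ker ((Ideal.Quotient.mkₐ k (idl k 1 0 0 Set.univ)).comp (trunc k 1 i)) := by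
      refine idl_le_iff.2 ⟨fun l _ => ?_, fun j hj => absurd hj (Nat.not_lt_zero j),
        fun p hp => absurd hp (Nat.not_lt_zero p)⟩
      refine Ideal.Quotient.eq_zero_iff_mem.2 ?_
      change trunc k 1 i (rel k 1 l) ∈ _
      by_cases hl : l < i
      · rw [trunc_rel hl]
        exact rel_mem_idl (Set.mem_univ l)
      · rw [rel, map_sum, Finset.sum_eq_zero]
        · exact zero_mem _
        · rintro ⟨p, s⟩ hps
          rw [map_mul, trunc_beta, trunc_av]
          rw [Finset.HasAntidiagonal.mem_antidiagonal] at hps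
          by_cases hp : p = 0
          · rw [if_neg (by simp at hps; omega), mul_zero]
          · rw [beta, dif_neg (by simpa using hp), zero_mul]
    exact this hx

theorem retr_mk (i : ℕ) (f : FreeAlg k 1) :
    retr k i (Ideal.Quotient.mk _ f) = Ideal.Quotient.mk _ (trunc k 1 i f) := rfl

theorem exists_toLim_eq (i : ℕ) (x : B k) : ∃ t, toLim k 1 0 0 i t = retr k i x := by
  obtain ⟨f, rfl⟩ := Ideal.Quotient.mk_surjective x
  exact ⟨Ideal.Quotient.mk _ f, (toLim_mk f).trans (retr_mk i f).symm⟩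

theorem exists_retr_eq (g : B k) : ∃ i, ∀ j, i ≤ j → retr k j g = g := by
  obtain ⟨f, rfl⟩ := Ideal.Quotient.mk_surjective g
  obtain ⟨i, hi⟩ := exists_trunc_eq f
  refine ⟨i, fun j hj => ?_⟩
  rw [retr_mk, ← hi, trunc_trunc hj]

theorem sub_retr_mem (i : ℕ) (x : B k) : x - retr k i x ∈ aIdl k (Set.Ici i) := by
  obtain ⟨f, rfl⟩ := Ideal.Quotient.mk_surjective x
  have : ((Ideal.Quotient.mkₐ k (aIdl k (Set.Ici i))).comp
      (Ideal.Quotient.mkₐ k (idl k 1 0 0 Set.univ))) =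
      ((Ideal.Quotient.mkₐ k (aIdl k (Set.Ici i))).comp
      (Ideal.Quotient.mkₐ k (idl k 1 0 0 Set.univ))).comp (trunc k 1 i) := by
    ext v
    rcases v with j | q
    · have := trunc_av (k := k) (N := 1) i j
      rw [av] at this
      rw [AlgHom.comp_apply _ (trunc k 1 i), this]
      split_ifs with h
      · rfl
      · rw [map_zero]
        exact Ideal.Quotient.eq_zero_iff_mem.2 (Ideal.subset_span ⟨j, not_lt.1 h, rfl⟩)
    · simp [trunc]
  exact (Ideal.Quotient.mk_eq_mk_iff_sub_mem _ _).1 (AlgHom.congr_fun this f)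

variable (k) in
/-- For `i` large, either some generator `g m` of the ideal acts invertibly on the ideal of the
`a_j` with `j ≥ i`, so that the relations with coefficients in that ideal come from the Koszul
relations with `g m`, or all generators are annihilated by the product of the `b_{-1} - s` with
`s < i`, which acts invertibly on that ideal. -/
theorem isCoherentRing [CharZero k] : IsCoherentRing (B k) := by
  refine isCoherentRing_of_fg_ker fun r g => ?_
  choose i₁ h₁ using fun l => exists_retr_eq (g l)
  choose i₂ h₂ using fun l => scalesAbove_or_mem (g l)
  let i := max (Finset.univ.sup i₁) (Finset.univ.sup i₂)
  have hi₁ (l) : i₁ l ≤ i := (Finset.le_sup (Finset.mem_univ l)).trans (le_max_left _ _)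
  have hi₂ (l) : i₂ l ≤ i := (Finset.le_sup (Finset.mem_univ l)).trans (le_max_right _ _)
  refine fg_ker_linearCombination (toLim k 1 0 0 i) (retr k i : B k →+* B k)
    (exists_toLim_eq i) (fun l => h₁ l i (hi₁ l)) (sub_retr_mem i) ?_
  by_cases hm : ∃ m, ScalesAbove i (g m)
  · obtain ⟨m, hm⟩ := hm
    exact .of_koszul m fun z hz => hm.exists_mul_eq hz
  · exact .of_annihilator
      (fun l => annihilator_mul (Ideal.span_mono (Set.image_mono (Set.Iio_subset_Iio (hi₂ l)))
        ((h₂ l).resolve_left fun h => hm ⟨l, h.mono (hi₂ l)⟩)))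
      fun z hz => (scalesAbove_annihilator i).exists_mul_eq hz

end B

end Coherence

end SemiCoh

theorem proposition4p10 (k : Type u) [Field k] [CharZero k] :
    (∀ (n : ℕ) [HasDerivedCategory.{w} (ModuleCat.{u} (SemiCoh.A k n))],
      SemiCoh.IsSemiCoherent (SemiCoh.A k n)) ∧
    (∀ n : ℕ, 1 ≤ n → ¬ IsNoetherianRing (SemiCoh.A k n)) ∧
    SemiCoh.IsCoherentRing (SemiCoh.A k 1) := by
  refine ⟨fun n _ => ?_, fun n hn => ?_, ?_⟩
  · obtain rfl | hn := n.eq_zero_or_pos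
    · have := SemiCoh.isNoetherianRing_A_zero k
      exact (SemiCoh.NoetherianSystem.const (SemiCoh.A k 0)).isSemiCoherent
    · have key (I : Ideal (SemiCoh.FreeAlg k n)) (hI : I = SemiCoh.idl k n 0 0 Set.univ)
          [HasDerivedCategory.{w} (ModuleCat.{u} (SemiCoh.FreeAlg k n ⧸ I))] :
          SemiCoh.IsSemiCoherent (SemiCoh.FreeAlg k n ⧸ I) := by
        subst hI
        exact (SemiCoh.noetherianSystem k n hn).isSemiCoherent
      exact key _ (SemiCoh.relations_eq_idl k n hn)
  · change ¬ IsNoetherianRing (SemiCoh.FreeAlg k n ⧸ SemiCoh.relations k n)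
    rw [SemiCoh.relations_eq_idl k n hn]
    exact SemiCoh.not_isNoetherianRing k n
  · change SemiCoh.IsCoherentRing (SemiCoh.FreeAlg k 1 ⧸ SemiCoh.relations k 1)
    rw [SemiCoh.relations_eq_idl k 1 Nat.one_pos]
    exact SemiCoh.B.isCoherentRing k
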